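/- **Setting.** Let $(M,g)$ and $(N,h)$ be connected smooth Riemannian manifolds (Hausdorff, second countable, without boundary), not necessarily compact or complete, of dimensions $d$ and $n$, let $1<p<\infty$, and let $\mathrm{vol}_g$ be the Riemannian volume measure of $M$. Charts are those of the smooth structure. A set $A\subset M$ is *negligible* if every $x\in A$ lies in the domain $W$ of a chart $\psi$ with $|\psi(W\cap A)|=0$ (Lebesgue measure); a property holds *almost everywhere* (a.e.) in $M$ if it holds outside a negligible set. A function $v:M\to\mathbb R$ is *weakly differentiable* if for every chart $(W,\psi)$ the function $v\circ\psi^{-1}$ is locally integrable on $\psi(W)$ with a locally integrable weak gradient; its weak derivative, given by $dv=d(v\circ\psi^{-1})\circ d\psi$ in every chart, is well defined a.e. A map $u:M\to N$ is *colocally weakly differentiable* if $f\circ u$ is weakly differentiable for every $f\in C^1_c(N)$. Its *colocal weak derivative* is the (a.e. unique) family of linear maps $du_x:T_xM\to T_{u(x)}N$ with $d(f\circ u)_x=df_{u(x)}\circ du_x$ for a.e. $x\in M$, for every $f\in C^1_c(N)$. Write $|du_x|_{g,h}=\bigl(\sum_{i=1}^d|du_x(v_i)|_h^2\bigr)^{1/2}$,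 where $(v_i)$ is a $g$-orthonormal basis of $T_xM$. The space $\dot W^{1,p}(M;N)$ consists of the colocally weakly differentiable maps $u:M\to N$ (not identified when they agree a.e.) whose colocal weak derivative $du$ satisfies $|du|_{g,h}\in L^p(M,\mathrm{vol}_g)$. **Lemma.** Let $(u_k)_{k\in\mathbb N}\subset\dot W^{1,p}(M;N)$ and suppose that there is a constant $C>0$ such that $$\int_M|du_k|_{g,h}^p\,d\mathrm{vol}_g\le C\qquad\text{for all }k\in\mathbb N.$$ Let $u:M\to N$ be a map such that $u_k(x)\to u(x)$ for a.e. $x\in M$. Then $u\in\dot W^{1,p}(M;N)$ and $$\int_M|du|_{g,h}^p\,d\mathrm{vol}_g\le\liminf_{k\to\infty}\int_M|du_k|_{g,h}^p\,d\mathrm{vol}_g.$$ -/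

import Mathlib

open scoped Manifold ContDiff Topology ENNReal
open MeasureTheory Bundle

noncomputable section

/-- The Frobenius norm `(∑ i, |T vᵢ| ^ 2) ^ (1 / 2)` of a linear map between inner product spaces,
where `(vᵢ)` is an orthonormal basis of the source. The value does not depend on that basis, see
`frobeniusNorm_eq`. -/
def frobeniusNorm {V W : Type*} [NormedAddCommGroup V] [InnerProductSpace ℝ V]
    [FiniteDimensional ℝ V] [NormedAddCommGroup W] [InnerProductSpace ℝ W]
    (T : V →L[ℝ] W) : ℝ :=
  Real.sqrt (∑ i, ‖T (stdOrthonormalBasis ℝ V i)‖ ^ 2)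

theorem sum_sq_norm_apply_eq {V W ι κ : Type*} [NormedAddCommGroup V] [InnerProductSpace ℝ V]
    [FiniteDimensional ℝ V] [NormedAddCommGroup W] [InnerProductSpace ℝ W] [FiniteDimensional ℝ W]
    [Fintype ι] [Fintype κ] (v : OrthonormalBasis ι ℝ V) (w : OrthonormalBasis κ ℝ W)
    (T : V →L[ℝ] W) :
    ∑ i, ‖T (v i)‖ ^ 2 = ∑ j, ‖LinearMap.adjoint T.toLinearMap (w j)‖ ^ 2 := by
  have h1 : ∀ i, ‖T (v i)‖ ^ 2 = ∑ j, ‖(inner ℝ (w j) (T (v i)) : ℝ)‖ ^ 2 :=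
    fun i ↦ (w.sum_sq_norm_inner_right _).symm
  have h2 : ∀ j, ‖LinearMap.adjoint T.toLinearMap (w j)‖ ^ 2 =
      ∑ i, ‖(inner ℝ (LinearMap.adjoint T.toLinearMap (w j)) (v i) : ℝ)‖ ^ 2 :=
    fun j ↦ (v.sum_sq_norm_inner_left _).symm
  simp only [h1, h2]
  rw [Finset.sum_comm]
  refine Finset.sum_congr rfl fun j _ ↦ Finset.sum_congr rfl fun i _ ↦ ?_
  rw [LinearMap.adjoint_inner_left]
  rfl

theorem frobeniusNorm_eq {V W ι : Type*} [NormedAddCommGroup V] [InnerProductSpace ℝ V]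
    [FiniteDimensional ℝ V] [NormedAddCommGroup W] [InnerProductSpace ℝ W] [FiniteDimensional ℝ W]
    [Fintype ι] (v : OrthonormalBasis ι ℝ V) (T : V →L[ℝ] W) :
    frobeniusNorm T = Real.sqrt (∑ i, ‖T (v i)‖ ^ 2) := by
  unfold frobeniusNorm
  rw [sum_sq_norm_apply_eq _ (stdOrthonormalBasis ℝ W),
    sum_sq_norm_apply_eq v (stdOrthonormalBasis ℝ W)]

/-! ### Weak differentiability on open subsets of Euclidean space -/

/-- `G` is a weak derivative of the real-valued function `v` on the open set `Ω ⊆ ℝᵈ`: both are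
locally integrable in `Ω`, and integration by parts holds against every `φ ∈ C_c^∞(Ω)`. -/
def IsWeakDerivOn {d : ℕ} (Ω : Set (EuclideanSpace ℝ (Fin d)))
    (v : EuclideanSpace ℝ (Fin d) → ℝ)
    (G : EuclideanSpace ℝ (Fin d) → EuclideanSpace ℝ (Fin d) →L[ℝ] ℝ) : Prop :=
  LocallyIntegrableOn v Ω volume ∧ LocallyIntegrableOn G Ω volume ∧
    ∀ φ : EuclideanSpace ℝ (Fin d) → ℝ, ContDiff ℝ ∞ φ → HasCompactSupport φ → tsupport φ ⊆ Ω →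
      ∀ w : EuclideanSpace ℝ (Fin d),
        ∫ y in Ω, v y * fderiv ℝ φ y w = -∫ y in Ω, G y w * φ y

/-! ### Weak differentiability on a manifold

A chart of the smooth `d`-manifold `M` is an element of its maximal smooth atlas. -/

section Manifold

variable {d : ℕ} {M : Type*} [TopologicalSpace M] [ChartedSpace (EuclideanSpace ℝ (Fin d)) M]

variable (d) in
/-- `A ⊆ M` is negligible: around each of its points there is a chart `(W, ψ)` such that
`ψ (W ∩ A)` is a Lebesgue null set. -/
def Negligible (A : Set M) : Prop :=
  ∀ x ∈ A, ∃ e ∈ IsManifold.maximalAtlas (𝓡 d) ∞ M,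
    x ∈ e.source ∧ volume (e '' (e.source ∩ A)) = 0

variable (d) in
/-- `v : M → ℝ` is weakly differentiable: in every chart it is so in the Euclidean sense. -/
def WeaklyDifferentiable (v : M → ℝ) : Prop :=
  ∀ e ∈ IsManifold.maximalAtlas (𝓡 d) ∞ M, ∃ G, IsWeakDerivOn e.target (v ∘ e.symm) G

/-- The family of covectors `α x : T_xM → ℝ` is a weak derivative of `v : M → ℝ`: in every chart
`(W, ψ)`, its pullback by `ψ⁻¹` is a weak derivative of `v ∘ ψ⁻¹`, that is, `α = d(v ∘ ψ⁻¹) ∘ dψ`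
almost everywhere in `W`. Such an `α` is unique up to a negligible set, and modifying it on a
negligible set does not matter. -/
def IsWeakDeriv (v : M → ℝ) (α : ∀ x : M, TangentSpace (𝓡 d) x →L[ℝ] ℝ) : Prop :=
  ∀ e ∈ IsManifold.maximalAtlas (𝓡 d) ∞ M,
    IsWeakDerivOn e.target (v ∘ e.symm)
      (fun y ↦ (α (e.symm y)).comp (mfderiv (𝓡 d) (𝓡 d) e.symm y))

/-! ### Maps between manifolds -/

variable {n : ℕ} {N : Type*} [TopologicalSpace N] [ChartedSpace (EuclideanSpace ℝ (Fin n)) N]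

variable (d n) in
/-- `u : M → N` is colocally weakly differentiable: `f ∘ u` is weakly differentiable for every
`f ∈ C_c^1(N)`. -/
def ColocallyWeaklyDifferentiable (u : M → N) : Prop :=
  ∀ f : N → ℝ, ContMDiff (𝓡 n) 𝓘(ℝ, ℝ) 1 f → HasCompactSupport f →
    WeaklyDifferentiable d (f ∘ u)

/-- The family of linear maps `D x : T_xM → T_{u x}N` is a colocal weak derivative of `u`:
`d(f ∘ u)_x = df_{u x} ∘ D x` for almost every `x`, for every `f ∈ C_c^1(N)`. -/
def IsColocalWeakDeriv (u : M → N)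
    (D : ∀ x : M, TangentSpace (𝓡 d) x →L[ℝ] TangentSpace (𝓡 n) (u x)) : Prop :=
  ∀ f : N → ℝ, ContMDiff (𝓡 n) 𝓘(ℝ, ℝ) 1 f → HasCompactSupport f →
    IsWeakDeriv (f ∘ u) (fun x ↦
      (mfderiv (𝓡 n) 𝓘(ℝ, ℝ) f (u x) : TangentSpace (𝓡 n) (u x) →L[ℝ] ℝ).comp (D x))

variable (d n) in
open Classical in
/-- The colocal weak derivative `du` of `u` (unique up to a negligible set); the zero family if
there is none. -/
def colocalWeakDeriv (u : M → N) (x : M) :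
    TangentSpace (𝓡 d) x →L[ℝ] TangentSpace (𝓡 n) (u x) :=
  if h : ∃ D : ∀ x : M, TangentSpace (𝓡 d) x →L[ℝ] TangentSpace (𝓡 n) (u x),
    IsColocalWeakDeriv u D then h.choose x else 0

/-! ### The Riemannian volume and homogeneous Sobolev spaces -/

instance tangentSpace_finiteDimensional (x : M) :
    FiniteDimensional ℝ (TangentSpace (𝓡 d) x) :=
  inferInstanceAs (FiniteDimensional ℝ (EuclideanSpace ℝ (Fin d)))

variable [RiemannianBundle (fun x : M ↦ TangentSpace (𝓡 d) x)]

/-- The volume density `√ det (g_ij)` of the metric of `M` in the coordinates of the chart `e`,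
with `g_ij = g (∂_i, ∂_j)` and `∂_i` the coordinate vector fields of `e`. -/
def chartDensity (e : OpenPartialHomeomorph M (EuclideanSpace ℝ (Fin d)))
    (y : EuclideanSpace ℝ (Fin d)) : ℝ :=
  Real.sqrt (Matrix.det (Matrix.of fun i j : Fin d ↦
    (inner ℝ (mfderiv (𝓡 d) (𝓡 d) e.symm y (EuclideanSpace.single i (1 : ℝ)))
      (mfderiv (𝓡 d) (𝓡 d) e.symm y (EuclideanSpace.single j (1 : ℝ))) : ℝ)))

/-- The measure `√ det (g_ij) dy` on the domain of the chart `e`, extended by zero to `M`. -/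
def chartVolume [MeasurableSpace M] (e : OpenPartialHomeomorph M (EuclideanSpace ℝ (Fin d))) :
    Measure M :=
  ((volume.restrict e.target).withDensity
    (fun y ↦ ENNReal.ofReal (chartDensity e y))).map e.symm

variable (d M) in
/-- The Riemannian volume measure `vol_g`. The measures `chartVolume e` agree on the overlaps of
chart domains, and `vol_g` is the measure that restricts to `chartVolume e` on the domain of every
chart `e`; as a formula, it is their least upper bound. -/
def riemannianVolume [MeasurableSpace M] : Measure M :=
  ⨆ e ∈ IsManifold.maximalAtlas (𝓡 d) ∞ M, chartVolume e

/-- The formula for the measure `chartVolume e`. -/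
theorem chartVolume_apply [MeasurableSpace M] [BorelSpace M] (e : OpenPartialHomeomorph M (EuclideanSpace ℝ (Fin d))) {s : Set M}
    (hs : MeasurableSet s) :
    chartVolume e s = ∫⁻ y in e.target ∩ e.symm ⁻¹' s, ENNReal.ofReal (chartDensity e y) := by
  have h0 : AEMeasurable e.symm (volume.restrict e.target) :=
    e.continuousOn_symm.aemeasurable e.open_target.measurableSet
  rw [chartVolume, Measure.map_apply_of_aemeasurable
    (h0.mono_ac (withDensity_absolutelyContinuous _ _)) hs, withDensity_apply',
    Measure.restrict_restrict₀, Set.inter_comm]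
  exact h0.nullMeasurable hs

theorem sqrt_gram_det_comp {W : Type*} [NormedAddCommGroup W] [InnerProductSpace ℝ W]
    (B : EuclideanSpace ℝ (Fin d) →ₗ[ℝ] W)
    (P : EuclideanSpace ℝ (Fin d) →L[ℝ] EuclideanSpace ℝ (Fin d)) :
    Real.sqrt (Matrix.det (Matrix.of fun i j : Fin d ↦
      (inner ℝ (B (P (EuclideanSpace.single i (1 : ℝ))))
        (B (P (EuclideanSpace.single j (1 : ℝ)))) : ℝ))) =
    |P.det| * Real.sqrt (Matrix.det (Matrix.of fun i j : Fin d ↦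
      (inner ℝ (B (EuclideanSpace.single i (1 : ℝ)))
        (B (EuclideanSpace.single j (1 : ℝ))) : ℝ))) := by
  let b := (EuclideanSpace.basisFun (Fin d) ℝ).toBasis
  let β : EuclideanSpace ℝ (Fin d) →ₗ[ℝ] EuclideanSpace ℝ (Fin d) →ₗ[ℝ] ℝ :=
    (innerₗ W).compl₁₂ B B
  have e1 : (Matrix.of fun i j : Fin d ↦ (inner ℝ (B (EuclideanSpace.single i (1 : ℝ)))
        (B (EuclideanSpace.single j (1 : ℝ))) : ℝ)) = LinearMap.toMatrix₂ b b β := by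
    ext i j
    simp [LinearMap.toMatrix₂_apply, b, β]
  have e2 : (Matrix.of fun i j : Fin d ↦ (inner ℝ (B (P (EuclideanSpace.single i (1 : ℝ))))
        (B (P (EuclideanSpace.single j (1 : ℝ)))) : ℝ)) =
      LinearMap.toMatrix₂ b b (β.compl₁₂ P.toLinearMap P.toLinearMap) := by
    ext i j
    simp [LinearMap.toMatrix₂_apply, b, β]
  have e3 : (LinearMap.toMatrix b b P.toLinearMap).det = P.det := by
    rw [LinearMap.det_toMatrix]
  rw [e1, e2, LinearMap.toMatrix₂_compl₁₂ b b b b, Matrix.det_mul, Matrix.det_mul,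
    Matrix.det_transpose, e3, mul_right_comm, ← pow_two, Real.sqrt_mul (sq_nonneg _),
    Real.sqrt_sq_eq_abs]

/-- Transformation of the volume density under a change of charts. -/
theorem chartDensity_comp {e e' : OpenPartialHomeomorph M (EuclideanSpace ℝ (Fin d))}
    (he : e ∈ IsManifold.maximalAtlas (𝓡 d) ∞ M) (he' : e' ∈ IsManifold.maximalAtlas (𝓡 d) ∞ M)
    {y : EuclideanSpace ℝ (Fin d)} (hy : y ∈ e.target) (hy' : e.symm y ∈ e'.source) :
    chartDensity e y = |(fderiv ℝ (e' ∘ e.symm) y).det| * chartDensity e' (e' (e.symm y)) := by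
  have h1 : MDifferentiableAt (𝓡 d) (𝓡 d) e.symm y :=
    (contMDiffOn_symm_of_mem_maximalAtlas he).contMDiffAt (e.open_target.mem_nhds hy)
      |>.mdifferentiableAt (by simp)
  have h2 : MDifferentiableAt (𝓡 d) (𝓡 d) e' (e.symm y) :=
    (contMDiffOn_of_mem_maximalAtlas he').contMDiffAt (e'.open_source.mem_nhds hy')
      |>.mdifferentiableAt (by simp)
  have h3 : MDifferentiableAt (𝓡 d) (𝓡 d) e'.symm (e' (e.symm y)) :=
    (contMDiffOn_symm_of_mem_maximalAtlas he').contMDiffAt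
      (e'.open_target.mem_nhds (e'.map_source hy'))
      |>.mdifferentiableAt (by simp)
  set P := fderiv ℝ (e' ∘ e.symm) y with hP
  have hP' : P = mfderiv (𝓡 d) (𝓡 d) (e' ∘ e.symm) y := mfderiv_eq_fderiv.symm
  have hloc : e'.symm ∘ (e' ∘ e.symm) =ᶠ[𝓝 y] e.symm := by
    have : ∀ᶠ z in 𝓝 y, e.symm z ∈ e'.source :=
      (e.continuousAt_symm hy).eventually (e'.open_source.mem_nhds hy')
    filter_upwards [this] with z hz using e'.left_inv hz
  have hcomp : ∀ w : EuclideanSpace ℝ (Fin d),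
      (mfderiv (𝓡 d) (𝓡 d) e.symm y : EuclideanSpace ℝ (Fin d) →L[ℝ] EuclideanSpace ℝ (Fin d)) w =
      (mfderiv (𝓡 d) (𝓡 d) e'.symm (e' (e.symm y)) :
        EuclideanSpace ℝ (Fin d) →L[ℝ] EuclideanSpace ℝ (Fin d)) (P w) := by
    intro w
    have h4 := mfderiv_comp (I := 𝓡 d) (I' := 𝓡 d) (I'' := 𝓡 d) y
      (g := e'.symm) (f := e' ∘ e.symm) h3 (h2.comp y h1)
    rw [hloc.mfderiv_eq] at h4
    rw [hP']
    exact congrArg (fun A : EuclideanSpace ℝ (Fin d) →L[ℝ] EuclideanSpace ℝ (Fin d) ↦ A w) h4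
  have key : ∀ (x x' : M) (_ : x' = x)
      (A B : EuclideanSpace ℝ (Fin d) →L[ℝ] EuclideanSpace ℝ (Fin d))
      (_ : ∀ w, A w = B (P w)),
      Real.sqrt (Matrix.det (Matrix.of fun i j : Fin d ↦
        (inner ℝ (show TangentSpace (𝓡 d) x from A (EuclideanSpace.single i (1 : ℝ)))
          (show TangentSpace (𝓡 d) x from A (EuclideanSpace.single j (1 : ℝ))) : ℝ))) =
      |P.det| * Real.sqrt (Matrix.det (Matrix.of fun i j : Fin d ↦
        (inner ℝ (show TangentSpace (𝓡 d) x' from B (EuclideanSpace.single i (1 : ℝ)))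
          (show TangentSpace (𝓡 d) x' from B (EuclideanSpace.single j (1 : ℝ))) : ℝ))) := by
    intro x x' hx A B hAB
    subst hx
    obtain rfl : A = B.comp P := ContinuousLinearMap.ext hAB
    exact sqrt_gram_det_comp (W := TangentSpace (𝓡 d) x') B.toLinearMap P
  exact key _ _ (e'.left_inv hy') _ _ hcomp

/-- The measures `chartVolume e` agree on the overlaps of chart domains. -/
theorem chartVolume_apply_eq [IsManifold (𝓡 d) ∞ M] [MeasurableSpace M] [BorelSpace M]
    {e e' : OpenPartialHomeomorph M (EuclideanSpace ℝ (Fin d))}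
    (he : e ∈ IsManifold.maximalAtlas (𝓡 d) ∞ M) (he' : e' ∈ IsManifold.maximalAtlas (𝓡 d) ∞ M)
    {s : Set M} (hs : MeasurableSet s) (h : s ⊆ e.source ∩ e'.source) :
    chartVolume e s = chartVolume e' s := by
  rw [chartVolume_apply e hs, chartVolume_apply e' hs]
  set A := e.target ∩ e.symm ⁻¹' s
  have hA : MeasurableSet A := by
    have h0 : Measurable (e.target.domRestrict e.symm) :=
      (continuousOn_iff_continuous_domRestrict.1 e.continuousOn_symm).measurable
    have := (MeasurableEmbedding.subtype_coe e.open_target.measurableSet).measurableSet_image.2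
      (h0 hs)
    convert this using 1
    ext z
    simp [A, Set.domRestrict, and_comm]
  have himg : e'.target ∩ e'.symm ⁻¹' s = (e' ∘ e.symm) '' A := by
    ext z
    constructor
    · rintro ⟨hz, hzs⟩
      refine ⟨e (e'.symm z), ⟨e.map_source (h hzs).1, ?_⟩, ?_⟩
      · simpa [e.left_inv (h hzs).1] using hzs
      · simp [e.left_inv (h hzs).1, e'.right_inv hz]
    · rintro ⟨w, ⟨hw, hws⟩, rfl⟩
      refine ⟨e'.map_source (h hws).2, ?_⟩
      simpa [e'.left_inv (h hws).2] using hws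
  have hinj : Set.InjOn (e' ∘ e.symm) A := by
    intro z hz w hw hzw
    exact e.symm.injOn hz.1 hw.1 (e'.injOn (h hz.2).2 (h hw.2).2 hzw)
  have hder : ∀ y ∈ A, HasFDerivWithinAt (e' ∘ e.symm) (fderiv ℝ (e' ∘ e.symm) y) A y := by
    intro y hy
    have h1 : MDifferentiableAt (𝓡 d) (𝓡 d) e.symm y :=
      (contMDiffOn_symm_of_mem_maximalAtlas he).contMDiffAt (e.open_target.mem_nhds hy.1)
        |>.mdifferentiableAt (by simp)
    have h2 : MDifferentiableAt (𝓡 d) (𝓡 d) e' (e.symm y) :=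
      (contMDiffOn_of_mem_maximalAtlas he').contMDiffAt (e'.open_source.mem_nhds (h hy.2).2)
        |>.mdifferentiableAt (by simp)
    exact (mdifferentiableAt_iff_differentiableAt.1 (h2.comp y h1)).hasFDerivAt.hasFDerivWithinAt
  rw [himg, lintegral_image_eq_lintegral_abs_det_fderiv_mul volume hA hder hinj]
  refine setLIntegral_congr_fun hA fun y hy ↦ ?_
  rw [chartDensity_comp he he' hy.1 (h hy.2).2, ENNReal.ofReal_mul (abs_nonneg _)]
  rfl

/-- On the domain of a chart, `vol_g` is given by `√ det (g_ij) dy`. -/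
theorem riemannianVolume_restrict_source [IsManifold (𝓡 d) ∞ M] [MeasurableSpace M] [BorelSpace M]
    {e : OpenPartialHomeomorph M (EuclideanSpace ℝ (Fin d))}
    (he : e ∈ IsManifold.maximalAtlas (𝓡 d) ∞ M) :
    (riemannianVolume d M).restrict e.source = chartVolume e := by
  have hsrc : MeasurableSet e.source := e.open_source.measurableSet
  have hself : ∀ e' : OpenPartialHomeomorph M (EuclideanSpace ℝ (Fin d)),
      (chartVolume e').restrict e'.source = chartVolume e' := by
    intro e'
    refine Measure.restrict_eq_self_of_ae_mem ?_
    rw [ae_iff, show {a | a ∉ e'.source} = e'.sourceᶜ from rfl,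
      chartVolume_apply e' e'.open_source.measurableSet.compl]
    have : e'.target ∩ e'.symm ⁻¹' e'.sourceᶜ = ∅ := by
      ext z; simpa using fun hz ↦ e'.map_target hz
    rw [this]; simp
  have hle : riemannianVolume d M ≤
      chartVolume e + (riemannianVolume d M).restrict e.sourceᶜ := by
    refine iSup₂_le fun e' he' ↦ ?_
    have h1 : chartVolume e' ≤ riemannianVolume d M :=
      le_iSup₂ (f := fun e (_ : e ∈ IsManifold.maximalAtlas (𝓡 d) ∞ M) ↦
        chartVolume (M := M) e) e' he'
    rw [← Measure.restrict_add_restrict_compl (μ := chartVolume e') hsrc]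
    refine add_le_add ?_ (Measure.restrict_mono le_rfl h1)
    refine Measure.le_iff.2 fun s hs ↦ ?_
    rw [← hself e', Measure.restrict_restrict hsrc,
      Measure.restrict_apply hs]
    rw [chartVolume_apply_eq he' he (hs.inter (hsrc.inter e'.open_source.measurableSet))
      fun x hx ↦ ⟨hx.2.2, hx.2.1⟩]
    exact measure_mono Set.inter_subset_left
  refine le_antisymm ?_ ?_
  · refine (Measure.restrict_mono le_rfl hle).trans ?_
    rw [Measure.restrict_add, hself e, Measure.restrict_restrict hsrc, Set.inter_compl_self]
    simp
  · rw [← hself e]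
    exact Measure.restrict_mono le_rfl
      (le_iSup₂ (f := fun e (_ : e ∈ IsManifold.maximalAtlas (𝓡 d) ∞ M) ↦
        chartVolume (M := M) e) e he)

variable [RiemannianBundle (fun x : N ↦ TangentSpace (𝓡 n) x)]

variable (d n) in
/-- `|du|_{g,h}`, the pointwise Frobenius norm of the colocal weak derivative of `u`. -/
def colocalDerivNorm (u : M → N) (x : M) : ℝ := frobeniusNorm (colocalWeakDeriv d n u x)

variable (d n) in
/-- The `p`-Dirichlet energy `∫_M |du|^p dvol_g`, with values in `[0, ∞]`. -/
def dirichletEnergy [MeasurableSpace M] (p : ℝ) (u : M → N) : ℝ≥0∞ :=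
  ∫⁻ x, ENNReal.ofReal (colocalDerivNorm d n u x ^ p) ∂(riemannianVolume d M)

variable (d n) in
/-- `u` belongs to the homogeneous Sobolev space `Ẇ^{1,p}(M; N)`: it is colocally weakly
differentiable, and its colocal weak derivative `du` exists and satisfies `|du|_{g,h} ∈ L^p(M)`. -/
def MemHomSobolev [MeasurableSpace M] (p : ℝ) (u : M → N) : Prop :=
  ColocallyWeaklyDifferentiable d n u ∧
    (∃ D : ∀ x : M, TangentSpace (𝓡 d) x →L[ℝ] TangentSpace (𝓡 n) (u x),
      IsColocalWeakDeriv u D) ∧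
    MemLp (colocalDerivNorm d n u) (ENNReal.ofReal p) (riemannianVolume d M)

end Manifold

end

/-!
The main difficulty is that the derivatives `Du_k x` take values in the tangent spaces `T_{u_k x}N`,
which vary with `k`, so that weak convergence has to be expressed by scalar functions. This is done
with smooth Parseval frames `X_l` on `M` and `Y_a` on `N` (`ParsevalFrame.exists_countable`): locally
finite families of compactly supported vector fields with `w = ∑ l, ⟪X_l, w⟫ X_l` for every tangent
vector. The Frobenius norm of `Du_k x` is the `ℓ²` norm of the coefficients
`g_k = ⟪Y_a (u_k x), Du_k x (X_l x)⟫` (`frobeniusNorm_sq_eq`), each of which is therefore bounded in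
`L^p`.

To have a finite measure at hand, `vol_g` is replaced with `w vol_g` for an integrable weight `w`
that is bounded away from `0` on compact sets. Along an ultrafilter, the coefficients then converge weakly to
functions `G a l` (`LpBounded.exists_tendstoWeakly`), and these are the coefficients from which a
family of linear maps `L x : T_xM → T_{v x}N` is synthesized. For a continuous one-form `β` of
compact support on `N`, the function `β (u_k x) (Du_k x (X_l x))` is a finite sum of products of a
coefficient `g_k` with functions that are bounded and converge almost everywhere; hence it converges
weakly to `β (v x) (L x (X_l x))` (`tendstoWeakly_oneForm`). With `β = df` for `f ∈ C_c^1(N)`,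
integration by parts passes to the limit (`isWeakDeriv_of_tendstoWeakly`), which shows that `L` is a
colocal weak derivative of `v`. With `β = ⟪Y_a, ·⟫`, it follows that the coefficients of `L` are the
weak limits of those of `Du_k`, so that the convexity of `z ↦ |z| ^ p` gives lower semicontinuity
for every finite set of coefficients (`lintegral_le_of_tendstoWeakly`), and monotone convergence
gives it for the energy. The ultrafilter is chosen such that the energies of `u_k` stay below a
number `c > liminf` along it, and the uniqueness of the colocal weak derivative identifies the
energy of `v` with that of `L`.
-/

noncomputable section

/-! ### Weak limits of bounded sequences in `L^p` -/

section WeakLimits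

open Filter

variable {X : Type*} [MeasurableSpace X] {m : Measure X} {l : Filter ℕ}

/-- `g k → G` weakly along the filter `l`: the integrals against every bounded measurable
function converge. -/
def TendstoWeakly (m : Measure X) (l : Filter ℕ) (g : ℕ → X → ℝ) (G : X → ℝ) : Prop :=
  ∀ ψ : X → ℝ, AEStronglyMeasurable ψ m → (∃ K : ℝ, ∀ x, |ψ x| ≤ K) →
    Tendsto (fun k ↦ ∫ x, g k x * ψ x ∂m) l (𝓝 (∫ x, G x * ψ x ∂m))

/-- The sequence `g` is bounded in `L^p(m)`. Measurability is part of the notion because `eLpNorm` is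
defined for every function. -/
structure LpBounded (m : Measure X) (p : ℝ) (g : ℕ → X → ℝ) : Prop where
  aestronglyMeasurable : ∀ k, AEStronglyMeasurable (g k) m
  exists_bound : ∃ B : ℝ≥0∞, B ≠ ⊤ ∧ ∀ k, eLpNorm (g k) (ENNReal.ofReal p) m ≤ B

/-- Hölder's inequality. -/
theorem enorm_integral_mul_le_eLpNorm {p q : ℝ} (hpq : p.HolderConjugate q) {f g : X → ℝ}
    (hf : AEStronglyMeasurable f m) (hg : AEStronglyMeasurable g m) :
    ‖∫ x, f x * g x ∂m‖ₑ ≤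
      eLpNorm f (ENNReal.ofReal p) m * eLpNorm g (ENNReal.ofReal q) m := by
  refine (enorm_integral_le_lintegral_enorm _).trans ?_
  have hp := hpq.pos
  have hq := hpq.symm.pos
  rw [eLpNorm_eq_lintegral_rpow_enorm_toReal (by simpa using hp) (by simp),
    eLpNorm_eq_lintegral_rpow_enorm_toReal (by simpa using hq) (by simp),
    ENNReal.toReal_ofReal hp.le, ENNReal.toReal_ofReal hq.le]
  simp only [enorm_mul]
  exact ENNReal.lintegral_mul_le_Lp_mul_Lq m hpq hf.enorm hg.enorm

theorem tendsto_eLpNorm_zero_of_bounded [IsFiniteMeasure m] {q : ℝ} (hq : 0 < q)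
    {f : ℕ → X → ℝ} (hf : ∀ k, AEStronglyMeasurable (f k) m) {K : ℝ} (hK : ∀ k x, |f k x| ≤ K)
    (hlim : ∀ᵐ x ∂m, Tendsto (fun k ↦ f k x) atTop (𝓝 0)) :
    Tendsto (fun k ↦ eLpNorm (f k) (ENNReal.ofReal q) m) atTop (𝓝 0) := by
  have h : Tendsto (fun k ↦ ∫⁻ x, ‖f k x‖ₑ ^ q ∂m) atTop (𝓝 (∫⁻ _, 0 ∂m)) := by
    refine tendsto_lintegral_of_dominated_convergence' (fun _ ↦ ENNReal.ofReal K ^ q)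
      (fun k ↦ (hf k).enorm.pow_const q) (fun k ↦ ae_of_all _ fun x ↦ ?_) ?_ ?_
    · refine ENNReal.rpow_le_rpow ?_ hq.le
      rw [Real.enorm_eq_ofReal_abs]
      exact ENNReal.ofReal_le_ofReal (hK k x)
    · rw [lintegral_const]
      exact ENNReal.mul_ne_top (ENNReal.rpow_ne_top_of_nonneg hq.le (by simp))
        (measure_ne_top m _)
    · filter_upwards [hlim] with x hx
      have h1 : Tendsto (fun k ↦ ‖f k x‖ₑ) atTop (𝓝 0) := by
        simpa using hx.enorm
      have h2 := ((ENNReal.continuous_rpow_const (y := q)).tendsto 0).comp h1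
      rwa [ENNReal.zero_rpow_of_pos hq] at h2
  have h2 := ((ENNReal.continuous_rpow_const (y := 1 / q)).tendsto 0).comp
    (by simpa using h)
  rw [ENNReal.zero_rpow_of_pos (by positivity)] at h2
  refine h2.congr fun k ↦ ?_
  rw [eLpNorm_eq_lintegral_rpow_enorm_toReal (by simpa using hq) (by simp),
    ENNReal.toReal_ofReal hq.le]
  rfl

namespace LpBounded

variable {p : ℝ} {g : ℕ → X → ℝ}

theorem integrable [IsFiniteMeasure m] (hg : LpBounded m p g) (hp : 1 < p) (k : ℕ) :
    Integrable (g k) m := by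
  obtain ⟨B, hB, h⟩ := hg.exists_bound
  have : MemLp (g k) (ENNReal.ofReal p) m :=
    ⟨hg.aestronglyMeasurable k, (h k).trans_lt hB.lt_top⟩
  exact this.integrable (by simpa using hp.le)

/-- If the test functions `f k` are bounded and tend to zero, the pairings of `f k` with the
members of an `L^p`-bounded sequence tend to zero uniformly in that sequence. -/
theorem tendsto_integral_mul_zero [IsFiniteMeasure m] (hg : LpBounded m p g) (hp : 1 < p)
    {f : ℕ → X → ℝ} (hf : ∀ k, AEStronglyMeasurable (f k) m) {K : ℝ} (hK : ∀ k x, |f k x| ≤ K)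
    (hlim : ∀ᵐ x ∂m, Tendsto (fun k ↦ f k x) atTop (𝓝 0)) {ε : ℝ} (hε : 0 < ε) :
    ∀ᶠ i in atTop, ∀ k, |∫ x, g k x * f i x ∂m| < ε := by
  obtain ⟨B, hB, h⟩ := hg.exists_bound
  have hpq := Real.HolderConjugate.conjExponent hp
  have h0 := tendsto_eLpNorm_zero_of_bounded hpq.symm.pos hf hK hlim
  have h1 : Tendsto (fun k ↦ B * eLpNorm (f k) (ENNReal.ofReal p.conjExponent) m) atTop (𝓝 0) := by
    simpa using ENNReal.Tendsto.const_mul h0 (Or.inr hB)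
  filter_upwards [h1.eventually_lt_const (show 0 < ENNReal.ofReal ε by simpa using hε)]
    with i hi k
  have h2 := (enorm_integral_mul_le_eLpNorm hpq (hg.aestronglyMeasurable k) (hf i)).trans_lt
    ((mul_le_mul_left (h k) _).trans_lt hi)
  rw [Real.enorm_eq_ofReal_abs] at h2
  exact (ENNReal.ofReal_lt_ofReal_iff hε).1 h2

end LpBounded

namespace TendstoWeakly

variable {p : ℝ} {g : ℕ → X → ℝ} {G : X → ℝ}

/-- Weak convergence is stable under multiplication by boundedly convergent functions. -/
theorem mul_bounded [IsFiniteMeasure m] (h : TendstoWeakly m l g G) (hl : l ≤ atTop)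
    (hg : LpBounded m p g) (hp : 1 < p) {f : ℕ → X → ℝ} {F : X → ℝ}
    (hf : ∀ k, AEStronglyMeasurable (f k) m) {K : ℝ} (hK : ∀ k x, |f k x| ≤ K)
    (hKF : ∀ x, |F x| ≤ K) (hlim : ∀ᵐ x ∂m, Tendsto (fun k ↦ f k x) atTop (𝓝 (F x))) :
    TendstoWeakly m l (fun k x ↦ f k x * g k x) (fun x ↦ F x * G x) := by
  rintro ψ hψ ⟨C, hC⟩
  have hF : AEStronglyMeasurable F m := aestronglyMeasurable_of_tendsto_ae atTop hf hlim
  have h1 : Tendsto (fun k ↦ ∫ x, g k x * (F x * ψ x) ∂m) l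
      (𝓝 (∫ x, G x * (F x * ψ x) ∂m)) := by
    refine h _ (hF.mul hψ) ⟨K * C, fun x ↦ ?_⟩
    rw [abs_mul]
    exact mul_le_mul (hKF x) (hC x) (abs_nonneg _) ((abs_nonneg _).trans (hKF x))
  have h2 : Tendsto (fun k ↦ ∫ x, g k x * ((f k x - F x) * ψ x) ∂m) l (𝓝 0) := by
    refine Tendsto.mono_left ?_ hl
    rw [Metric.tendsto_nhds]
    intro ε hε
    filter_upwards [hg.tendsto_integral_mul_zero hp
      (f := fun k x ↦ (f k x - F x) * ψ x) (K := (K + K) * C)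
      (fun k ↦ ((hf k).sub hF).mul hψ) (fun k x ↦ by
        rw [abs_mul]
        exact mul_le_mul ((abs_sub _ _).trans (add_le_add (hK k x) (hKF x))) (hC x) (abs_nonneg _)
          (add_nonneg ((abs_nonneg _).trans (hKF x)) ((abs_nonneg _).trans (hKF x))))
      (by
        filter_upwards [hlim] with x hx
        simpa using (hx.sub_const (F x)).mul_const (ψ x)) hε] with k hk
    simpa using hk k
  have h3 := h1.add h2
  rw [add_zero] at h3
  have h4 : ∫ x, G x * (F x * ψ x) ∂m = ∫ x, F x * G x * ψ x ∂m := by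
    congr 1; ext x; ring
  rw [h4] at h3
  refine h3.congr fun k ↦ ?_
  have hb1 : AEStronglyMeasurable (fun x ↦ F x * ψ x) m := hF.mul hψ
  have hb2 : AEStronglyMeasurable (fun x ↦ (f k x - F x) * ψ x) m := ((hf k).sub hF).mul hψ
  rw [← integral_add]
  · congr 1; ext x; ring
  · refine (hg.integrable hp k).mul_bdd (c := K * C) hb1 (ae_of_all _ fun x ↦ ?_)
    rw [Real.norm_eq_abs, abs_mul]
    exact mul_le_mul (hKF x) (hC x) (abs_nonneg _) ((abs_nonneg _).trans (hKF x))
  · refine (hg.integrable hp k).mul_bdd (c := (K + K) * C) hb2 (ae_of_all _ fun x ↦ ?_)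
    rw [Real.norm_eq_abs, abs_mul]
    exact mul_le_mul ((abs_sub _ _).trans (add_le_add (hK k x) (hKF x))) (hC x) (abs_nonneg _)
          (add_nonneg ((abs_nonneg _).trans (hKF x)) ((abs_nonneg _).trans (hKF x)))

theorem add (h : TendstoWeakly m l g G) {g' : ℕ → X → ℝ} {G' : X → ℝ}
    (h' : TendstoWeakly m l g' G') (hg : ∀ k, Integrable (g k) m) (hg' : ∀ k, Integrable (g' k) m)
    (hG : Integrable G m) (hG' : Integrable G' m) :
    TendstoWeakly m l (fun k x ↦ g k x + g' k x) (fun x ↦ G x + G' x) := by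
  rintro ψ hψ ⟨K, hK⟩
  have key : ∀ f f' : X → ℝ, Integrable f m → Integrable f' m →
      ∫ x, (f x + f' x) * ψ x ∂m = ∫ x, f x * ψ x ∂m + ∫ x, f' x * ψ x ∂m := by
    intro f f' hf hf'
    simp only [add_mul]
    exact integral_add (hf.mul_bdd hψ (ae_of_all _ hK)) (hf'.mul_bdd hψ (ae_of_all _ hK))
  rw [key G G' hG hG']
  simp only [fun k ↦ key (g k) (g' k) (hg k) (hg' k)]
  exact (h ψ hψ ⟨K, hK⟩).add (h' ψ hψ ⟨K, hK⟩)

theorem sum {ι : Type*} (s : Finset ι) {g : ι → ℕ → X → ℝ} {G : ι → X → ℝ}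
    (h : ∀ i ∈ s, TendstoWeakly m l (g i) (G i)) (hg : ∀ i ∈ s, ∀ k, Integrable (g i k) m)
    (hG : ∀ i ∈ s, Integrable (G i) m) :
    TendstoWeakly m l (fun k x ↦ ∑ i ∈ s, g i k x) (fun x ↦ ∑ i ∈ s, G i x) := by
  classical
  induction s using Finset.induction_on with
  | empty => intro ψ _ _; simpa using tendsto_const_nhds
  | insert a s ha ih =>
    simp only [Finset.sum_insert ha]
    exact (h a (by simp)).add (ih (fun i hi ↦ h i (by simp [hi])) (fun i hi ↦ hg i (by simp [hi]))
      (fun i hi ↦ hG i (by simp [hi]))) (hg a (by simp))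
      (fun k ↦ integrable_finsetSum _ fun i hi ↦ hg i (by simp [hi]) k)
      (hG a (by simp)) (integrable_finsetSum _ fun i hi ↦ hG i (by simp [hi]))

end TendstoWeakly

/-- Weak compactness of bounded sequences in `L^p`, `1 < p`, along an ultrafilter. The limits of the
integrals over sets form a signed measure, because the sequence is uniformly integrable, and the
weak limit is its Radon-Nikodym derivative. -/
theorem LpBounded.exists_tendstoWeakly [IsFiniteMeasure m] {p : ℝ} {g : ℕ → X → ℝ}
    (hg : LpBounded m p g) (hp : 1 < p) (𝒰 : Ultrafilter ℕ) :
    ∃ G : X → ℝ, Integrable G m ∧ TendstoWeakly m 𝒰 g G := by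
  classical
  obtain ⟨B, hB, hb⟩ := hg.exists_bound
  have hpq := Real.HolderConjugate.conjExponent hp
  set q := p.conjExponent
  have hq : 0 < q := hpq.symm.pos
  have hint := hg.integrable hp
  have hbound : ∀ A, MeasurableSet A → ∀ k, ‖∫ x in A, g k x ∂m‖ₑ ≤ B * m A ^ (1 / q) := by
    intro A hA k
    have h1 : ∫ x in A, g k x ∂m = ∫ x, g k x * A.indicator (fun _ ↦ (1 : ℝ)) x ∂m := by
      rw [← integral_indicator hA]
      congr 1; ext x
      by_cases hx : x ∈ A <;> simp [hx]
    rw [h1]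
    refine (enorm_integral_mul_le_eLpNorm hpq (hg.aestronglyMeasurable k)
      (aestronglyMeasurable_const.indicator hA)).trans ?_
    rw [eLpNorm_indicator_const hA (by simpa using hq) (by simp), ENNReal.toReal_ofReal hq.le]
    simpa using mul_le_mul_left (hb k) _
  have hfin : ∀ A, B * m A ^ (1 / q) ≠ ⊤ := fun A ↦ ENNReal.mul_ne_top hB
    (ENNReal.rpow_ne_top_of_nonneg (by positivity) (measure_ne_top m A))
  have hex : ∀ A, MeasurableSet A → ∃ a : ℝ, Tendsto (fun k ↦ ∫ x in A, g k x ∂m) 𝒰 (𝓝 a) := by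
    intro A hA
    have hmem : (𝒰.map fun k ↦ ∫ x in A, g k x ∂m : Filter ℝ) ≤
        𝓟 (Metric.closedBall 0 (B * m A ^ (1 / q)).toReal) := by
      rw [le_principal_iff]
      refine Filter.Eventually.of_forall (f := (𝒰 : Filter ℕ)) fun k ↦ ?_
      rw [mem_closedBall_zero_iff, ← toReal_enorm]
      exact ENNReal.toReal_mono (hfin A) (hbound A hA k)
    obtain ⟨a, -, ha⟩ := (isCompact_closedBall _ _).ultrafilter_le_nhds _ hmem
    exact ⟨a, ha⟩
  choose! L hL using hex
  have hLle : ∀ A, MeasurableSet A → ‖L A‖ₑ ≤ B * m A ^ (1 / q) := fun A hA ↦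
    le_of_tendsto (hL A hA).enorm (Eventually.of_forall (hbound A hA))
  have hLadd : ∀ A A', MeasurableSet A → MeasurableSet A' → Disjoint A A' →
      L (A ∪ A') = L A + L A' := by
    intro A A' hA hA' hd
    refine tendsto_nhds_unique (hL _ (hA.union hA')) (((hL A hA).add (hL A' hA')).congr fun k ↦ ?_)
    rw [setIntegral_union hd hA' (hint k).integrableOn (hint k).integrableOn]
  have hLempty : L ∅ = 0 := by
    refine tendsto_nhds_unique (hL ∅ .empty) ?_
    simp
  have hLsum : ∀ f : ℕ → Set X, (∀ i, MeasurableSet (f i)) → Pairwise (Function.onFun Disjoint f) →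
      ∀ s : Finset ℕ, ∑ i ∈ s, L (f i) = L (⋃ i ∈ s, f i) := by
    intro f hf hd s
    induction s using Finset.induction_on with
    | empty => simp [hLempty]
    | insert a s ha ih =>
      rw [Finset.sum_insert ha, ih, Finset.set_biUnion_insert, hLadd _ _ (hf a)
        (s.measurableSet_biUnion fun i _ ↦ hf i)]
      rw [Set.disjoint_iUnion₂_right]
      intro i hi
      exact hd (by rintro rfl; exact ha hi)
  let ν : SignedMeasure X :=
    { measureOf' := fun A ↦ if MeasurableSet A then L A else 0
      empty' := by simp [hLempty]
      not_measurable' := fun A hA ↦ by simp [hA]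
      m_iUnion' := by
        intro f hf hd
        simp only [hf, MeasurableSet.iUnion hf, if_true]
        have hmeas : ∀ s : Finset ℕ, MeasurableSet (⋃ i : {i // i ∉ s}, f i.1) := fun s ↦
          MeasurableSet.iUnion fun i ↦ hf i.1
        have htail : ∀ s : Finset ℕ, L (⋃ i, f i) =
            L (⋃ i ∈ s, f i) + L (⋃ i : {i // i ∉ s}, f i) := by
          intro s
          rw [← hLadd _ _ (s.measurableSet_biUnion fun i _ ↦ hf i) (hmeas s)]
          · congr 1
            ext x
            simp only [Set.mem_iUnion, Set.mem_union, Subtype.exists, exists_prop]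
            constructor
            · rintro ⟨i, hi⟩
              by_cases his : i ∈ s
              exacts [Or.inl ⟨i, his, hi⟩, Or.inr ⟨i, his, hi⟩]
            · rintro (⟨i, -, hi⟩ | ⟨i, -, hi⟩) <;> exact ⟨i, hi⟩
          · rw [Set.disjoint_iUnion₂_left]
            intro i hi
            rw [Set.disjoint_iUnion_right]
            rintro ⟨j, hj⟩
            exact hd (by rintro rfl; exact hj hi)
        have h0 : Tendsto (fun s : Finset ℕ ↦ L (⋃ i : {i // i ∉ s}, f i)) atTop (𝓝 0) := by
          rw [tendsto_zero_iff_enorm_tendsto_zero]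
          have h1 := ENNReal.tendsto_tsum_compl_atTop_zero (f := fun i ↦ m (f i)) (by
            rw [← measure_iUnion hd hf]; exact measure_ne_top _ _)
          have h2 := ((ENNReal.continuous_rpow_const (y := 1 / q)).tendsto 0).comp h1
          rw [ENNReal.zero_rpow_of_pos (by positivity)] at h2
          have h3 := ENNReal.Tendsto.const_mul h2 (Or.inr hB)
          rw [mul_zero] at h3
          refine tendsto_of_tendsto_of_tendsto_of_le_of_le tendsto_const_nhds h3
            (fun _ ↦ zero_le) fun s ↦ ?_
          refine (hLle _ (hmeas s)).trans ?_
          exact mul_le_mul_right (ENNReal.rpow_le_rpow (measure_iUnion_le _) (by positivity)) _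
        have h1 : Tendsto (fun s : Finset ℕ ↦ L (⋃ i, f i) - L (⋃ i : {i // i ∉ s}, f i)) atTop
            (𝓝 (L (⋃ i, f i) - 0)) := tendsto_const_nhds.sub h0
        rw [sub_zero] at h1
        refine h1.congr fun s ↦ ?_
        rw [hLsum f hf hd, htail s, add_sub_cancel_right] }
  have hν : ∀ A, MeasurableSet A → ν A = L A := fun A hA ↦ if_pos hA
  have hac : ν ≪ᵥ m.toENNRealVectorMeasure := by
    refine VectorMeasure.AbsolutelyContinuous.mk fun A hA h0 ↦ ?_
    rw [Measure.toENNRealVectorMeasure_apply_measurable hA] at h0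
    have h1 := hLle A hA
    rw [h0, ENNReal.zero_rpow_of_pos (by positivity), mul_zero, nonpos_iff_eq_zero,
      enorm_eq_zero] at h1
    rw [hν A hA, h1]
  set G := ν.rnDeriv m
  have hG : Integrable G m := SignedMeasure.integrable_rnDeriv _ _
  have hset : ∀ A, MeasurableSet A →
      Tendsto (fun k ↦ ∫ x in A, g k x ∂m) 𝒰 (𝓝 (∫ x in A, G x ∂m)) := by
    intro A hA
    rw [← withDensityᵥ_apply hG hA, SignedMeasure.withDensityᵥ_rnDeriv_eq ν m hac, hν A hA]
    exact hL A hA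
  refine ⟨G, hG, ?_⟩
  have hsimple : ∀ s : SimpleFunc X ℝ,
      Tendsto (fun k ↦ ∫ x, g k x * s x ∂m) 𝒰 (𝓝 (∫ x, G x * s x ∂m)) := by
    intro s
    induction s using SimpleFunc.induction with
    | const c hA =>
      rename_i A
      have key : ∀ f : X → ℝ, ∫ x, f x * (SimpleFunc.piecewise A hA (SimpleFunc.const X c)
          (SimpleFunc.const X 0)) x ∂m = (∫ x in A, f x ∂m) * c := by
        intro f
        rw [← integral_indicator hA, ← integral_mul_const]
        congr 1; ext x
        by_cases hx : x ∈ A <;> simp [hx]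
      simp only [key]
      exact (hset A hA).mul_const c
    | add hd hs hs' =>
      rename_i s s'
      have hbd : ∀ s : SimpleFunc X ℝ, ∃ C, ∀ x, ‖s x‖ ≤ C := fun s ↦ s.exists_forall_norm_le
      have key : ∀ f : X → ℝ, Integrable f m → ∫ x, f x * (s + s') x ∂m =
          ∫ x, f x * s x ∂m + ∫ x, f x * s' x ∂m := by
        intro f hf
        obtain ⟨C, hC⟩ := hbd s
        obtain ⟨C', hC'⟩ := hbd s'
        rw [← integral_add (hf.mul_bdd s.aestronglyMeasurable (ae_of_all _ hC))
          (hf.mul_bdd s'.aestronglyMeasurable (ae_of_all _ hC'))]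
        simp [mul_add]
      simp only [fun k ↦ key (g k) (hint k), key G hG]
      exact hs.add hs'
  rintro ψ' hψ' ⟨K, hK⟩
  -- Bounded functions are pointwise limits of uniformly bounded simple functions.
  set ψ := hψ'.mk with hψdef
  have hψm : StronglyMeasurable ψ := hψ'.stronglyMeasurable_mk
  have hψae : ψ' =ᵐ[m] ψ := hψ'.ae_eq_mk
  have hKae : ∀ᵐ x ∂m, ‖ψ x‖ ≤ K := by
    filter_upwards [hψae] with x hx
    rw [← hx]; exact hK x
  have hcongr : ∀ f : X → ℝ, ∫ x, f x * ψ' x ∂m = ∫ x, f x * ψ x ∂m := fun f ↦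
    integral_congr_ae (by filter_upwards [hψae] with x hx; rw [hx])
  simp only [hcongr]
  rcases isEmpty_or_nonempty X with hX | ⟨⟨x0⟩⟩
  · simp [integral_of_isEmpty]
  have hK0 : 0 ≤ K := (abs_nonneg _).trans (hK x0)
  set S := hψm.approxBounded K
  have hS : ∀ i x, ‖S i x‖ ≤ K := fun i x ↦ hψm.norm_approxBounded_le hK0 i x
  have hSlim : ∀ᵐ x ∂m, Tendsto (fun i ↦ S i x) atTop (𝓝 (ψ x)) :=
    hψm.tendsto_approxBounded_ae hKae
  -- The truncation changes `S i - ψ` on a null set only, and makes the bound hold everywhere.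
  set D : ℕ → X → ℝ := fun i x ↦ (S i x - ψ x) ⊓ (K + K) ⊔ (-(K + K))
  have hDae : ∀ i, ∀ᵐ x ∂m, D i x = S i x - ψ x := by
    intro i
    filter_upwards [hKae] with x hx
    have h1 := abs_le.1 ((abs_sub (S i x) (ψ x)).trans (add_le_add (hS i x) hx))
    simp only [D]
    rw [inf_eq_left.2 h1.2, sup_eq_left.2 h1.1]
  have hDm : ∀ i, AEStronglyMeasurable (D i) m := fun i ↦
    (((S i).aestronglyMeasurable.sub hψm.aestronglyMeasurable).congr
      (by filter_upwards [hDae i] with x hx; exact hx.symm))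
  have hDlim : ∀ᵐ x ∂m, Tendsto (fun i ↦ D i x) atTop (𝓝 0) := by
    filter_upwards [hSlim, ae_all_iff.2 hDae] with x hx hx'
    simp only [hx']
    simpa using hx.sub_const (ψ x)
  have hDb : ∀ i x, |D i x| ≤ K + K := fun i x ↦
    abs_le.2 ⟨le_sup_right, sup_le inf_le_right (by linarith)⟩
  have hsplit : ∀ f : X → ℝ, Integrable f m → ∀ i,
      ∫ x, f x * D i x ∂m = ∫ x, f x * S i x ∂m - ∫ x, f x * ψ x ∂m := by
    intro f hf i
    rw [← integral_sub (hf.mul_bdd (S i).aestronglyMeasurable (ae_of_all _ (hS i)))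
      (hf.mul_bdd hψm.aestronglyMeasurable hKae)]
    refine integral_congr_ae ?_
    filter_upwards [hDae i] with x hx
    rw [hx, mul_sub]
  have hGlim : Tendsto (fun i ↦ ∫ x, G x * D i x ∂m) atTop (𝓝 0) := by
    have := tendsto_integral_of_dominated_convergence (F := fun i x ↦ G x * D i x)
      (f := fun _ ↦ (0 : ℝ)) (μ := m) (fun x ↦ ‖G x‖ * (K + K))
      (fun i ↦ hG.aestronglyMeasurable.mul (hDm i)) (hG.norm.mul_const _)
      (fun i ↦ ae_of_all _ fun x ↦ by
        rw [norm_mul]; exact mul_le_mul_of_nonneg_left (hDb i x) (norm_nonneg _))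
      (by filter_upwards [hDlim] with x hx; simpa using hx.const_mul (G x))
    simpa using this
  rw [Metric.tendsto_nhds]
  intro ε hε
  obtain ⟨i, hi1, hi2⟩ := ((hg.tendsto_integral_mul_zero hp hDm hDb hDlim
    (show 0 < ε / 3 by linarith)).and
    (hGlim.eventually (Metric.ball_mem_nhds _ (show 0 < ε / 3 by linarith)))).exists
  filter_upwards [(hsimple (S i)).eventually (Metric.ball_mem_nhds _ (show 0 < ε / 3 by linarith))]
    with k hk
  have h1 := hi1 k
  rw [hsplit _ (hint k)] at h1
  rw [dist_zero_right, Real.norm_eq_abs, hsplit _ hG] at hi2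
  rw [Real.dist_eq] at hk
  rw [Real.dist_eq]
  rw [abs_lt] at *
  constructor <;> linarith [h1.1, h1.2, hi2.1, hi2.2, hk.1, hk.2]

/-- The tangent-plane inequality for the convex function `z ↦ |z| ^ p` on `ℝ^ι`. -/
theorem rpow_sqrt_sum_sq_add_le {ι : Type*} [Fintype ι] {p : ℝ} (hp : 1 < p) (a b : ι → ℝ) :
    Real.sqrt (∑ i, a i ^ 2) ^ p +
      ∑ i, p * Real.sqrt (∑ i, a i ^ 2) ^ (p - 2) * a i * (b i - a i) ≤
      Real.sqrt (∑ i, b i ^ 2) ^ p := by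
  set s := Real.sqrt (∑ i, a i ^ 2) with hs
  set t := Real.sqrt (∑ i, b i ^ 2) with ht
  have hs0 : 0 ≤ s := Real.sqrt_nonneg _
  have ht0 : 0 ≤ t := Real.sqrt_nonneg _
  have hss : s ^ 2 = ∑ i, a i ^ 2 := Real.sq_sqrt (Finset.sum_nonneg fun i _ ↦ sq_nonneg _)
  have htt : t ^ 2 = ∑ i, b i ^ 2 := Real.sq_sqrt (Finset.sum_nonneg fun i _ ↦ sq_nonneg _)
  have hcs : ∑ i, a i * b i ≤ s * t := by
    refine abs_le_of_sq_le_sq' ?_ (mul_nonneg hs0 ht0) |>.2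
    rw [mul_pow, hss, htt]
    exact Finset.sum_mul_sq_le_sq_mul_sq _ _ _
  have hsum : ∑ i, p * s ^ (p - 2) * a i * (b i - a i) =
      p * s ^ (p - 2) * (∑ i, a i * b i - s ^ 2) := by
    rw [hss, ← Finset.sum_sub_distrib, Finset.mul_sum]
    exact Finset.sum_congr rfl fun i _ ↦ by ring
  rw [hsum]
  rcases hs0.eq_or_lt with h0 | h0
  · have hz : ∑ i, a i * b i ≤ 0 := by simpa [← h0] using hcs
    rw [← h0, Real.zero_rpow (by linarith)]
    have h1 : 0 ≤ p * (0 : ℝ) ^ (p - 2) :=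
      mul_nonneg (by linarith) (Real.rpow_nonneg le_rfl _)
    have h2 : p * (0 : ℝ) ^ (p - 2) * (∑ i, a i * b i - 0 ^ 2) ≤ 0 :=
      mul_nonpos_of_nonneg_of_nonpos h1 (by simpa using hz)
    have h3 := Real.rpow_nonneg ht0 p
    linarith
  · have h1 : p * s ^ (p - 2) * (∑ i, a i * b i - s ^ 2) ≤ p * s ^ (p - 2) * (s * t - s ^ 2) :=
      mul_le_mul_of_nonneg_left (by linarith) (by positivity)
    refine (add_le_add_right h1 _).trans ?_
    have h2 := one_add_mul_self_le_rpow_one_add (s := t / s - 1) (p := p)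
      (by have := div_nonneg ht0 hs0; linarith) hp.le
    have h3 : s ^ p * (1 + p * (t / s - 1)) ≤ t ^ p := by
      refine (mul_le_mul_of_nonneg_left h2 (by positivity)).trans_eq ?_
      rw [← Real.mul_rpow hs0 (by have := div_nonneg ht0 hs0; linarith)]
      congr 1; field_simp; ring
    refine le_trans (le_of_eq ?_) h3
    have h4 : s ^ p = s ^ (p - 2) * s ^ 2 := by
      rw [← Real.rpow_natCast, ← Real.rpow_add h0]; congr 1; push_cast; ring
    rw [h4]; field_simp

/-- Weak lower semicontinuity of weighted `L^p` norms of vector valued functions. On the set where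
the limit and the weight `θ` are bounded, the tangent-plane inequality at the limit involves only
bounded test functions; these sets exhaust the space. -/
theorem lintegral_le_of_tendstoWeakly [IsFiniteMeasure m] [l.NeBot] {ι : Type*} [Fintype ι]
    {p : ℝ} (hp : 1 < p) {g : ι → ℕ → X → ℝ} {G : ι → X → ℝ}
    (hg : ∀ i k, Integrable (g i k) m) (hG : ∀ i, Integrable (G i) m)
    (hw : ∀ i, TendstoWeakly m l (g i) (G i)) {θ : X → ℝ} (hθ : AEStronglyMeasurable θ m)
    (hθ0 : ∀ x, 0 ≤ θ x) {c : ℝ≥0∞}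
    (hc : ∃ᶠ k in l,
      ∫⁻ x, ENNReal.ofReal (Real.sqrt (∑ i, g i k x ^ 2) ^ p * θ x) ∂m ≤ c) :
    ∫⁻ x, ENNReal.ofReal (Real.sqrt (∑ i, G i x ^ 2) ^ p * θ x) ∂m ≤ c := by
  rcases eq_or_ne c ⊤ with rfl | hctop
  · exact le_top
  set N : X → ℝ := fun x ↦ Real.sqrt (∑ i, G i x ^ 2) with hN
  have hNm : AEMeasurable N m := by
    refine Real.continuous_sqrt.measurable.comp_aemeasurable ?_
    exact Finset.aemeasurable_fun_sum _ fun i _ ↦ (hG i).aemeasurable.pow_const 2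
  have hN0 : ∀ x, 0 ≤ N x := fun x ↦ Real.sqrt_nonneg _
  set A : ℕ → Set X := fun R ↦ {x | N x ≤ R ∧ θ x ≤ R} with hA
  have hAm : ∀ R, NullMeasurableSet (A R) m := fun R ↦
    (nullMeasurableSet_le hNm aemeasurable_const).inter
      (nullMeasurableSet_le hθ.aemeasurable aemeasurable_const)
  have hmono : Monotone A := by
    intro R R' hRR x hx
    have : (R : ℝ) ≤ R' := by exact_mod_cast hRR
    exact ⟨hx.1.trans this, hx.2.trans this⟩
  have hUnion : ⋃ R, A R = Set.univ := by
    refine Set.eq_univ_of_forall fun x ↦ Set.mem_iUnion.2 ?_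
    obtain ⟨R, hR⟩ := exists_nat_ge (max (N x) (θ x))
    exact ⟨R, (le_max_left _ _).trans hR, (le_max_right _ _).trans hR⟩
  have key : ∀ R : ℕ, ∫⁻ x in A R, ENNReal.ofReal (N x ^ p * θ x) ∂m ≤ c := by
    intro R
    have hR0 : (0 : ℝ) ≤ R := R.cast_nonneg
    -- The test function is the differential of `z ↦ |z| ^ p` at the limit, times `θ`, cut off to
    -- `A R`.
    set V : ι → X → ℝ := fun i ↦
      (A R).indicator fun x ↦ p * N x ^ (p - 2) * G i x * θ x with hV
    have hVm : ∀ i, AEStronglyMeasurable (V i) m := by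
      intro i
      refine AEStronglyMeasurable.indicator₀ ?_ (hAm R)
      exact ((((hNm.pow_const (p - 2)).const_mul p).mul (hG i).aemeasurable).mul
        hθ.aemeasurable).aestronglyMeasurable
    have hVb : ∀ i x, |V i x| ≤ p * (R : ℝ) ^ (p - 1) * R := by
      intro i x
      have hpos : 0 ≤ p * (R : ℝ) ^ (p - 1) * R :=
        mul_nonneg (mul_nonneg (by linarith) (Real.rpow_nonneg hR0 _)) hR0
      by_cases hx : x ∈ A R
      · rw [hV]
        simp only [Set.indicator_of_mem hx]
        rw [abs_mul, abs_mul, abs_mul, abs_of_nonneg (hθ0 x), abs_of_nonneg (by linarith : 0 ≤ p),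
          abs_of_nonneg (Real.rpow_nonneg (hN0 x) _), mul_assoc p]
        have hGN : |G i x| ≤ N x := by
          rw [hN, ← Real.sqrt_sq_eq_abs]
          exact Real.sqrt_le_sqrt (Finset.single_le_sum (f := fun i ↦ G i x ^ 2)
            (fun j _ ↦ sq_nonneg _) (Finset.mem_univ i))
        have h1 : N x ^ (p - 2) * |G i x| ≤ (R : ℝ) ^ (p - 1) := by
          rcases (hN0 x).eq_or_lt with h0 | h0
          · have : |G i x| = 0 := le_antisymm (h0 ▸ hGN) (abs_nonneg _)
            rw [this, mul_zero]
            exact Real.rpow_nonneg hR0 _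
          · calc N x ^ (p - 2) * |G i x| ≤ N x ^ (p - 2) * N x :=
                  mul_le_mul_of_nonneg_left hGN (Real.rpow_nonneg (hN0 x) _)
              _ = N x ^ (p - 1) := by
                  rw [← Real.rpow_add_one h0.ne']; congr 1; ring
              _ ≤ _ := Real.rpow_le_rpow (hN0 x) hx.1 (by linarith)
        exact mul_le_mul (mul_le_mul_of_nonneg_left h1 (by linarith)) hx.2 (hθ0 x)
          (mul_nonneg (by linarith) (Real.rpow_nonneg hR0 _))
      · rw [hV]
        simpa [Set.indicator_of_notMem hx] using hpos
    have hVint : ∀ i (f : X → ℝ), Integrable f m → Integrable (fun x ↦ f x * V i x) m :=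
      fun i f hf ↦ hf.mul_bdd (hVm i) (ae_of_all _ (hVb i))
    have hlim : Tendsto (fun k ↦ ∑ i, (∫ x, g i k x * V i x ∂m - ∫ x, G i x * V i x ∂m)) l
        (𝓝 0) := by
      have : Tendsto (fun k ↦ ∑ i, (∫ x, g i k x * V i x ∂m - ∫ x, G i x * V i x ∂m)) l
          (𝓝 (∑ i : ι, (0 : ℝ))) := by
        refine tendsto_finsetSum _ fun i _ ↦ ?_
        have := (hw i (V i) (hVm i) ⟨_, hVb i⟩).sub_const (∫ x, G i x * V i x ∂m)
        rwa [sub_self] at this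
      simpa using this
    have hNint : IntegrableOn (fun x ↦ N x ^ p * θ x) (A R) m := by
      refine Measure.integrableOn_of_bounded (M := (R : ℝ) ^ p * R) (measure_ne_top _ _)
        ((hNm.pow_const p).mul hθ.aemeasurable).aestronglyMeasurable ?_
      refine (ae_restrict_iff'₀ (hAm R)).2 (ae_of_all _ fun x hx ↦ ?_)
      rw [Real.norm_of_nonneg (mul_nonneg (Real.rpow_nonneg (hN0 x) _) (hθ0 x))]
      exact mul_le_mul (Real.rpow_le_rpow (hN0 x) hx.1 (by linarith)) hx.2 (hθ0 x)
        (Real.rpow_nonneg hR0 _)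
    have hstep : ∀ k,
        ∫⁻ x, ENNReal.ofReal (Real.sqrt (∑ i, g i k x ^ 2) ^ p * θ x) ∂m ≤ c →
        ∫ x in A R, N x ^ p * θ x ∂m +
          ∑ i, (∫ x, g i k x * V i x ∂m - ∫ x, G i x * V i x ∂m) ≤ c.toReal := by
      intro k hk
      set Nk : X → ℝ := fun x ↦ Real.sqrt (∑ i, g i k x ^ 2) with hNk
      have hNkm : AEMeasurable Nk m := by
        refine Real.continuous_sqrt.measurable.comp_aemeasurable ?_
        exact Finset.aemeasurable_fun_sum _ fun i _ ↦ (hg i k).aemeasurable.pow_const 2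
      have hNk0 : ∀ x, 0 ≤ Nk x ^ p * θ x := fun x ↦
        mul_nonneg (Real.rpow_nonneg (Real.sqrt_nonneg _) _) (hθ0 x)
      have hNkaesm : AEStronglyMeasurable (fun x ↦ Nk x ^ p * θ x) m :=
        ((hNkm.pow_const p).mul hθ.aemeasurable).aestronglyMeasurable
      have hNkint : Integrable (fun x ↦ Nk x ^ p * θ x) m := by
        refine ⟨hNkaesm, ?_⟩
        rw [hasFiniteIntegral_iff_ofReal (ae_of_all _ hNk0)]
        exact hk.trans_lt hctop.lt_top
      have hle1 : ∫ x, Nk x ^ p * θ x ∂m ≤ c.toReal := by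
        rw [integral_eq_lintegral_of_nonneg_ae (ae_of_all _ hNk0) hNkaesm]
        exact ENNReal.toReal_mono hctop hk
      refine le_trans ?_ hle1
      have hsub : ∀ i, Integrable (fun x ↦ g i k x * V i x - G i x * V i x) m := fun i ↦
        (hVint i _ (hg i k)).sub (hVint i _ (hG i))
      have heq : ∑ i, (∫ x, g i k x * V i x ∂m - ∫ x, G i x * V i x ∂m) =
          ∫ x, ∑ i, (g i k x * V i x - G i x * V i x) ∂m := by
        rw [integral_finsetSum _ fun i _ ↦ hsub i]
        exact Finset.sum_congr rfl fun i _ ↦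
          (integral_sub (hVint i _ (hg i k)) (hVint i _ (hG i))).symm
      rw [heq, ← integral_indicator₀ (hAm R), ← integral_add]
      · refine integral_mono ?_ hNkint fun x ↦ ?_
        · exact (hNint.integrable_indicator₀ (hAm R)).add
            (integrable_finsetSum _ fun i _ ↦ hsub i)
        · by_cases hx : x ∈ A R
          · have h1 := mul_le_mul_of_nonneg_right
              (rpow_sqrt_sum_sq_add_le hp (fun i ↦ G i x) (fun i ↦ g i k x)) (hθ0 x)
            refine le_trans (le_of_eq ?_) h1
            simp only [hV, Set.indicator_of_mem hx, hN, add_mul, Finset.sum_mul]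
            congr 1
            exact Finset.sum_congr rfl fun i _ ↦ by ring
          · simpa [hV, Set.indicator_of_notMem hx] using hNk0 x
      · exact hNint.integrable_indicator₀ (hAm R)
      · exact integrable_finsetSum _ fun i _ ↦ hsub i
    have hfinal : ∫ x in A R, N x ^ p * θ x ∂m ≤ c.toReal := by
      by_contra! hcon
      have h1 := hlim.eventually (Metric.ball_mem_nhds _ (sub_pos.2 hcon))
      obtain ⟨k, hk1, hk2⟩ := (hc.and_eventually h1).exists
      have h2 := hstep k hk1
      rw [dist_zero_right, Real.norm_eq_abs] at hk2
      linarith [(abs_lt.1 hk2).1]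
    rw [← ofReal_integral_eq_lintegral_ofReal hNint (ae_of_all _ fun x ↦
      mul_nonneg (Real.rpow_nonneg (hN0 x) _) (hθ0 x))]
    exact ENNReal.ofReal_le_of_le_toReal hfinal
  have h1 : ∫⁻ x, ENNReal.ofReal (N x ^ p * θ x) ∂m =
      ⨆ R, ∫⁻ x in A R, ENNReal.ofReal (N x ^ p * θ x) ∂m := by
    rw [← setLIntegral_univ, ← hUnion]
    exact setLIntegral_iUnion_of_directed _ hmono.directed_le
  rw [h1]
  exact iSup_le key

end WeakLimits

/-! ### Coordinate fields and Parseval frames on a Riemannian manifold -/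

section Frames

universe u

variable {d : ℕ} {M : Type u} [TopologicalSpace M] [ChartedSpace (EuclideanSpace ℝ (Fin d)) M]

/-- The vector field on the domain of the chart `e` whose coordinates in `e` are constantly `w`.
The derivative of `e.symm` at `e x` takes values in `T_{e.symm (e x)}M`, which is `T_xM` for `x` in
the domain of `e`. -/
def coordField (e : OpenPartialHomeomorph M (EuclideanSpace ℝ (Fin d)))
    (w : EuclideanSpace ℝ (Fin d)) (x : M) : TangentSpace (𝓡 d) x :=
  (mfderiv (𝓡 d) (𝓡 d) e.symm (e x) : EuclideanSpace ℝ (Fin d) →L[ℝ] EuclideanSpace ℝ (Fin d)) w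

variable {e : OpenPartialHomeomorph M (EuclideanSpace ℝ (Fin d))}

theorem coordField_symm {y : EuclideanSpace ℝ (Fin d)} (hy : y ∈ e.target)
    (w : EuclideanSpace ℝ (Fin d)) :
    coordField e w (e.symm y) = mfderiv (𝓡 d) (𝓡 d) e.symm y w := by
  have key : ∀ y', y' = y →
      (mfderiv (𝓡 d) (𝓡 d) e.symm y' : EuclideanSpace ℝ (Fin d) →L[ℝ] EuclideanSpace ℝ (Fin d)) w =
      (mfderiv (𝓡 d) (𝓡 d) e.symm y : EuclideanSpace ℝ (Fin d) →L[ℝ] EuclideanSpace ℝ (Fin d)) w := by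
    rintro _ rfl; rfl
  exact key _ (e.right_inv hy)

theorem coordField_sum (e : OpenPartialHomeomorph M (EuclideanSpace ℝ (Fin d)))
    (w : EuclideanSpace ℝ (Fin d)) (x : M) :
    coordField e w x = ∑ b, w b • coordField e (EuclideanSpace.single b 1) x := by
  have h : w = ∑ b, w b • EuclideanSpace.single b (1 : ℝ) := by
    ext i; simp [Finset.sum_apply, Pi.single_apply]
  have key : ∀ A : EuclideanSpace ℝ (Fin d) →L[ℝ] EuclideanSpace ℝ (Fin d),
      A w = ∑ b, w b • A (EuclideanSpace.single b (1 : ℝ)) := by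
    intro A
    conv_lhs => rw [h]
    simp only [map_sum, map_smul]
  exact key _

theorem mdifferentiableAt_chart (he : e ∈ IsManifold.maximalAtlas (𝓡 d) ∞ M) {x : M}
    (hx : x ∈ e.source) : MDifferentiableAt (𝓡 d) (𝓡 d) e x :=
  (contMDiffOn_of_mem_maximalAtlas he).contMDiffAt (e.open_source.mem_nhds hx)
    |>.mdifferentiableAt (by simp)

theorem mdifferentiableAt_chart_symm (he : e ∈ IsManifold.maximalAtlas (𝓡 d) ∞ M)
    {y : EuclideanSpace ℝ (Fin d)} (hy : y ∈ e.target) :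
    MDifferentiableAt (𝓡 d) (𝓡 d) e.symm y :=
  (contMDiffOn_symm_of_mem_maximalAtlas he).contMDiffAt (e.open_target.mem_nhds hy)
    |>.mdifferentiableAt (by simp)

theorem mfderiv_coordField (he : e ∈ IsManifold.maximalAtlas (𝓡 d) ∞ M) {x : M}
    (hx : x ∈ e.source) (w : EuclideanSpace ℝ (Fin d)) :
    mfderiv (𝓡 d) (𝓡 d) e x (coordField e w x) = w := by
  have h1 := mdifferentiableAt_chart_symm he (e.map_source hx)
  have h2 : MDifferentiableAt (𝓡 d) (𝓡 d) e (e.symm (e x)) := by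
    rw [e.left_inv hx]; exact mdifferentiableAt_chart he hx
  have h3 := mfderiv_comp (I := 𝓡 d) (I' := 𝓡 d) (I'' := 𝓡 d) (e x) h2 h1
  have h4 : e ∘ e.symm =ᶠ[𝓝 (e x)] id := by
    filter_upwards [e.open_target.mem_nhds (e.map_source hx)] with z hz using e.right_inv hz
  rw [h4.mfderiv_eq, mfderiv_id] at h3
  have h5 : w = (mfderiv (𝓡 d) (𝓡 d) e (e.symm (e x)) :
      EuclideanSpace ℝ (Fin d) →L[ℝ] EuclideanSpace ℝ (Fin d)) (coordField e w x) :=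
    congrArg (fun A : EuclideanSpace ℝ (Fin d) →L[ℝ] EuclideanSpace ℝ (Fin d) ↦ A w) h3
  have key : ∀ x', x' = x → (mfderiv (𝓡 d) (𝓡 d) e x' :
      EuclideanSpace ℝ (Fin d) →L[ℝ] EuclideanSpace ℝ (Fin d)) (coordField e w x) =
      (mfderiv (𝓡 d) (𝓡 d) e x :
      EuclideanSpace ℝ (Fin d) →L[ℝ] EuclideanSpace ℝ (Fin d)) (coordField e w x) := by
    rintro _ rfl; rfl
  exact (key _ (e.left_inv hx)).symm.trans h5.symm

theorem coordField_mfderiv (he : e ∈ IsManifold.maximalAtlas (𝓡 d) ∞ M) {x : M}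
    (hx : x ∈ e.source) (v : TangentSpace (𝓡 d) x) :
    coordField e (mfderiv (𝓡 d) (𝓡 d) e x v) x = v := by
  have h1 := mdifferentiableAt_chart_symm he (e.map_source hx)
  have h2 := mdifferentiableAt_chart he hx
  have h3 := mfderiv_comp (I := 𝓡 d) (I' := 𝓡 d) (I'' := 𝓡 d) x h1 h2
  have h4 : e.symm ∘ e =ᶠ[𝓝 x] id := by
    filter_upwards [e.open_source.mem_nhds hx] with z hz using e.left_inv hz
  rw [h4.mfderiv_eq, mfderiv_id] at h3
  exact (congrArg (fun A : EuclideanSpace ℝ (Fin d) →L[ℝ] EuclideanSpace ℝ (Fin d) ↦ A v) h3).symm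

theorem linearIndependent_coordField (he : e ∈ IsManifold.maximalAtlas (𝓡 d) ∞ M) {x : M}
    (hx : x ∈ e.source) :
    LinearIndependent ℝ fun b : Fin d ↦ coordField e (EuclideanSpace.single b 1) x := by
  refine LinearIndependent.of_comp (mfderiv (𝓡 d) (𝓡 d) e x).toLinearMap ?_
  have : (mfderiv (𝓡 d) (𝓡 d) e x).toLinearMap ∘
      (fun b : Fin d ↦ coordField e (EuclideanSpace.single b 1) x) =
      (EuclideanSpace.basisFun (Fin d) ℝ) := by
    ext1 b
    simpa using mfderiv_coordField he hx (EuclideanSpace.single b 1)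
  rw [this]
  exact (EuclideanSpace.basisFun (Fin d) ℝ).toBasis.linearIndependent

section Smooth

variable [IsManifold (𝓡 d) ∞ M]

theorem contMDiffOn_coordField (he : e ∈ IsManifold.maximalAtlas (𝓡 d) ∞ M)
    (w : EuclideanSpace ℝ (Fin d)) :
    ContMDiffOn (𝓡 d) (𝓡 d).tangent ∞
      (fun x ↦ (⟨x, coordField e w x⟩ : TangentBundle (𝓡 d) M)) e.source := by
  have h1 := (contMDiffOn_symm_of_mem_maximalAtlas he).contMDiffOn_tangentMapWithin
    (m := ∞) (by simp) e.open_target.uniqueMDiffOn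
  have h2 : ContMDiff (𝓡 d) (𝓡 d).tangent ∞ (fun y : EuclideanSpace ℝ (Fin d) ↦
      (⟨y, w⟩ : TangentBundle (𝓡 d) (EuclideanSpace ℝ (Fin d)))) := by
    exact contMDiff_vectorSpace_iff_contDiff.2 contDiff_const
  have h3 := (h1.comp h2.contMDiffOn (s := e.target) fun y hy ↦ hy).comp
    (contMDiffOn_of_mem_maximalAtlas he) e.mapsTo
  refine h3.congr fun x hx ↦ ?_
  have key : ∀ (x' : M) (_ : x' = x) (A : EuclideanSpace ℝ (Fin d)),
      (⟨x, A⟩ : TangentBundle (𝓡 d) M) = ⟨x', A⟩ := by rintro _ rfl _; rfl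
  have h4 : mfderivWithin (𝓡 d) (𝓡 d) e.symm e.target (e x) = mfderiv (𝓡 d) (𝓡 d) e.symm (e x) :=
    mfderivWithin_of_isOpen e.open_target (e.map_source hx)
  simp only [Function.comp, tangentMapWithin]
  rw [h4]
  exact key _ (e.left_inv hx) _

end Smooth

/-- The derivative of a `C^1` map along a continuous vector field is continuous. -/
theorem ContMDiffOn.continuousOn_mfderiv_apply [IsManifold (𝓡 d) 1 M]
    {F : Type*} [NormedAddCommGroup F] [NormedSpace ℝ F] {f : M → F} {s : Set M} (hs : IsOpen s)
    (hf : ContMDiffOn (𝓡 d) 𝓘(ℝ, F) 1 f s) {X : ∀ x : M, TangentSpace (𝓡 d) x}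
    (hX : ContinuousOn (fun x ↦ (⟨x, X x⟩ : TangentBundle (𝓡 d) M)) s) :
    ContinuousOn (fun x ↦ (mfderiv (𝓡 d) 𝓘(ℝ, F) f x (X x) : F)) s := by
  have h1 := hf.continuousOn_tangentMapWithin le_rfl hs.uniqueMDiffOn
  have h2 := (contMDiff_snd_tangentBundle_modelSpace F 𝓘(ℝ, F) (n := 0)).continuous.comp_continuousOn
    (h1.comp hX fun x hx ↦ hx)
  refine h2.congr fun x hx ↦ ?_
  simp only [Function.comp, tangentMapWithin]
  rw [mfderivWithin_of_isOpen hs hx]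

variable [IsManifold (𝓡 d) ∞ M] [RiemannianBundle (fun x : M ↦ TangentSpace (𝓡 d) x)]

/-- The Gram-Schmidt orthonormalization of the coordinate frame of the chart `e`. -/
def orthoFrame (e : OpenPartialHomeomorph M (EuclideanSpace ℝ (Fin d))) (x : M) :
    OrthonormalBasis (Fin d) ℝ (TangentSpace (𝓡 d) x) :=
  InnerProductSpace.gramSchmidtOrthonormalBasis (𝕜 := ℝ)
    (by rw [Fintype.card_fin]; exact finrank_euclideanSpace_fin (𝕜 := ℝ) (n := d))
    fun b ↦ coordField e (EuclideanSpace.single b 1) x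

variable (d M) in
/-- A smooth Parseval frame: vector fields `X l` with `w = ∑ l, ⟪X l, w⟫ X l` for every tangent
vector `w`, each supported in a compact subset `K l` of the domain of the preferred chart at
`center l`, the family `K` being locally finite. The sum runs over any finite set of indices that
contains those of the frame vectors which do not vanish at the point. -/
structure ParsevalFrame (ι : Type*) where
  /-- The vector fields. -/
  field : ι → ∀ x : M, TangentSpace (𝓡 d) x
  /-- The base points of the charts containing the supports. -/
  center : ι → M
  /-- The supports. -/
  K : ι → Set M
  contMDiff : ∀ l, ContMDiff (𝓡 d) (𝓡 d).tangent ∞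
    (fun x ↦ (⟨x, field l x⟩ : TangentBundle (𝓡 d) M))
  isCompact : ∀ l, IsCompact (K l)
  subset_source : ∀ l, K l ⊆ (chartAt (EuclideanSpace ℝ (Fin d)) (center l)).source
  eq_zero : ∀ l, ∀ x ∉ K l, field l x = 0
  locallyFinite : LocallyFinite K
  sum_eq : ∀ (x : M) (s : Finset ι), (∀ l, field l x ≠ 0 → l ∈ s) →
    ∀ w : TangentSpace (𝓡 d) x, ∑ l ∈ s, (inner ℝ (field l x) w : ℝ) • field l x = w

namespace ParsevalFrame

variable {ι : Type*} (X : ParsevalFrame d M ι)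

theorem continuous (l : ι) : Continuous (fun x ↦ (⟨x, X.field l x⟩ : TangentBundle (𝓡 d) M)) :=
  (X.contMDiff l).continuous

theorem finite_inter_compact {S : Set M} (hS : IsCompact S) :
    {l | (X.K l ∩ S).Nonempty}.Finite :=
  X.locallyFinite.finite_nonempty_inter_compact hS

/-- The indices `l` with `x ∈ K l`, outside of which the frame vectors vanish at `x`. -/
def supp (x : M) : Finset ι := (X.finite_inter_compact (isCompact_singleton (x := x))).toFinset

theorem mem_supp {x : M} {l : ι} (h : X.field l x ≠ 0) : l ∈ X.supp x := by
  rw [supp, Set.Finite.mem_toFinset]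
  refine ⟨x, ?_, rfl⟩
  by_contra hx
  exact h (X.eq_zero l x hx)

theorem sum_sq_inner (x : M) (s : Finset ι) (hs : ∀ l, X.field l x ≠ 0 → l ∈ s)
    (w : TangentSpace (𝓡 d) x) : ∑ l ∈ s, (inner ℝ (X.field l x) w : ℝ) ^ 2 = ‖w‖ ^ 2 := by
  rw [← real_inner_self_eq_norm_sq]
  conv_rhs => rw [← X.sum_eq x s hs w]
  rw [sum_inner]
  refine Finset.sum_congr rfl fun l _ ↦ ?_
  rw [real_inner_smul_left, X.sum_eq x s hs w, sq]

theorem sum_sq_inner_le (x : M) (s : Finset ι) (w : TangentSpace (𝓡 d) x) :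
    ∑ l ∈ s, (inner ℝ (X.field l x) w : ℝ) ^ 2 ≤ ‖w‖ ^ 2 := by
  classical
  rw [← X.sum_sq_inner x (s ∪ X.supp x) (fun l hl ↦ Finset.mem_union_right _ (X.mem_supp hl)) w]
  exact Finset.sum_le_sum_of_subset_of_nonneg Finset.subset_union_left fun _ _ _ ↦ sq_nonneg _

theorem norm_field_le (l : ι) (x : M) : ‖X.field l x‖ ≤ 1 := by
  have h1 := X.sum_sq_inner_le x {l} (X.field l x)
  rw [Finset.sum_singleton, real_inner_self_eq_norm_sq] at h1
  have h2 := norm_nonneg (X.field l x)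
  by_contra! h
  nlinarith [pow_pos (zero_lt_one.trans h) 2, one_lt_pow₀ h two_ne_zero]

end ParsevalFrame

variable [IsContMDiffRiemannianBundle (𝓡 d) ∞ (EuclideanSpace ℝ (Fin d))
      (fun x : M ↦ TangentSpace (𝓡 d) x)]

theorem contMDiffOn_orthoFrame (he : e ∈ IsManifold.maximalAtlas (𝓡 d) ∞ M) (a : Fin d) :
    ContMDiffOn (𝓡 d) (𝓡 d).tangent ∞
      (fun x ↦ (⟨x, orthoFrame e x a⟩ : TangentBundle (𝓡 d) M)) e.source := by
  set f : ∀ x : M, Fin d → TangentSpace (𝓡 d) x :=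
    fun x b ↦ coordField e (EuclideanSpace.single b 1) x with hf
  have hf' : ∀ b, ContMDiffOn (𝓡 d) (𝓡 d).tangent ∞
      (fun x ↦ (⟨x, f x b⟩ : TangentBundle (𝓡 d) M)) e.source :=
    fun b ↦ contMDiffOn_coordField he _
  have hne : ∀ x ∈ e.source, ∀ b, InnerProductSpace.gramSchmidt ℝ (f x) b ≠ 0 :=
    fun x hx b ↦ InnerProductSpace.gramSchmidt_ne_zero b (linearIndependent_coordField he hx)
  have hGS : ∀ b, ContMDiffOn (𝓡 d) (𝓡 d).tangent ∞
      (fun x ↦ (⟨x, InnerProductSpace.gramSchmidt ℝ (f x) b⟩ : TangentBundle (𝓡 d) M))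
      e.source := by
    intro b
    induction b using WellFoundedLT.induction with
    | ind b ih =>
      have h1 : ∀ c ∈ Finset.Iio b, ContMDiffOn (𝓡 d) (𝓡 d).tangent ∞ (fun x ↦
          (⟨x, (inner ℝ (InnerProductSpace.gramSchmidt ℝ (f x) c) (f x b) /
            inner ℝ (InnerProductSpace.gramSchmidt ℝ (f x) c)
              (InnerProductSpace.gramSchmidt ℝ (f x) c)) •
            InnerProductSpace.gramSchmidt ℝ (f x) c⟩ : TangentBundle (𝓡 d) M)) e.source := by
        intro c hc
        have hc' := ih c (Finset.mem_Iio.1 hc)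
        exact ContMDiffOn.smul_section ((hc'.inner_bundle (hf' b)).div₀ (hc'.inner_bundle hc')
          fun x hx ↦ inner_self_ne_zero.2 (hne x hx c)) hc'
      have h2 := (hf' b).sub_section (ContMDiffOn.sum_section h1)
      refine h2.congr fun x hx ↦ ?_
      rw [InnerProductSpace.gramSchmidt_def]
      simp [Submodule.starProjection_singleton]
  have hnorm : ContMDiffOn (𝓡 d) 𝓘(ℝ, ℝ) ∞
      (fun x ↦ (Real.sqrt (inner ℝ (InnerProductSpace.gramSchmidt ℝ (f x) a)
        (InnerProductSpace.gramSchmidt ℝ (f x) a)))⁻¹) e.source := by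
    refine ContMDiffOn.inv₀ ?_ fun x hx ↦ ?_
    · intro x hx
      have h1 := (hGS a).inner_bundle (hGS a) x hx
      have h2 : ContDiffAt ℝ ∞ Real.sqrt (inner ℝ (InnerProductSpace.gramSchmidt ℝ (f x) a)
        (InnerProductSpace.gramSchmidt ℝ (f x) a)) :=
        Real.contDiffAt_sqrt (inner_self_ne_zero.2 (hne x hx a))
      exact h2.contMDiffAt.comp_contMDiffWithinAt x h1
    · rw [Real.sqrt_ne_zero']
      exact real_inner_self_pos.2 (hne x hx a)
  refine (ContMDiffOn.smul_section hnorm (hGS a)).congr fun x hx ↦ ?_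
  have h1 : InnerProductSpace.gramSchmidtNormed ℝ (f x) a ≠ 0 := by
    rw [← norm_ne_zero_iff, InnerProductSpace.gramSchmidtNormed_unit_length a
      (linearIndependent_coordField he hx)]
    exact one_ne_zero
  rw [orthoFrame, InnerProductSpace.gramSchmidtOrthonormalBasis_apply _ h1,
    InnerProductSpace.gramSchmidtNormed, norm_eq_sqrt_real_inner]
  rfl

/-- Local orthonormal frames, multiplied by smooth functions `χ i` with `∑ i, χ i ^ 2 = 1`, together
form a Parseval frame. -/
theorem ParsevalFrame.exists_countable [T2Space M] [SecondCountableTopology M] :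
    ∃ (ι : Type u) (_ : Countable ι), Nonempty (ParsevalFrame d M ι) := by
  have : LocallyCompactSpace M := ChartedSpace.locallyCompactSpace (EuclideanSpace ℝ (Fin d)) M
  have : SigmaCompactSpace M := inferInstance
  obtain ⟨κ, fs, -⟩ := SmoothBumpCovering.exists_isSubordinate (𝓡 d) (M := M)
    (U := fun _ ↦ Set.univ) isClosed_univ (fun _ _ ↦ Filter.univ_mem)
  have hκ : Countable κ := Set.countable_univ_iff.1
    (fs.locallyFinite.countable_univ fun i ↦ (fs i).nonempty_support)
  set σ : M → ℝ := fun x ↦ ∑ᶠ i, fs i x ^ 2 with hσ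
  have hsupp : ∀ i, (Function.support fun x ↦ fs i x ^ 2) ⊆ Function.support (fs i) := by
    intro i x hx h0
    exact hx (by simp [h0])
  have hσsm : ContMDiff (𝓡 d) 𝓘(ℝ, ℝ) ∞ σ :=
    contMDiff_finsum (fun i ↦ (fs i).contMDiff.pow 2) (fs.locallyFinite.subset hsupp)
  have hσfin : ∀ x, (Function.support fun i ↦ fs i x ^ 2) ⊆ (fs.point_finite x).toFinset := by
    intro x i hi
    simp only [Set.Finite.coe_toFinset, Set.mem_ofPred_eq]
    intro h0
    exact hi (by simp [h0])
  have hσpos : ∀ x, 0 < σ x := by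
    intro x
    rw [hσ]
    simp only
    rw [finsum_eq_sum_of_support_subset _ (hσfin x)]
    refine Finset.sum_pos' (fun i _ ↦ sq_nonneg _) ⟨fs.ind x (Set.mem_univ x), ?_, ?_⟩
    · simpa using fs.mem_support_ind x (Set.mem_univ x)
    · simp [fs.apply_ind x (Set.mem_univ x)]
  set χ : κ → M → ℝ := fun i x ↦ fs i x * (Real.sqrt (σ x))⁻¹ with hχ
  have hχsm : ∀ i, ContMDiff (𝓡 d) 𝓘(ℝ, ℝ) ∞ (χ i) := by
    intro i
    refine (fs i).contMDiff.mul (ContMDiff.inv₀ (fun x ↦ ?_) fun x ↦ ?_)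
    · exact (Real.contDiffAt_sqrt (hσpos x).ne').contMDiffAt.comp x (hσsm x)
    · exact (Real.sqrt_pos.2 (hσpos x)).ne'
  have hχsupp : ∀ i, tsupport (χ i) ⊆ tsupport (fs i) := by
    intro i
    refine closure_mono fun x hx h0 ↦ hx ?_
    simp [hχ, h0]
  refine ⟨κ × Fin d, inferInstance, ⟨{
    field := fun l x ↦ χ l.1 x • orthoFrame (chartAt (EuclideanSpace ℝ (Fin d)) (fs.c l.1)) x l.2
    center := fun l ↦ fs.c l.1
    K := fun l ↦ tsupport (fs l.1)
    contMDiff := ?_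
    isCompact := fun l ↦ (fs l.1).hasCompactSupport
    subset_source := fun l ↦ (fs l.1).tsupport_subset_chartAt_source
    eq_zero := ?_
    locallyFinite := ?_
    sum_eq := ?_ }⟩⟩
  · rintro ⟨i, a⟩
    exact ContMDiffOn.smul_section_of_tsupport (hχsm i).contMDiffOn
      (chartAt (EuclideanSpace ℝ (Fin d)) (fs.c i)).open_source
      ((hχsupp i).trans (fs i).tsupport_subset_chartAt_source)
      (contMDiffOn_orthoFrame (IsManifold.chart_mem_maximalAtlas _) a)
  · rintro ⟨i, a⟩ x hx
    have : fs i x = 0 := image_eq_zero_of_notMem_tsupport hx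
    simp [hχ, this]
  · intro x
    obtain ⟨t, ht, hfin⟩ := fs.locallyFinite.closure x
    refine ⟨t, ht, (hfin.prod (Set.finite_univ (α := Fin d))).subset ?_⟩
    rintro ⟨i, a⟩ h
    exact ⟨h, Set.mem_univ _⟩
  · intro x s hs w
    set F : κ × Fin d → TangentSpace (𝓡 d) x := fun l ↦
      χ l.1 x • orthoFrame (chartAt (EuclideanSpace ℝ (Fin d)) (fs.c l.1)) x l.2 with hF
    have h1 : ∑ l ∈ s, (inner ℝ (F l) w : ℝ) • F l = ∑ᶠ l, (inner ℝ (F l) w : ℝ) • F l := by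
      refine (finsum_eq_sum_of_support_subset _ fun l hl ↦ hs l fun h0 ↦ hl ?_).symm
      change F l = 0 at h0
      simp [h0]
    have h2 : ∑ l ∈ (fs.point_finite x).toFinset ×ˢ (Finset.univ : Finset (Fin d)),
        (inner ℝ (F l) w : ℝ) • F l = ∑ᶠ l, (inner ℝ (F l) w : ℝ) • F l := by
      refine (finsum_eq_sum_of_support_subset _ fun l hl ↦ ?_).symm
      simp only [Finset.coe_product, Set.Finite.coe_toFinset, Finset.coe_univ, Set.mem_prod,
        Set.mem_ofPred_eq, Set.mem_univ, and_true]
      intro h0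
      exact hl (by simp [hF, hχ, h0])
    change ∑ l ∈ s, (inner ℝ (F l) w : ℝ) • F l = w
    rw [h1, ← h2, Finset.sum_product]
    have h3 : ∀ i, ∑ a, (inner ℝ (F (i, a)) w : ℝ) • F (i, a) = (χ i x ^ 2) • w := by
      intro i
      conv_rhs => rw [← (orthoFrame (chartAt (EuclideanSpace ℝ (Fin d)) (fs.c i)) x).sum_repr' w]
      rw [Finset.smul_sum]
      refine Finset.sum_congr rfl fun a _ ↦ ?_
      simp only [hF, real_inner_smul_left, smul_smul]
      congr 1; ring
    simp only [h3]
    rw [← Finset.sum_smul]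
    have h4 : ∑ i ∈ (fs.point_finite x).toFinset, χ i x ^ 2 = 1 := by
      have h5 : σ x = ∑ i ∈ (fs.point_finite x).toFinset, fs i x ^ 2 :=
        finsum_eq_sum_of_support_subset _ (hσfin x)
      simp only [hχ, mul_pow, inv_pow, Real.sq_sqrt (hσpos x).le]
      rw [← Finset.sum_mul, ← h5, mul_inv_cancel₀ (hσpos x).ne']
    rw [h4, one_smul]

end Frames

/-! ### The Riemannian volume in charts -/

section Volume

universe u

variable {d : ℕ} {M : Type u} [TopologicalSpace M] [ChartedSpace (EuclideanSpace ℝ (Fin d)) M]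
  [RiemannianBundle (fun x : M ↦ TangentSpace (𝓡 d) x)]
  {e : OpenPartialHomeomorph M (EuclideanSpace ℝ (Fin d))}

theorem chartDensity_pos (he : e ∈ IsManifold.maximalAtlas (𝓡 d) ∞ M)
    {y : EuclideanSpace ℝ (Fin d)} (hy : y ∈ e.target) : 0 < chartDensity e y := by
  have h1 := linearIndependent_coordField he (e.map_target hy)
  simp only [coordField_symm hy] at h1
  exact Real.sqrt_pos.2 (Matrix.posDef_gram_of_linearIndependent h1).det_pos

theorem continuousOn_chartDensity [IsManifold (𝓡 d) ∞ M]
    [IsContMDiffRiemannianBundle (𝓡 d) ∞ (EuclideanSpace ℝ (Fin d))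
      (fun x : M ↦ TangentSpace (𝓡 d) x)] (he : e ∈ IsManifold.maximalAtlas (𝓡 d) ∞ M) :
    ContinuousOn (chartDensity e) e.target := by
  have h1 : ContinuousOn (fun x : M ↦ Real.sqrt (Matrix.det (Matrix.of fun i j : Fin d ↦
      (inner ℝ (coordField e (EuclideanSpace.single i (1 : ℝ)) x)
        (coordField e (EuclideanSpace.single j (1 : ℝ)) x) : ℝ)))) e.source := by
    refine Real.continuous_sqrt.comp_continuousOn ?_
    refine (continuous_id.matrix_det).comp_continuousOn ?_
    refine continuousOn_pi.2 fun i ↦ continuousOn_pi.2 fun j ↦ ?_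
    exact ((contMDiffOn_coordField he _).inner_bundle (contMDiffOn_coordField he _)).continuousOn
  refine (h1.comp e.continuousOn_symm e.mapsTo_symm).congr fun y hy ↦ ?_
  simp only [Function.comp, coordField_symm hy]
  rfl

variable [IsManifold (𝓡 d) ∞ M] [MeasurableSpace M] [BorelSpace M]

theorem riemannianVolume_inter_source_eq_zero (he : e ∈ IsManifold.maximalAtlas (𝓡 d) ∞ M)
    {A : Set M} (hA : volume (e.target ∩ e.symm ⁻¹' A) = 0) :
    riemannianVolume d M (A ∩ e.source) = 0 := by
  obtain ⟨B, hAB, hB, hB0⟩ := exists_measurable_superset_of_null hA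
  have hm : MeasurableSet (e.source ∩ e ⁻¹' B) := by
    have h0 : Measurable (e.source.domRestrict e) :=
      (continuousOn_iff_continuous_domRestrict.1 e.continuousOn).measurable
    have := (MeasurableEmbedding.subtype_coe e.open_source.measurableSet).measurableSet_image.2
      (h0 hB)
    convert this using 1
    ext z
    simp [Set.domRestrict, and_comm]
  have hsub : A ∩ e.source ⊆ e.source ∩ e ⁻¹' B := fun x hx ↦
    ⟨hx.2, hAB ⟨e.map_source hx.2, by simpa [e.left_inv hx.2] using hx.1⟩⟩
  refine measure_mono_null hsub ?_
  have h1 : riemannianVolume d M (e.source ∩ e ⁻¹' B) = chartVolume e (e.source ∩ e ⁻¹' B) := by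
    rw [← riemannianVolume_restrict_source he, Measure.restrict_apply hm]
    congr 1
    ext x; simp; tauto
  rw [h1, chartVolume_apply e hm]
  refine setLIntegral_measure_zero _ _ (measure_mono_null ?_ hB0)
  rintro y ⟨hy, -, hyB⟩
  simpa [e.right_inv hy] using hyB

theorem map_absolutelyContinuous (he : e ∈ IsManifold.maximalAtlas (𝓡 d) ∞ M) :
    ((riemannianVolume d M).restrict e.source).map e ≪ volume.restrict e.target := by
  refine Measure.AbsolutelyContinuous.mk fun A hA h0 ↦ ?_
  have hm : AEMeasurable e ((riemannianVolume d M).restrict e.source) :=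
    e.continuousOn.aemeasurable e.open_source.measurableSet
  rw [Measure.map_apply_of_aemeasurable hm hA, Measure.restrict_apply₀ (hm.nullMeasurable hA)]
  refine riemannianVolume_inter_source_eq_zero he ?_
  rw [Measure.restrict_apply hA] at h0
  refine measure_mono_null ?_ h0
  rintro y ⟨hy, hyA⟩
  rw [Set.mem_preimage, Set.mem_preimage, e.right_inv hy] at hyA
  exact ⟨hyA, hy⟩

/-- A function on `M` which in the chart `e` is given by a measurable function. -/
theorem aemeasurable_restrict_source {β : Type*} [MeasurableSpace β] {f : M → β}
    (he : e ∈ IsManifold.maximalAtlas (𝓡 d) ∞ M)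
    (hf : AEMeasurable (fun y ↦ f (e.symm y)) (volume.restrict e.target)) :
    AEMeasurable f ((riemannianVolume d M).restrict e.source) := by
  have h1 := (hf.mono_ac (map_absolutelyContinuous he)).comp_aemeasurable'
    (e.continuousOn.aemeasurable e.open_source.measurableSet)
  refine h1.congr ?_
  filter_upwards [ae_restrict_mem e.open_source.measurableSet] with x hx
  rw [e.left_inv hx]

section SecondCountable

variable [SecondCountableTopology M]

theorem riemannianVolume_eq_zero_of_charts {A : Set M}
    (hA : ∀ x ∈ A, ∃ e ∈ IsManifold.maximalAtlas (𝓡 d) ∞ M, x ∈ e.source ∧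
      volume (e.target ∩ e.symm ⁻¹' A) = 0) : riemannianVolume d M A = 0 := by
  refine measure_null_of_locally_null A fun x hx ↦ ?_
  obtain ⟨e, he, hxe, h0⟩ := hA x hx
  exact ⟨A ∩ e.source, Filter.inter_mem self_mem_nhdsWithin
    (mem_nhdsWithin_of_mem_nhds (e.open_source.mem_nhds hxe)),
    riemannianVolume_inter_source_eq_zero he h0⟩

theorem Negligible.riemannianVolume_eq_zero {A : Set M} (hA : Negligible d A) :
    riemannianVolume d M A = 0 := by
  refine riemannianVolume_eq_zero_of_charts fun x hx ↦ ?_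
  obtain ⟨e, he, hxe, h0⟩ := hA x hx
  refine ⟨e, he, hxe, measure_mono_null ?_ h0⟩
  rintro y ⟨hy, hyA⟩
  exact ⟨e.symm y, ⟨e.map_target hy, hyA⟩, e.right_inv hy⟩

theorem aemeasurable_of_charts {β : Type*} [MeasurableSpace β] {f : M → β}
    (hf : ∀ e ∈ IsManifold.maximalAtlas (𝓡 d) ∞ M,
      AEMeasurable (fun y ↦ f (e.symm y)) (volume.restrict e.target)) :
    AEMeasurable f (riemannianVolume d M) := by
  obtain ⟨s, hs, hcover⟩ := TopologicalSpace.countable_cover_nhds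
    (f := fun x : M ↦ (chartAt (EuclideanSpace ℝ (Fin d)) x).source)
    fun x ↦ (chartAt (EuclideanSpace ℝ (Fin d)) x).open_source.mem_nhds (mem_chart_source _ x)
  have := hs.to_subtype
  rw [Set.biUnion_eq_iUnion] at hcover
  rw [← Measure.restrict_univ (μ := riemannianVolume d M), ← hcover, aemeasurable_iUnion_iff]
  exact fun x ↦ aemeasurable_restrict_source (IsManifold.chart_mem_maximalAtlas _)
    (hf _ (IsManifold.chart_mem_maximalAtlas _))

end SecondCountable

variable [IsContMDiffRiemannianBundle (𝓡 d) ∞ (EuclideanSpace ℝ (Fin d))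
      (fun x : M ↦ TangentSpace (𝓡 d) x)]

/-- The volume density is positive, so that null sets of the volume are Lebesgue null in charts. -/
theorem volume_preimage_eq_zero (he : e ∈ IsManifold.maximalAtlas (𝓡 d) ∞ M) {A : Set M}
    (hA : riemannianVolume d M A = 0) : volume (e.target ∩ e.symm ⁻¹' A) = 0 := by
  obtain ⟨B, hAB, hB, hB0⟩ := exists_measurable_superset_of_null hA
  have hAB' : e.target ∩ e.symm ⁻¹' A ⊆ e.target ∩ e.symm ⁻¹' B :=
    Set.inter_subset_inter_right _ (Set.preimage_mono hAB)
  refine measure_mono_null hAB' ?_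
  have h1 : chartVolume e B = 0 := by
    rw [← riemannianVolume_restrict_source he, Measure.restrict_apply hB]
    exact measure_mono_null Set.inter_subset_left hB0
  rw [chartVolume, Measure.map_apply_of_aemeasurable ((e.continuousOn_symm.aemeasurable
    e.open_target.measurableSet).mono_ac (withDensity_absolutelyContinuous _ _)) hB] at h1
  have h2 : volume.restrict e.target ≪ (volume.restrict e.target).withDensity
      (fun y ↦ ENNReal.ofReal (chartDensity e y)) := by
    refine withDensity_absolutelyContinuous' ?_ ?_
    · exact ((continuousOn_chartDensity he).aemeasurable
        e.open_target.measurableSet).ennreal_ofReal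
    · filter_upwards [ae_restrict_mem e.open_target.measurableSet] with y hy
      simpa using chartDensity_pos he hy
  have h3 := h2 h1
  rwa [Measure.restrict_apply₀', Set.inter_comm] at h3
  exact e.open_target.measurableSet.nullMeasurableSet

theorem map_symm_absolutelyContinuous (he : e ∈ IsManifold.maximalAtlas (𝓡 d) ∞ M) :
    (volume.restrict e.target).map e.symm ≪ riemannianVolume d M := by
  refine Measure.AbsolutelyContinuous.mk fun A hA h0 ↦ ?_
  have hm : AEMeasurable e.symm (volume.restrict e.target) :=
    e.continuousOn_symm.aemeasurable e.open_target.measurableSet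
  rw [Measure.map_apply_of_aemeasurable hm hA, Measure.restrict_apply₀ (hm.nullMeasurable hA),
    Set.inter_comm]
  exact volume_preimage_eq_zero he h0

theorem AEMeasurable.comp_chart_symm {β : Type*} [MeasurableSpace β] {f : M → β}
    (hf : AEMeasurable f (riemannianVolume d M)) (he : e ∈ IsManifold.maximalAtlas (𝓡 d) ∞ M) :
    AEMeasurable (fun y ↦ f (e.symm y)) (volume.restrict e.target) :=
  (hf.mono_ac (map_symm_absolutelyContinuous he)).comp_aemeasurable'
    (e.continuousOn_symm.aemeasurable e.open_target.measurableSet)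

theorem ae_comp_chart_symm {P : M → Prop} (hP : ∀ᵐ x ∂riemannianVolume d M, P x)
    (he : e ∈ IsManifold.maximalAtlas (𝓡 d) ∞ M) :
    ∀ᵐ y ∂volume.restrict e.target, P (e.symm y) :=
  ae_of_ae_map (e.continuousOn_symm.aemeasurable e.open_target.measurableSet)
    ((map_symm_absolutelyContinuous he).ae_le hP)

variable (d M) in
theorem isLocallyFiniteMeasure_riemannianVolume :
    IsLocallyFiniteMeasure (riemannianVolume d M) := by
  refine ⟨fun x ↦ ?_⟩
  set e := chartAt (EuclideanSpace ℝ (Fin d)) x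
  have he : e ∈ IsManifold.maximalAtlas (𝓡 d) ∞ M := IsManifold.chart_mem_maximalAtlas _
  obtain ⟨K, hK, hxK, hKt⟩ := exists_compact_subset e.open_target
    (e.map_source (mem_chart_source _ x))
  obtain ⟨C, hC⟩ := hK.exists_bound_of_continuousOn ((continuousOn_chartDensity he).mono hKt)
  have hm : IsOpen (e.source ∩ e ⁻¹' interior K) := e.isOpen_inter_preimage isOpen_interior
  refine ⟨e.source ∩ e ⁻¹' interior K, hm.mem_nhds ⟨mem_chart_source _ x, hxK⟩, ?_⟩
  have h1 : riemannianVolume d M (e.source ∩ e ⁻¹' interior K) =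
      chartVolume e (e.source ∩ e ⁻¹' interior K) := by
    rw [← riemannianVolume_restrict_source he, Measure.restrict_apply hm.measurableSet]
    congr 1
    ext x; simp; tauto
  rw [h1, chartVolume_apply e hm.measurableSet]
  have h2 : e.target ∩ e.symm ⁻¹' (e.source ∩ e ⁻¹' interior K) ⊆ K := by
    rintro y ⟨hy, -, hyK⟩
    rw [Set.mem_preimage, e.right_inv hy] at hyK
    exact interior_subset hyK
  calc ∫⁻ y in e.target ∩ e.symm ⁻¹' (e.source ∩ e ⁻¹' interior K),
        ENNReal.ofReal (chartDensity e y)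
      ≤ ∫⁻ y in K, ENNReal.ofReal (chartDensity e y) := lintegral_mono_set h2
    _ ≤ ∫⁻ _ in K, ENNReal.ofReal C := setLIntegral_mono measurable_const fun y hy ↦
        ENNReal.ofReal_le_ofReal ((le_abs_self _).trans (hC y hy))
    _ < ⊤ := by
        rw [setLIntegral_const]
        exact ENNReal.mul_lt_top ENNReal.ofReal_lt_top hK.measure_lt_top

variable (d) in
/-- A weight `w` on `M` with values in `(0, 1]`, integrable with respect to the volume, and bounded
away from `0` on compact sets. The measure `w vol_g` is finite, and has the same null sets as
`vol_g`. -/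
structure IsVolumeWeight (w : M → ℝ≥0∞) : Prop where
  measurable : Measurable w
  ne_zero : ∀ x, w x ≠ 0
  le_one : ∀ x, w x ≤ 1
  lintegral_ne_top : ∫⁻ x, w x ∂riemannianVolume d M ≠ ⊤
  bound : ∀ K, IsCompact K → ∃ δ : ℝ, 0 < δ ∧ ∀ x ∈ K, δ ≤ (w x).toReal

variable (d M) in
/-- The weight is a sum `∑ n, δ n 1_{K n}` over a compact exhaustion, with small coefficients. -/
theorem exists_isVolumeWeight [T2Space M] [SecondCountableTopology M] :
    ∃ w : M → ℝ≥0∞, IsVolumeWeight d w := by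
  have : LocallyCompactSpace M := ChartedSpace.locallyCompactSpace (EuclideanSpace ℝ (Fin d)) M
  have : SigmaCompactSpace M := inferInstance
  have := isLocallyFiniteMeasure_riemannianVolume d M
  let K := CompactExhaustion.choice M
  obtain ⟨δ, hδ, hsum⟩ := ENNReal.exists_pos_tsum_mul_lt_of_countable one_ne_zero
    (fun n ↦ max 1 (riemannianVolume d M (K n)))
    fun n ↦ (max_lt ENNReal.one_lt_top (K.isCompact n).measure_lt_top).ne
  set w : M → ℝ≥0∞ := fun x ↦ ∑' n, (K n).indicator (fun _ ↦ (δ n : ℝ≥0∞)) x with hw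
  have hle : ∀ n, ∀ x ∈ K n, (δ n : ℝ≥0∞) ≤ w x := by
    intro n x hx
    refine le_trans (le_of_eq ?_) (ENNReal.le_tsum n)
    rw [Set.indicator_of_mem hx]
  have hone : ∀ x, w x ≤ 1 := by
    intro x
    refine le_trans (ENNReal.tsum_le_tsum fun n ↦ ?_) hsum.le
    refine (Set.indicator_le_self' (fun _ _ ↦ zero_le) x).trans ?_
    exact le_mul_of_one_le_left' (le_max_left _ _)
  have hne : ∀ x, w x ≠ 0 := by
    intro x h0
    obtain ⟨n, hn⟩ := K.exists_mem x
    have := hle n x hn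
    rw [h0, nonpos_iff_eq_zero] at this
    exact (hδ n).ne' (by simpa using this)
  refine ⟨w, ?_, hne, hone, ?_, ?_⟩
  · exact Measurable.tsum fun n ↦ measurable_const.indicator (K.isCompact n).measurableSet
  · rw [hw]
    rw [lintegral_tsum fun n ↦ (measurable_const.indicator (K.isCompact n).measurableSet).aemeasurable]
    refine (lt_of_le_of_lt (ENNReal.tsum_le_tsum fun n ↦ ?_) hsum).trans ENNReal.one_lt_top |>.ne
    rw [lintegral_indicator_const (K.isCompact n).measurableSet, mul_comm]
    exact mul_le_mul_left (le_max_right _ _) _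
  · intro S hS
    obtain ⟨n, hn⟩ := K.exists_superset_of_isCompact hS
    refine ⟨δ n, by exact_mod_cast hδ n, fun x hx ↦ ?_⟩
    have := ENNReal.toReal_mono (ne_top_of_le_ne_top ENNReal.one_ne_top (hone x)) (hle n x (hn hx))
    simpa using this

end Volume

/-! ### Test functions in charts -/

section ChartTest

universe u

variable {d : ℕ} {M : Type u} [TopologicalSpace M] [ChartedSpace (EuclideanSpace ℝ (Fin d)) M]
  [RiemannianBundle (fun x : M ↦ TangentSpace (𝓡 d) x)]
  {e : OpenPartialHomeomorph M (EuclideanSpace ℝ (Fin d))}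

variable (d) in
/-- The measure `w vol_g`. -/
def weightedVolume [MeasurableSpace M] (w : M → ℝ≥0∞) : Measure M :=
  (riemannianVolume d M).withDensity w

/-- The function on `M` whose pairing with `H` with respect to `w vol_g` is the integral of
`(H ∘ e.symm) φ` with respect to Lebesgue measure on the range of the chart `e`. -/
def chartTest (e : OpenPartialHomeomorph M (EuclideanSpace ℝ (Fin d))) (w : M → ℝ≥0∞)
    (φ : EuclideanSpace ℝ (Fin d) → ℝ) : M → ℝ :=
  e.source.indicator fun x ↦ φ (e x) * (chartDensity e (e x) * (w x).toReal)⁻¹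

variable [MeasurableSpace M]

namespace IsVolumeWeight

variable {w : M → ℝ≥0∞}

theorem ne_top (hw : IsVolumeWeight d w) (x : M) : w x ≠ ⊤ :=
  ne_top_of_le_ne_top ENNReal.one_ne_top (hw.le_one x)

theorem toReal_pos (hw : IsVolumeWeight d w) (x : M) : 0 < (w x).toReal :=
  ENNReal.toReal_pos (hw.ne_zero x) (hw.ne_top x)

theorem isFiniteMeasure (hw : IsVolumeWeight d w) : IsFiniteMeasure (weightedVolume d w) :=
  isFiniteMeasure_withDensity hw.lintegral_ne_top

theorem absolutelyContinuous (hw : IsVolumeWeight d w) :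
    riemannianVolume d M ≪ weightedVolume d w :=
  withDensity_absolutelyContinuous' hw.measurable.aemeasurable (ae_of_all _ hw.ne_zero)

theorem lintegral_ofReal (hw : IsVolumeWeight d w) {f : M → ℝ}
    (hf : AEMeasurable f (riemannianVolume d M)) :
    ∫⁻ x, ENNReal.ofReal (f x * (w x).toReal⁻¹) ∂weightedVolume d w =
      ∫⁻ x, ENNReal.ofReal (f x) ∂riemannianVolume d M := by
  refine (lintegral_withDensity_eq_lintegral_mul₀ hw.measurable.aemeasurable
    (hf.mul hw.measurable.ennreal_toReal.inv.aemeasurable).ennreal_ofReal).trans ?_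
  refine lintegral_congr fun x ↦ ?_
  have h1 : w x = ENNReal.ofReal (w x).toReal := (ENNReal.ofReal_toReal (hw.ne_top x)).symm
  have h2 := (hw.toReal_pos x).ne'
  simp only [Pi.mul_apply, Pi.inv_apply]
  conv_lhs => enter [1]; rw [h1]
  rw [← ENNReal.ofReal_mul (hw.toReal_pos x).le]
  congr 1
  field_simp

theorem weightedVolume_le (hw : IsVolumeWeight d w) :
    weightedVolume d w ≤ riemannianVolume d M :=
  (withDensity_mono (ae_of_all _ hw.le_one)).trans_eq withDensity_one

end IsVolumeWeight

variable {w : M → ℝ≥0∞} {φ : EuclideanSpace ℝ (Fin d) → ℝ}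

theorem chartDensity_mul_chartTest (hw : IsVolumeWeight d w)
    (he : e ∈ IsManifold.maximalAtlas (𝓡 d) ∞ M) {y : EuclideanSpace ℝ (Fin d)}
    (hy : y ∈ e.target) (a : ℝ) :
    chartDensity e y * ((w (e.symm y)).toReal * (a * chartTest e w φ (e.symm y))) = a * φ y := by
  rw [chartTest, Set.indicator_of_mem (e.map_target hy), e.right_inv hy]
  have h1 := (chartDensity_pos he hy).ne'
  have h2 := (hw.toReal_pos (e.symm y)).ne'
  field_simp

variable [IsManifold (𝓡 d) ∞ M]

theorem weightedVolume_restrict_source [BorelSpace M]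
    (he : e ∈ IsManifold.maximalAtlas (𝓡 d) ∞ M) :
    (weightedVolume d w).restrict e.source = (chartVolume e).withDensity w := by
  rw [weightedVolume, restrict_withDensity e.open_source.measurableSet,
    riemannianVolume_restrict_source he]

variable [IsContMDiffRiemannianBundle (𝓡 d) ∞ (EuclideanSpace ℝ (Fin d))
      (fun x : M ↦ TangentSpace (𝓡 d) x)]

/-- The weight and the volume density are bounded away from `0` on compact subsets of the chart. -/
theorem exists_bound_chartTest (hw : IsVolumeWeight d w)
    (he : e ∈ IsManifold.maximalAtlas (𝓡 d) ∞ M)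
    {K : Set (EuclideanSpace ℝ (Fin d))} (hK : IsCompact K) (hKe : K ⊆ e.target)
    (h0 : ∀ y ∈ e.target, y ∉ K → φ y = 0) {C : ℝ} (hC : ∀ y ∈ K, |φ y| ≤ C) :
    ∃ B : ℝ, ∀ x, |chartTest e w φ x| ≤ B := by
  obtain ⟨D, hD⟩ := hK.exists_bound_of_continuousOn (f := fun y ↦ (chartDensity e y)⁻¹)
    (((continuousOn_chartDensity he).mono hKe).inv₀ fun y hy ↦ (chartDensity_pos he (hKe hy)).ne')
  obtain ⟨δ, hδ, hδw⟩ := hw.bound (e.symm '' K) (hK.image_of_continuousOn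
    (e.continuousOn_symm.mono hKe))
  have hB : 0 ≤ |C| * (|D| * δ⁻¹) := by positivity
  refine ⟨|C| * (|D| * δ⁻¹), fun x ↦ ?_⟩
  by_cases hx : x ∈ e.source
  · rw [chartTest, Set.indicator_of_mem hx]
    by_cases hxK : e x ∈ K
    · rw [abs_mul, mul_inv, abs_mul, abs_of_nonneg (inv_nonneg.2 (hw.toReal_pos x).le)]
      have h1 : |(chartDensity e (e x))⁻¹| ≤ |D| := (hD _ hxK).trans (le_abs_self _)
      have h2 : (w x).toReal⁻¹ ≤ δ⁻¹ :=
        inv_anti₀ hδ (hδw x ⟨e x, hxK, e.left_inv hx⟩)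
      have h3 : 0 ≤ (w x).toReal⁻¹ := inv_nonneg.2 (hw.toReal_pos x).le
      have h4 : |φ (e x)| ≤ |C| := (hC _ hxK).trans (le_abs_self _)
      gcongr
    · rw [h0 _ (e.map_source hx) hxK, zero_mul, abs_zero]; exact hB
  · rw [chartTest, Set.indicator_of_notMem hx, abs_zero]; exact hB

variable [BorelSpace M]

theorem aestronglyMeasurable_chartTest (hw : IsVolumeWeight d w)
    (he : e ∈ IsManifold.maximalAtlas (𝓡 d) ∞ M)
    (hφ : AEMeasurable φ (volume.restrict e.target)) :
    AEStronglyMeasurable (chartTest e w φ) (weightedVolume d w) := by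
  refine AEStronglyMeasurable.mono_ac (withDensity_absolutelyContinuous _ _)
    (AEMeasurable.aestronglyMeasurable ?_)
  rw [chartTest, aemeasurable_indicator_iff e.open_source.measurableSet]
  have h1 : AEMeasurable (fun x ↦ φ (e x)) ((riemannianVolume d M).restrict e.source) := by
    refine aemeasurable_restrict_source he (hφ.congr ?_)
    filter_upwards [ae_restrict_mem e.open_target.measurableSet] with y hy
    rw [e.right_inv hy]
  have h2 : AEMeasurable (fun x ↦ chartDensity e (e x))
      ((riemannianVolume d M).restrict e.source) := by
    refine aemeasurable_restrict_source he (((continuousOn_chartDensity he).aemeasurable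
        e.open_target.measurableSet).congr ?_)
    filter_upwards [ae_restrict_mem e.open_target.measurableSet] with y hy
    rw [e.right_inv hy]
  exact h1.mul (h2.mul hw.measurable.ennreal_toReal.aemeasurable).inv

/-- Change of variables from `w vol_g` to Lebesgue measure in a chart, for integrability and for
integrals. -/
theorem integrable_and_integral_restrict_source (hw : IsVolumeWeight d w)
    (he : e ∈ IsManifold.maximalAtlas (𝓡 d) ∞ M) {F : M → ℝ}
    (hF : AEStronglyMeasurable F (weightedVolume d w)) :
    (IntegrableOn F e.source (weightedVolume d w) → IntegrableOn (fun y ↦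
      chartDensity e y * ((w (e.symm y)).toReal * F (e.symm y))) e.target volume) ∧
    ∫ x in e.source, F x ∂weightedVolume d w =
      ∫ y in e.target, chartDensity e y * ((w (e.symm y)).toReal * F (e.symm y)) := by
  have hdens : AEMeasurable (fun y ↦ ENNReal.ofReal (chartDensity e y))
      (volume.restrict e.target) :=
    ((continuousOn_chartDensity he).aemeasurable e.open_target.measurableSet).ennreal_ofReal
  have hsymm : AEMeasurable e.symm ((volume.restrict e.target).withDensity
      (fun y ↦ ENNReal.ofReal (chartDensity e y))) :=
    (e.continuousOn_symm.aemeasurable e.open_target.measurableSet).mono_ac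
      (withDensity_absolutelyContinuous _ _)
  have hFm : AEStronglyMeasurable (fun x ↦ (w x).toReal • F x) (chartVolume e) := by
    rw [← riemannianVolume_restrict_source he]
    exact (hw.measurable.ennreal_toReal.aestronglyMeasurable.smul
      (hF.mono_ac hw.absolutelyContinuous)).restrict
  have hpos : ∀ᵐ y ∂volume.restrict e.target,
      (ENNReal.ofReal (chartDensity e y)).toReal • ((w (e.symm y)).toReal • F (e.symm y)) =
      chartDensity e y * ((w (e.symm y)).toReal * F (e.symm y)) := by
    filter_upwards [ae_restrict_mem e.open_target.measurableSet] with y hy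
    rw [ENNReal.toReal_ofReal (chartDensity_pos he hy).le, smul_eq_mul, smul_eq_mul]
  rw [IntegrableOn, weightedVolume_restrict_source he,
    integrable_withDensity_iff_integrable_smul' hw.measurable
      (ae_of_all _ fun x ↦ (hw.ne_top x).lt_top),
    integral_withDensity_eq_integral_toReal_smul hw.measurable
      (ae_of_all _ fun x ↦ (hw.ne_top x).lt_top)]
  rw [chartVolume] at hFm ⊢
  rw [integrable_map_measure hFm hsymm, integral_map hsymm hFm,
    integrable_withDensity_iff_integrable_smul₀' hdens (ae_of_all _ fun x ↦ ENNReal.ofReal_lt_top),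
    integral_withDensity_eq_integral_toReal_smul₀ hdens
      (ae_of_all _ fun x ↦ ENNReal.ofReal_lt_top)]
  refine ⟨fun h ↦ h.congr ?_, integral_congr_ae ?_⟩ <;> exact hpos

theorem integral_mul_chartTest (hw : IsVolumeWeight d w)
    (he : e ∈ IsManifold.maximalAtlas (𝓡 d) ∞ M)
    (hφ : AEMeasurable φ (volume.restrict e.target)) {H : M → ℝ}
    (hH : AEStronglyMeasurable H (weightedVolume d w)) :
    ∫ x, H x * chartTest e w φ x ∂weightedVolume d w = ∫ y in e.target, H (e.symm y) * φ y := by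
  rw [← setIntegral_eq_integral_of_forall_compl_eq_zero (s := e.source) fun x hx ↦ by
    rw [chartTest, Set.indicator_of_notMem hx, mul_zero]]
  refine ((integrable_and_integral_restrict_source hw he
    (hH.mul (aestronglyMeasurable_chartTest hw he hφ))).2).trans ?_
  exact setIntegral_congr_fun e.open_target.measurableSet fun y hy ↦
    chartDensity_mul_chartTest hw he hy _

theorem locallyIntegrableOn_comp_symm (hw : IsVolumeWeight d w)
    (he : e ∈ IsManifold.maximalAtlas (𝓡 d) ∞ M) {H : M → ℝ}
    (hH : Integrable H (weightedVolume d w)) :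
    LocallyIntegrableOn (fun y ↦ H (e.symm y)) e.target volume := by
  rw [locallyIntegrableOn_iff e.open_target.isLocallyClosed]
  intro K hKe hK
  set φ : EuclideanSpace ℝ (Fin d) → ℝ := K.indicator fun _ ↦ 1 with hφ
  have hφm : AEMeasurable φ (volume.restrict e.target) :=
    (measurable_const.indicator hK.measurableSet).aemeasurable
  obtain ⟨B, hB⟩ := exists_bound_chartTest (φ := φ) hw he hK hKe
    (fun y _ hy ↦ Set.indicator_of_notMem hy _) (C := 1)
    (fun y hy ↦ by rw [hφ, Set.indicator_of_mem hy, abs_one])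
  have h1 : Integrable (fun x ↦ H x * chartTest e w φ x) (weightedVolume d w) :=
    hH.mul_bdd (aestronglyMeasurable_chartTest hw he hφm) (ae_of_all _ hB)
  have h2 := (integrable_and_integral_restrict_source hw he h1.aestronglyMeasurable).1
    h1.integrableOn
  refine (h2.mono_set hKe).congr_fun (fun y hy ↦ ?_) hK.measurableSet
  refine (chartDensity_mul_chartTest hw he (hKe hy) _).trans ?_
  rw [hφ, Set.indicator_of_mem hy, mul_one]

end ChartTest

/-! ### The Frobenius norm in Parseval frames -/

section Frobenius

/-- In the formula for the Frobenius norm, a Parseval frame may replace the orthonormal basis. -/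
theorem sum_sq_norm_apply_eq_of_parseval {V W ι κ : Type*} [NormedAddCommGroup V]
    [InnerProductSpace ℝ V] [FiniteDimensional ℝ V] [NormedAddCommGroup W] [InnerProductSpace ℝ W]
    [FiniteDimensional ℝ W] [Fintype ι] (b : OrthonormalBasis ι ℝ V) (s : Finset κ) (f : κ → V)
    (hf : ∀ w, ∑ l ∈ s, (inner ℝ (f l) w : ℝ) ^ 2 = ‖w‖ ^ 2) (T : V →L[ℝ] W) :
    ∑ l ∈ s, ‖T (f l)‖ ^ 2 = ∑ i, ‖T (b i)‖ ^ 2 := by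
  rw [sum_sq_norm_apply_eq b (stdOrthonormalBasis ℝ W)]
  simp only [← hf, ← (stdOrthonormalBasis ℝ W).sum_sq_norm_inner_right]
  rw [Finset.sum_comm]
  refine Finset.sum_congr rfl fun j _ ↦ Finset.sum_congr rfl fun i _ ↦ ?_
  rw [LinearMap.adjoint_inner_right, Real.norm_eq_abs, sq_abs, real_inner_comm]
  rfl

theorem frobeniusNorm_nonneg {V W : Type*} [NormedAddCommGroup V] [InnerProductSpace ℝ V]
    [FiniteDimensional ℝ V] [NormedAddCommGroup W] [InnerProductSpace ℝ W] (T : V →L[ℝ] W) :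
    0 ≤ frobeniusNorm T :=
  Real.sqrt_nonneg _

universe u v

variable {d : ℕ} {M : Type u} [TopologicalSpace M] [ChartedSpace (EuclideanSpace ℝ (Fin d)) M]
  [RiemannianBundle (fun x : M ↦ TangentSpace (𝓡 d) x)]
  {n : ℕ} {N : Type v} [TopologicalSpace N] [ChartedSpace (EuclideanSpace ℝ (Fin n)) N]
  [RiemannianBundle (fun x : N ↦ TangentSpace (𝓡 n) x)]
  [IsManifold (𝓡 d) ∞ M] [IsManifold (𝓡 n) ∞ N]
  {ι κ : Type*} (X : ParsevalFrame d M ι) (Y : ParsevalFrame n N κ)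

theorem frobeniusNorm_sq_eq {x : M} {y : N} (T : TangentSpace (𝓡 d) x →L[ℝ] TangentSpace (𝓡 n) y)
    (S : Finset (κ × ι)) (hS : Y.supp y ×ˢ X.supp x ⊆ S) :
    frobeniusNorm T ^ 2 =
      ∑ i ∈ S, (inner ℝ (Y.field i.1 y) (T (X.field i.2 x)) : ℝ) ^ 2 := by
  rw [← Finset.sum_subset hS, Finset.sum_product_right]
  · rw [frobeniusNorm, Real.sq_sqrt (Finset.sum_nonneg fun i _ ↦ sq_nonneg _),
      ← sum_sq_norm_apply_eq_of_parseval _ (X.supp x) (fun l ↦ X.field l x)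
      (X.sum_sq_inner x _ fun l hl ↦ X.mem_supp hl)]
    exact Finset.sum_congr rfl fun l _ ↦ (Y.sum_sq_inner y _ (fun l hl ↦ Y.mem_supp hl) _).symm
  · rintro ⟨a, l⟩ - hal
    rw [Finset.mem_product, not_and_or] at hal
    rcases hal with h | h
    · have : Y.field a y = 0 := by
        by_contra h0; exact h (Y.mem_supp h0)
      simp [this]
    · have : X.field l x = 0 := by
        by_contra h0; exact h (X.mem_supp h0)
      simp [this]

theorem sum_sq_inner_le_frobeniusNorm_sq {x : M} {y : N}
    (T : TangentSpace (𝓡 d) x →L[ℝ] TangentSpace (𝓡 n) y) (S : Finset (κ × ι)) :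
    ∑ i ∈ S, (inner ℝ (Y.field i.1 y) (T (X.field i.2 x)) : ℝ) ^ 2 ≤ frobeniusNorm T ^ 2 := by
  classical
  rw [frobeniusNorm_sq_eq X Y T (S ∪ Y.supp y ×ˢ X.supp x) Finset.subset_union_right]
  exact Finset.sum_le_sum_of_subset_of_nonneg Finset.subset_union_left fun _ _ _ ↦ sq_nonneg _

theorem abs_inner_field_le_frobeniusNorm {x : M} {y : N}
    (T : TangentSpace (𝓡 d) x →L[ℝ] TangentSpace (𝓡 n) y) (a : κ) (l : ι) :
    |(inner ℝ (Y.field a y) (T (X.field l x)) : ℝ)| ≤ frobeniusNorm T := by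
  refine abs_le_of_sq_le_sq ?_ (frobeniusNorm_nonneg T)
  simpa using sum_sq_inner_le_frobeniusNorm_sq X Y T {(a, l)}

theorem ParsevalFrame.abs_inner_field_le_one (l l' : ι) (x : M) :
    |(inner ℝ (X.field l x) (X.field l' x) : ℝ)| ≤ 1 :=
  (abs_real_inner_le_norm _ _).trans
    (mul_le_one₀ (X.norm_field_le l x) (norm_nonneg _) (X.norm_field_le l' x))

/-- A one-form `β`, a frame vector and a linear map paired through the two frames. Only the frame
vectors meeting the support `S` of `β`, and those meeting `K l`, contribute. -/
theorem apply_apply_field_eq_sum {x : M} {y : N}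
    (T : TangentSpace (𝓡 d) x →L[ℝ] TangentSpace (𝓡 n) y) (β : TangentSpace (𝓡 n) y →L[ℝ] ℝ)
    (l : ι) (S : Finset (κ × ι))
    (hS : β ≠ 0 → X.field l x ≠ 0 → Y.supp y ×ˢ X.supp x ⊆ S) :
    β (T (X.field l x)) = ∑ i ∈ S, β (Y.field i.1 y) *
      (inner ℝ (X.field i.2 x) (X.field l x) : ℝ) *
      (inner ℝ (Y.field i.1 y) (T (X.field i.2 x)) : ℝ) := by
  by_cases h1 : β = 0
  · simp [h1]
  by_cases h2 : X.field l x = 0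
  · simp [h2]
  rw [← Finset.sum_subset (hS h1 h2), Finset.sum_product_right]
  · conv_lhs => rw [← X.sum_eq x (X.supp x) (fun l hl ↦ X.mem_supp hl) (X.field l x)]
    rw [map_sum, map_sum]
    refine Finset.sum_congr rfl fun l' _ ↦ ?_
    rw [map_smul, map_smul]
    conv_lhs => rw [← Y.sum_eq y (Y.supp y) (fun l hl ↦ Y.mem_supp hl) (T (X.field l' x))]
    rw [map_sum, smul_eq_mul, Finset.mul_sum]
    refine Finset.sum_congr rfl fun a _ ↦ ?_
    rw [map_smul, smul_eq_mul]
    ring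
  · rintro ⟨a, l'⟩ - hal
    rw [Finset.mem_product, not_and_or] at hal
    rcases hal with h | h
    · have : Y.field a y = 0 := by
        by_contra h0; exact h (Y.mem_supp h0)
      simp [this]
    · have : X.field l' x = 0 := by
        by_contra h0; exact h (X.mem_supp h0)
      simp [this]

/-- The squared Frobenius norm as a supremum of finite sums of measurable functions. -/
theorem ofReal_frobeniusNorm_sq_eq_iSup {x : M} {y : N} (T : TangentSpace (𝓡 d) x →L[ℝ] TangentSpace (𝓡 n) y) :
    ENNReal.ofReal (frobeniusNorm T ^ 2) = ⨆ S : Finset (κ × ι), ENNReal.ofReal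
      (∑ i ∈ S, (inner ℝ (Y.field i.1 y) (T (X.field i.2 x)) : ℝ) ^ 2) := by
  refine le_antisymm ?_ (iSup_le fun S ↦
    ENNReal.ofReal_le_ofReal (sum_sq_inner_le_frobeniusNorm_sq X Y T S))
  refine le_trans (le_of_eq ?_) (le_iSup _ (Y.supp y ×ˢ X.supp x))
  rw [frobeniusNorm_sq_eq X Y T _ subset_rfl]

/-- A bound on the integrals of all finite sums of frame coefficients is a bound on the integral of
the Frobenius norm, by monotone convergence along the countable family of finite index sets. -/
theorem lintegral_frobeniusNorm_rpow_le [Countable ι] [Countable κ] [MeasurableSpace M]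
    {m : Measure M} {u : M → N}
    {D : ∀ x : M, TangentSpace (𝓡 d) x →L[ℝ] TangentSpace (𝓡 n) (u x)} {p : ℝ} (hp : 0 ≤ p) {θ : M → ℝ}
    (hθ : AEMeasurable θ m) (hθ0 : ∀ x, 0 ≤ θ x)
    (hD : ∀ a l, AEMeasurable
      (fun x ↦ (inner ℝ (Y.field a (u x)) (D x (X.field l x)) : ℝ)) m) {c : ℝ≥0∞}
    (hc : ∀ S : Finset (κ × ι), ∫⁻ x, ENNReal.ofReal (Real.sqrt (∑ i ∈ S,
      (inner ℝ (Y.field i.1 (u x)) (D x (X.field i.2 x)) : ℝ) ^ 2) ^ p * θ x) ∂m ≤ c) :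
    ∫⁻ x, ENNReal.ofReal (frobeniusNorm (D x) ^ p * θ x) ∂m ≤ c := by
  calc ∫⁻ x, ENNReal.ofReal (frobeniusNorm (D x) ^ p * θ x) ∂m
      ≤ ∫⁻ x, ⨆ S : Finset (κ × ι), ENNReal.ofReal (Real.sqrt (∑ i ∈ S,
      (inner ℝ (Y.field i.1 (u x)) (D x (X.field i.2 x)) : ℝ) ^ 2) ^ p * θ x) ∂m := by
        refine lintegral_mono fun x ↦ ?_
        refine le_trans (le_of_eq ?_) (le_iSup _ (Y.supp (u x) ×ˢ X.supp x))
        rw [← frobeniusNorm_sq_eq X Y (D x) _ subset_rfl,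
          Real.sqrt_sq (frobeniusNorm_nonneg _)]
    _ = ⨆ S : Finset (κ × ι), ∫⁻ x, ENNReal.ofReal (Real.sqrt (∑ i ∈ S,
      (inner ℝ (Y.field i.1 (u x)) (D x (X.field i.2 x)) : ℝ) ^ 2) ^ p * θ x) ∂m := by
        classical
        refine lintegral_iSup_directed (fun S ↦ ?_) (Monotone.directed_le fun S S' hS x ↦ ?_)
        · exact (((Finset.aemeasurable_fun_sum _ fun i _ ↦ (hD i.1 i.2).pow_const 2).sqrt.pow_const
            p).mul hθ).ennreal_ofReal
        · refine ENNReal.ofReal_le_ofReal (mul_le_mul_of_nonneg_right ?_ (hθ0 x))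
          refine Real.rpow_le_rpow (Real.sqrt_nonneg _) (Real.sqrt_le_sqrt ?_) hp
          exact Finset.sum_le_sum_of_subset_of_nonneg hS fun _ _ _ ↦ sq_nonneg _
    _ ≤ c := iSup_le hc

end Frobenius

/-! ### Frame covectors as combinations of differentials of test functions -/

section FrameDifferentials

universe v

variable {n : ℕ} {N : Type v} [TopologicalSpace N] [ChartedSpace (EuclideanSpace ℝ (Fin n)) N]
  [IsManifold (𝓡 n) ∞ N]

theorem continuous_of_continuousOn_of_eq_zero {A : Type*} [TopologicalSpace A] {f : A → ℝ}
    {U K : Set A} (hU : IsOpen U) (hK : IsClosed K) (hKU : K ⊆ U) (hf : ContinuousOn f U)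
    (h0 : ∀ x ∉ K, f x = 0) : Continuous f := by
  rw [continuous_iff_continuousAt]
  intro x
  by_cases hx : x ∈ K
  · exact hf.continuousAt (hU.mem_nhds (hKU hx))
  · refine (continuousAt_const (y := (0 : ℝ))).congr ?_
    filter_upwards [hK.isOpen_compl.mem_nhds hx] with z hz using (h0 z hz).symm

/-- The differential of a real function, with values in the cotangent spaces. -/
def differential (f : N → ℝ) (y : N) : TangentSpace (𝓡 n) y →L[ℝ] ℝ :=
  mfderiv (𝓡 n) 𝓘(ℝ, ℝ) f y

/-- Coordinate functions near a compact subset of a chart domain, cut off to be compactly supported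
on the whole manifold. -/
theorem exists_coordinate_functions [T2Space N] [SecondCountableTopology N]
    {e : OpenPartialHomeomorph N (EuclideanSpace ℝ (Fin n))}
    (he : e ∈ IsManifold.maximalAtlas (𝓡 n) ∞ N) {K : Set N} (hK : IsCompact K)
    (hKe : K ⊆ e.source) :
    ∃ f : Fin n → N → ℝ, (∀ c, ContMDiff (𝓡 n) 𝓘(ℝ, ℝ) 1 (f c)) ∧
      (∀ c, HasCompactSupport (f c)) ∧
      ∀ c, ∀ y ∈ K, ∀ w : EuclideanSpace ℝ (Fin n),
        differential (f c) y (coordField e w y) = w c := by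
  have : LocallyCompactSpace N := ChartedSpace.locallyCompactSpace (EuclideanSpace ℝ (Fin n)) N
  have : SigmaCompactSpace N := inferInstance
  obtain ⟨K', hK', hKK', hK'e⟩ := exists_compact_between hK e.open_source hKe
  obtain ⟨η, hη1, hη0, -⟩ := exists_contMDiffMap_one_nhds_of_subset_interior (𝓡 n) (n := 1)
    hK.isClosed hKK'
  have hts : ∀ c : Fin n, tsupport (fun x ↦ η x * (e x) c) ⊆ K' := fun c ↦
    closure_minimal (fun x hx ↦ by
      by_contra h
      exact hx (by simp [hη0 x h])) hK'.isClosed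
  let coord : Fin n → EuclideanSpace ℝ (Fin n) →L[ℝ] ℝ := fun c ↦ EuclideanSpace.proj c
  have hcoord : ∀ c : Fin n, ContMDiffOn (𝓡 n) 𝓘(ℝ, ℝ) ∞ (fun x ↦ (e x) c) e.source := by
    intro c
    have h1 : ContMDiff (𝓡 n) 𝓘(ℝ, ℝ) ∞ (coord c) := (coord c).contDiff.contMDiff
    exact h1.comp_contMDiffOn (contMDiffOn_of_mem_maximalAtlas he)
  refine ⟨fun c x ↦ η x * (e x) c, fun c ↦ ?_, fun c ↦ ?_, fun c y hy w ↦ ?_⟩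
  · refine contMDiff_of_tsupport fun x hx ↦ ?_
    exact ((η.contMDiff x).mul (((hcoord c).contMDiffAt
      (e.open_source.mem_nhds (hK'e (hts c hx)))).of_le (by simp)))
  · exact HasCompactSupport.of_support_subset_isCompact hK' ((subset_tsupport _).trans (hts c))
  · have h1 : (fun x ↦ η x * (e x) c) =ᶠ[𝓝 y] coord c ∘ e := by
      filter_upwards [hη1.filter_mono (nhds_le_nhdsSet hy)] with z hz
      simp [hz, coord]
    have h2 : MDifferentiableAt (𝓡 n) 𝓘(ℝ, ℝ) (coord c) (e y) :=
      (coord c).differentiableAt.mdifferentiableAt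
    rw [differential, h1.mfderiv_eq, mfderiv_comp y h2 (mdifferentiableAt_chart he (hKe hy)),
      mfderiv_eq_fderiv, ContinuousLinearMap.fderiv]
    exact congrArg (coord c) (mfderiv_coordField he (hKe hy) w)

variable [RiemannianBundle (fun x : N ↦ TangentSpace (𝓡 n) x)]
  [IsContMDiffRiemannianBundle (𝓡 n) ∞ (EuclideanSpace ℝ (Fin n))
      (fun x : N ↦ TangentSpace (𝓡 n) x)] {κ : Type*} (Y : ParsevalFrame n N κ)

/-- The covector `⟪Y a, ·⟫` is a combination of differentials of compactly supported functions with
continuous coefficients. -/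
theorem ParsevalFrame.exists_inner_eq_sum_differential [T2Space N] [SecondCountableTopology N]
    (a : κ) :
    ∃ b f : Fin n → N → ℝ, (∀ c, Continuous (b c)) ∧
      (∀ c, ContMDiff (𝓡 n) 𝓘(ℝ, ℝ) 1 (f c)) ∧ (∀ c, HasCompactSupport (f c)) ∧
      ∀ (y : N) (w : TangentSpace (𝓡 n) y), (inner ℝ (Y.field a y) w : ℝ) =
        ∑ c, b c y * differential (f c) y w := by
  set e := chartAt (EuclideanSpace ℝ (Fin n)) (Y.center a)
  have he : e ∈ IsManifold.maximalAtlas (𝓡 n) ∞ N := IsManifold.chart_mem_maximalAtlas _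
  obtain ⟨f, hf1, hf2, hf3⟩ := exists_coordinate_functions he (Y.isCompact a) (Y.subset_source a)
  set b : Fin n → N → ℝ := fun c y ↦
    inner ℝ (Y.field a y) (coordField e (EuclideanSpace.single c 1) y) with hb
  have hb0 : ∀ c, ∀ y ∉ Y.K a, b c y = 0 := by
    intro c y hy
    simp [hb, Y.eq_zero a y hy]
  refine ⟨b, f, fun c ↦ ?_, hf1, hf2, fun y w ↦ ?_⟩
  · refine continuous_of_continuousOn_of_eq_zero e.open_source (Y.isCompact a).isClosed
      (Y.subset_source a) ?_ (hb0 c)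
    exact ((Y.contMDiff a).contMDiffOn.inner_bundle (contMDiffOn_coordField he _)).continuousOn
  · by_cases hy : y ∈ Y.K a
    · obtain ⟨w', rfl⟩ : ∃ w', coordField e w' y = w :=
        ⟨_, coordField_mfderiv he (Y.subset_source a hy) w⟩
      simp only [hf3 _ y hy]
      rw [coordField_sum, inner_sum]
      refine Finset.sum_congr rfl fun c _ ↦ ?_
      rw [real_inner_smul_right, mul_comm]
    · simp [hb0 _ y hy, Y.eq_zero a y hy]

end FrameDifferentials

/-! ### Weak derivatives on a manifold -/

section WeakDerivative

universe u

variable {d : ℕ} {M : Type u} [TopologicalSpace M] [ChartedSpace (EuclideanSpace ℝ (Fin d)) M]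

theorem locallyIntegrableOn_of_apply {U : Set (EuclideanSpace ℝ (Fin d))} (hU : IsOpen U)
    {G : EuclideanSpace ℝ (Fin d) → EuclideanSpace ℝ (Fin d) →L[ℝ] ℝ}
    (h : ∀ w, LocallyIntegrableOn (fun y ↦ G y w) U volume) : LocallyIntegrableOn G U volume := by
  simp only [locallyIntegrableOn_iff hU.isLocallyClosed] at h ⊢
  intro K hKe hK
  let coord : Fin d → EuclideanSpace ℝ (Fin d) →L[ℝ] ℝ := fun c ↦ EuclideanSpace.proj c
  have h1 : ∀ b, Integrable (fun y ↦ G y (EuclideanSpace.single b 1) • coord b)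
      (volume.restrict K) := fun b ↦ Integrable.smul_const (h _ K hKe hK) (coord b)
  have h2 : Integrable (fun y ↦ ∑ b, G y (EuclideanSpace.single b 1) • coord b)
      (volume.restrict K) :=
    integrable_finsetSum (ε' := EuclideanSpace ℝ (Fin d) →L[ℝ] ℝ) Finset.univ fun b _ ↦ h1 b
  refine h2.congr (ae_of_all _ fun y ↦ ?_)
  ext w
  have hw : w = ∑ b, w b • EuclideanSpace.single b (1 : ℝ) := by
    ext i; simp [Finset.sum_apply, Pi.single_apply]
  conv_rhs => rw [hw]
  simp only [sum_apply, map_sum, map_smul, smul_eq_mul, coord, smul_apply]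
  exact Finset.sum_congr rfl fun b _ ↦ mul_comm _ _

/-- Weak derivatives in terms of their components along coordinate vector fields. -/
theorem isWeakDeriv_iff {ζ : M → ℝ} {α : ∀ x : M, TangentSpace (𝓡 d) x →L[ℝ] ℝ} :
    IsWeakDeriv ζ α ↔ ∀ e ∈ IsManifold.maximalAtlas (𝓡 d) ∞ M,
      LocallyIntegrableOn (fun y ↦ ζ (e.symm y)) e.target volume ∧
      ∀ w : EuclideanSpace ℝ (Fin d),
        LocallyIntegrableOn (fun y ↦ α (e.symm y) (coordField e w (e.symm y))) e.target volume ∧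
        ∀ φ : EuclideanSpace ℝ (Fin d) → ℝ, ContDiff ℝ ∞ φ → HasCompactSupport φ →
          tsupport φ ⊆ e.target →
          ∫ y in e.target, ζ (e.symm y) * fderiv ℝ φ y w =
            -∫ y in e.target, α (e.symm y) (coordField e w (e.symm y)) * φ y := by
  refine forall₂_congr fun e he ↦ ?_
  have hcongr : ∀ y ∈ e.target, ∀ w : EuclideanSpace ℝ (Fin d),
      ((α (e.symm y)).comp (mfderiv (𝓡 d) (𝓡 d) e.symm y) :
        EuclideanSpace ℝ (Fin d) →L[ℝ] ℝ) w = α (e.symm y) (coordField e w (e.symm y)) := by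
    intro y hy w
    rw [coordField_symm hy]
    rfl
  have hint : ∀ (φ : EuclideanSpace ℝ (Fin d) → ℝ) (w : EuclideanSpace ℝ (Fin d)),
      ∫ y in e.target, ((α (e.symm y)).comp (mfderiv (𝓡 d) (𝓡 d) e.symm y) :
        EuclideanSpace ℝ (Fin d) →L[ℝ] ℝ) w * φ y =
      ∫ y in e.target, α (e.symm y) (coordField e w (e.symm y)) * φ y := fun φ w ↦
    setIntegral_congr_fun e.open_target.measurableSet fun y hy ↦ by
      simp only; rw [hcongr y hy w]
  constructor
  · rintro ⟨h1, h2, h3⟩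
    refine ⟨h1, fun w ↦ ⟨?_, fun φ hφ hc hs ↦ (h3 φ hφ hc hs w).trans (congrArg _ (hint φ w))⟩⟩
    rw [locallyIntegrableOn_iff e.open_target.isLocallyClosed] at h2 ⊢
    intro K hKe hK
    refine IntegrableOn.congr_fun ((ContinuousLinearMap.apply ℝ ℝ w).integrable_comp (h2 K hKe hK))
      (fun y hy ↦ ?_) hK.measurableSet
    exact hcongr y (hKe hy) w
  · rintro ⟨h1, h2⟩
    refine ⟨h1, ?_, fun φ hφ hc hs w ↦
      ((h2 w).2 φ hφ hc hs).trans (congrArg _ (hint φ w).symm)⟩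
    refine locallyIntegrableOn_of_apply e.open_target fun w ↦ ?_
    have h3 := (h2 w).1
    rw [locallyIntegrableOn_iff e.open_target.isLocallyClosed] at h3 ⊢
    exact fun K hKe hK ↦ (h3 K hKe hK).congr_fun (fun y hy ↦ (hcongr y (hKe hy) w).symm)
      hK.measurableSet

variable [IsManifold (𝓡 d) ∞ M] {ζ : M → ℝ} {α α' : ∀ x : M, TangentSpace (𝓡 d) x →L[ℝ] ℝ}
  {e : OpenPartialHomeomorph M (EuclideanSpace ℝ (Fin d))}

/-- A continuous vector field is a combination of the coordinate fields of a chart, with continuous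
coefficients. -/
theorem exists_eq_sum_coordField (he : e ∈ IsManifold.maximalAtlas (𝓡 d) ∞ M)
    {X : ∀ x : M, TangentSpace (𝓡 d) x}
    (hX : Continuous (fun x ↦ (⟨x, X x⟩ : TangentBundle (𝓡 d) M))) :
    ∃ c : Fin d → M → ℝ, (∀ b, ContinuousOn (c b) e.source) ∧ ∀ x ∈ e.source,
      X x = ∑ b, c b x • coordField e (EuclideanSpace.single b 1) x := by
  have : IsManifold (𝓡 d) 1 M := IsManifold.of_le (n := ∞) (by simp)
  have h1 := ContMDiffOn.continuousOn_mfderiv_apply e.open_source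
    ((contMDiffOn_of_mem_maximalAtlas he).of_le (by simp)) hX.continuousOn
  refine ⟨fun b x ↦ (mfderiv (𝓡 d) (𝓡 d) e x (X x) : EuclideanSpace ℝ (Fin d)).ofLp b,
    fun b ↦ ?_, fun x hx ↦ ?_⟩
  · exact (EuclideanSpace.proj (𝕜 := ℝ) b : EuclideanSpace ℝ (Fin d) →L[ℝ] ℝ).continuous
      |>.comp_continuousOn h1
  · exact (coordField_mfderiv he hx (X x)).symm.trans (coordField_sum e _ x)

variable [RiemannianBundle (fun x : M ↦ TangentSpace (𝓡 d) x)]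
  [SecondCountableTopology M] [MeasurableSpace M] [BorelSpace M]

theorem IsWeakDeriv.aemeasurable (h : IsWeakDeriv ζ α) : AEMeasurable ζ (riemannianVolume d M) :=
  aemeasurable_of_charts fun e he ↦
    ((isWeakDeriv_iff.1 h e he).1.aestronglyMeasurable).aemeasurable

theorem IsWeakDeriv.aemeasurable_apply (h : IsWeakDeriv ζ α) {X : ∀ x : M, TangentSpace (𝓡 d) x}
    (hX : Continuous (fun x ↦ (⟨x, X x⟩ : TangentBundle (𝓡 d) M))) :
    AEMeasurable (fun x ↦ α x (X x)) (riemannianVolume d M) := by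
  refine aemeasurable_of_charts fun e he ↦ ?_
  obtain ⟨c, hc, hXc⟩ := exists_eq_sum_coordField he hX
  have h1 : AEMeasurable (fun y ↦ ∑ b, c b (e.symm y) *
      α (e.symm y) (coordField e (EuclideanSpace.single b 1) (e.symm y)))
      (volume.restrict e.target) := by
    refine Finset.aemeasurable_fun_sum _ fun b _ ↦ AEMeasurable.mul ?_ ?_
    · exact ((hc b).comp e.continuousOn_symm e.mapsTo_symm).aemeasurable
        e.open_target.measurableSet
    · exact ((isWeakDeriv_iff.1 h e he).2 _).1.aestronglyMeasurable.aemeasurable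
  refine h1.congr ?_
  filter_upwards [ae_restrict_mem e.open_target.measurableSet] with y hy
  rw [hXc _ (e.map_target hy), map_sum]
  simp only [map_smul, smul_eq_mul]

/-- Weak derivatives are unique, by the fundamental lemma of the calculus of variations. -/
theorem IsWeakDeriv.ae_eq (h : IsWeakDeriv ζ α) (h' : IsWeakDeriv ζ α') :
    ∀ᵐ x ∂riemannianVolume d M, α x = α' x := by
  refine riemannianVolume_eq_zero_of_charts fun x _ ↦ ?_
  set e := chartAt (EuclideanSpace ℝ (Fin d)) x
  have he : e ∈ IsManifold.maximalAtlas (𝓡 d) ∞ M := IsManifold.chart_mem_maximalAtlas _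
  refine ⟨e, he, mem_chart_source _ x, ?_⟩
  have h1 : ∀ b : Fin d, ∀ᵐ y, y ∈ e.target →
      α (e.symm y) (coordField e (EuclideanSpace.single b 1) (e.symm y)) -
      α' (e.symm y) (coordField e (EuclideanSpace.single b 1) (e.symm y)) = 0 := by
    intro b
    obtain ⟨i1, j1⟩ := (isWeakDeriv_iff.1 h e he).2 (EuclideanSpace.single b 1)
    obtain ⟨i2, j2⟩ := (isWeakDeriv_iff.1 h' e he).2 (EuclideanSpace.single b 1)
    refine e.open_target.ae_eq_zero_of_integral_contDiff_smul_eq_zero (i1.sub i2)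
      fun φ hφ hc hs ↦ ?_
    have h2 := (j1 φ hφ hc hs).symm.trans (j2 φ hφ hc hs)
    have hint : ∀ f : EuclideanSpace ℝ (Fin d) → ℝ, LocallyIntegrableOn f e.target volume →
        IntegrableOn (fun y ↦ f y * φ y) e.target volume := by
      intro f hf
      have h3 : IntegrableOn f (tsupport φ) volume :=
        (locallyIntegrableOn_iff e.open_target.isLocallyClosed).1 hf _ hs hc
      have h4 : IntegrableOn (fun y ↦ f y * φ y) (tsupport φ) volume :=
        h3.mul_continuousOn hφ.continuous.continuousOn hc
      refine (IntegrableOn.of_forall_sdiff_eq_zero h4 e.open_target.measurableSet fun y hy ↦ ?_)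
      rw [image_eq_zero_of_notMem_tsupport hy.2, mul_zero]
    have h5 : ∫ y, φ y • (α (e.symm y) (coordField e (EuclideanSpace.single b 1) (e.symm y)) -
        α' (e.symm y) (coordField e (EuclideanSpace.single b 1) (e.symm y))) =
        ∫ y in e.target, (α (e.symm y) (coordField e (EuclideanSpace.single b 1) (e.symm y)) * φ y -
        α' (e.symm y) (coordField e (EuclideanSpace.single b 1) (e.symm y)) * φ y) := by
      rw [setIntegral_eq_integral_of_forall_compl_eq_zero]
      · refine integral_congr_ae (ae_of_all _ fun y ↦ ?_)
        simp only [smul_eq_mul]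
        ring
      · intro y hy
        rw [image_eq_zero_of_notMem_tsupport fun h ↦ hy (hs h)]
        ring
    refine h5.trans ((integral_sub (hint _ i1) (hint _ i2)).trans ?_)
    linarith
  rw [← ae_all_iff] at h1
  refine measure_mono_null ?_ h1
  rintro y ⟨hy, hne⟩ hall
  refine hne (ContinuousLinearMap.ext fun w ↦ ?_)
  obtain ⟨w', rfl⟩ : ∃ w', coordField e w' (e.symm y) = w :=
    ⟨_, coordField_mfderiv he (e.map_target hy) w⟩
  rw [coordField_sum, map_sum, map_sum]
  refine Finset.sum_congr rfl fun b _ ↦ ?_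
  rw [map_smul, map_smul, sub_eq_zero.1 (hall b hy)]

end WeakDerivative

/-! ### Measurability and uniqueness of colocal weak derivatives -/

section ColocalDerivative

universe u v

variable {d : ℕ} {M : Type u} [TopologicalSpace M] [ChartedSpace (EuclideanSpace ℝ (Fin d)) M]
  {n : ℕ} {N : Type v} [TopologicalSpace N] [ChartedSpace (EuclideanSpace ℝ (Fin n)) N]

variable {u : M → N} {D D' : ∀ x : M, TangentSpace (𝓡 d) x →L[ℝ] TangentSpace (𝓡 n) (u x)}

theorem IsColocalWeakDeriv.isWeakDeriv (hD : IsColocalWeakDeriv u D) {f : N → ℝ}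
    (hf : ContMDiff (𝓡 n) 𝓘(ℝ, ℝ) 1 f) (hc : HasCompactSupport f) :
    IsWeakDeriv (f ∘ u) fun x ↦ (differential f (u x)).comp (D x) :=
  hD f hf hc

variable [T2Space N] [SecondCountableTopology N] [IsManifold (𝓡 n) ∞ N]

/-- Testing a map `u` with `C^1` functions of compact support suffices for the measurability of
`h ∘ u`, because every open set of the target is a countable union of sets `{f ≠ 0}`. -/
theorem aemeasurable_comp_of_hasCompactSupport {A : Type*} [MeasurableSpace A] {μ : Measure A}
    {u : A → N} (hu : ∀ f : N → ℝ, ContMDiff (𝓡 n) 𝓘(ℝ, ℝ) 1 f → HasCompactSupport f →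
      AEMeasurable (f ∘ u) μ) {h : N → ℝ} (hh : Continuous h) :
    AEMeasurable (fun x ↦ h (u x)) μ := by
  have : LocallyCompactSpace N := ChartedSpace.locallyCompactSpace (EuclideanSpace ℝ (Fin n)) N
  have : SigmaCompactSpace N := inferInstance
  have hopen : ∀ V : Set N, IsOpen V → NullMeasurableSet (u ⁻¹' V) μ := by
    intro V hV
    let K := CompactExhaustion.choice N
    have hVK : V = ⋃ i, V ∩ interior (K i) := by
      refine Set.Subset.antisymm (fun x hx ↦ ?_) (Set.iUnion_subset fun i ↦ Set.inter_subset_left)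
      obtain ⟨i, hi⟩ := K.exists_mem_nhds x
      exact Set.mem_iUnion.2 ⟨i, hx, mem_interior_iff_mem_nhds.2 hi⟩
    rw [hVK, Set.preimage_iUnion]
    refine NullMeasurableSet.iUnion fun i ↦ ?_
    obtain ⟨f, hf, hfs, -⟩ := (hV.inter isOpen_interior).exists_contMDiff_support_eq (𝓡 n)
      (n := 1) (s := V ∩ interior (K i))
    have h1 := (hu f hfs (HasCompactSupport.of_support_subset_isCompact (K.isCompact i)
      (hf.trans_subset (Set.inter_subset_right.trans interior_subset)))).nullMeasurable
      (measurableSet_singleton (0 : ℝ)).compl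
    rw [← hf]
    exact h1
  have h2 : NullMeasurable (fun x ↦ h (u x)) μ :=
    measurable_of_isOpen (δ := NullMeasurableSpace A μ) fun O hO ↦ hopen _ (hO.preimage hh)
  exact h2.aemeasurable

variable [IsManifold (𝓡 d) ∞ M] [SecondCountableTopology M]
  [RiemannianBundle (fun x : M ↦ TangentSpace (𝓡 d) x)]
  [MeasurableSpace M] [BorelSpace M]

theorem IsColocalWeakDeriv.aemeasurable_comp (hD : IsColocalWeakDeriv u D) {h : N → ℝ}
    (hh : Continuous h) : AEMeasurable (fun x ↦ h (u x)) (riemannianVolume d M) :=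
  aemeasurable_comp_of_hasCompactSupport (fun _ hf hc ↦ (hD.isWeakDeriv hf hc).aemeasurable) hh

variable [RiemannianBundle (fun x : N ↦ TangentSpace (𝓡 n) x)]
  [IsContMDiffRiemannianBundle (𝓡 n) ∞ (EuclideanSpace ℝ (Fin n))
      (fun x : N ↦ TangentSpace (𝓡 n) x)] {ι κ : Type*}

theorem IsColocalWeakDeriv.aemeasurable_inner (hD : IsColocalWeakDeriv u D)
    (X : ParsevalFrame d M ι) (Y : ParsevalFrame n N κ) (a : κ) (l : ι) :
    AEMeasurable (fun x ↦ (inner ℝ (Y.field a (u x)) (D x (X.field l x)) : ℝ))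
      (riemannianVolume d M) := by
  obtain ⟨b, f, hb, hf, hc, h⟩ := Y.exists_inner_eq_sum_differential a
  simp only [h]
  exact Finset.aemeasurable_fun_sum _ fun c _ ↦ (hD.aemeasurable_comp (hb c)).mul
    ((hD.isWeakDeriv (hf c) (hc c)).aemeasurable_apply (X.continuous l))

/-- Colocal weak derivatives are unique: countably many differentials of test functions separate the
tangent vectors of the target. -/
theorem IsColocalWeakDeriv.ae_eq (hD : IsColocalWeakDeriv u D) (hD' : IsColocalWeakDeriv u D') :
    ∀ᵐ x ∂riemannianVolume d M, D x = D' x := by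
  obtain ⟨κ, _, ⟨Y⟩⟩ := ParsevalFrame.exists_countable (d := n) (M := N)
  choose b f hb hf hc h using Y.exists_inner_eq_sum_differential
  have h1 := ae_all_iff.2 fun a ↦ ae_all_iff.2 fun c ↦
    (hD.isWeakDeriv (hf a c) (hc a c)).ae_eq (hD'.isWeakDeriv (hf a c) (hc a c))
  filter_upwards [h1] with x hx
  ext1 w
  rw [← Y.sum_eq (u x) (Y.supp (u x)) (fun l hl ↦ Y.mem_supp hl) (D x w),
    ← Y.sum_eq (u x) (Y.supp (u x)) (fun l hl ↦ Y.mem_supp hl) (D' x w)]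
  refine Finset.sum_congr rfl fun a _ ↦ ?_
  rw [h, h]
  refine congrArg (· • _) (Finset.sum_congr rfl fun c _ ↦ ?_)
  exact congrArg (b a c (u x) * ·) (DFunLike.congr_fun (hx a c) w)

variable [T2Space M] [IsContMDiffRiemannianBundle (𝓡 d) ∞ (EuclideanSpace ℝ (Fin d))
      (fun x : M ↦ TangentSpace (𝓡 d) x)]

theorem IsColocalWeakDeriv.aemeasurable_frobeniusNorm (hD : IsColocalWeakDeriv u D) :
    AEMeasurable (fun x ↦ frobeniusNorm (D x)) (riemannianVolume d M) := by
  obtain ⟨ι, _, ⟨X⟩⟩ := ParsevalFrame.exists_countable (d := d) (M := M)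
  obtain ⟨κ, _, ⟨Y⟩⟩ := ParsevalFrame.exists_countable (d := n) (M := N)
  have h1 : AEMeasurable (fun x ↦ ENNReal.ofReal (frobeniusNorm (D x) ^ 2))
      (riemannianVolume d M) := by
    simp only [ofReal_frobeniusNorm_sq_eq_iSup X Y]
    exact AEMeasurable.iSup fun S ↦ (Finset.aemeasurable_fun_sum _ fun i _ ↦
      (hD.aemeasurable_inner X Y i.1 i.2).pow_const 2).ennreal_ofReal
  refine h1.ennreal_toReal.sqrt.congr (ae_of_all _ fun x ↦ ?_)
  simp only
  rw [ENNReal.toReal_ofReal (sq_nonneg _), Real.sqrt_sq (frobeniusNorm_nonneg _)]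

end ColocalDerivative

/-! ### Closedness of the weak derivative -/

section Closedness

universe u

variable {d : ℕ} {M : Type u} [TopologicalSpace M] [ChartedSpace (EuclideanSpace ℝ (Fin d)) M]
  [IsManifold (𝓡 d) ∞ M] [RiemannianBundle (fun x : M ↦ TangentSpace (𝓡 d) x)]
  {ι : Type*} (X : ParsevalFrame d M ι) {e : OpenPartialHomeomorph M (EuclideanSpace ℝ (Fin d))}

/-- The coefficients of a coordinate vector field in a Parseval frame, in the coordinates of the
chart. -/
def frameCoeff (e : OpenPartialHomeomorph M (EuclideanSpace ℝ (Fin d)))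
    (a : EuclideanSpace ℝ (Fin d)) (l : ι) (y : EuclideanSpace ℝ (Fin d)) : ℝ :=
  inner ℝ (X.field l (e.symm y)) (coordField e a (e.symm y))

/-- On a compact set, a coordinate vector field is a finite combination of the frame vectors. -/
theorem exists_apply_coordField_eq_sum {K : Set (EuclideanSpace ℝ (Fin d))} (hK : IsCompact K)
    (hKe : K ⊆ e.target) (a : EuclideanSpace ℝ (Fin d)) :
    ∃ s : Finset ι, ∀ y ∈ K, ∀ β : TangentSpace (𝓡 d) (e.symm y) →L[ℝ] ℝ,
      β (coordField e a (e.symm y)) =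
        ∑ l ∈ s, β (X.field l (e.symm y)) * frameCoeff X e a l y := by
  refine ⟨(X.finite_inter_compact (hK.image_of_continuousOn
    (e.continuousOn_symm.mono hKe))).toFinset, fun y hy β ↦ ?_⟩
  have h1 : ∀ l, X.field l (e.symm y) ≠ 0 → l ∈ (X.finite_inter_compact
      (hK.image_of_continuousOn (e.continuousOn_symm.mono hKe))).toFinset := by
    intro l hl
    rw [Set.Finite.mem_toFinset]
    refine ⟨e.symm y, ?_, y, hy, rfl⟩
    by_contra h
    exact hl (X.eq_zero l _ h)
  conv_lhs => rw [← X.sum_eq _ _ h1 (coordField e a (e.symm y))]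
  rw [map_sum]
  refine Finset.sum_congr rfl fun l _ ↦ ?_
  rw [map_smul, smul_eq_mul, mul_comm]
  rfl

variable [IsContMDiffRiemannianBundle (𝓡 d) ∞ (EuclideanSpace ℝ (Fin d))
      (fun x : M ↦ TangentSpace (𝓡 d) x)]

theorem continuousOn_frameCoeff (he : e ∈ IsManifold.maximalAtlas (𝓡 d) ∞ M)
    (a : EuclideanSpace ℝ (Fin d)) (l : ι) : ContinuousOn (frameCoeff X e a l) e.target :=
  ((X.contMDiff l).contMDiffOn.inner_bundle (contMDiffOn_coordField he a)).continuousOn.comp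
    e.continuousOn_symm e.mapsTo_symm

variable {φ : EuclideanSpace ℝ (Fin d) → ℝ}

theorem aemeasurable_frameCoeff_mul (he : e ∈ IsManifold.maximalAtlas (𝓡 d) ∞ M)
    (hφ : Continuous φ) (a : EuclideanSpace ℝ (Fin d)) (l : ι) :
    AEMeasurable (fun y ↦ frameCoeff X e a l y * φ y) (volume.restrict e.target) :=
  ((continuousOn_frameCoeff X he a l).mul hφ.continuousOn).aemeasurable e.open_target.measurableSet

variable [MeasurableSpace M] {w : M → ℝ≥0∞}

theorem exists_bound_chartTest_frameCoeff (hw : IsVolumeWeight d w)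
    (he : e ∈ IsManifold.maximalAtlas (𝓡 d) ∞ M) (hφ : Continuous φ) (hc : HasCompactSupport φ)
    (hs : tsupport φ ⊆ e.target) (a : EuclideanSpace ℝ (Fin d)) (l : ι) :
    ∃ B : ℝ, ∀ x, |chartTest e w (fun y ↦ frameCoeff X e a l y * φ y) x| ≤ B := by
  obtain ⟨C, hC⟩ := IsCompact.exists_bound_of_continuousOn (f := fun y ↦ frameCoeff X e a l y * φ y)
    hc (((continuousOn_frameCoeff X he a l).mono hs).mul hφ.continuousOn)
  exact exists_bound_chartTest hw he hc hs
    (fun y _ hy ↦ by rw [image_eq_zero_of_notMem_tsupport hy, mul_zero]) hC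

variable [BorelSpace M] {α : ∀ x : M, TangentSpace (𝓡 d) x →L[ℝ] ℝ}

theorem locallyIntegrableOn_apply_coordField (hw : IsVolumeWeight d w)
    (he : e ∈ IsManifold.maximalAtlas (𝓡 d) ∞ M)
    (hα : ∀ l, Integrable (fun x ↦ α x (X.field l x)) (weightedVolume d w))
    (a : EuclideanSpace ℝ (Fin d)) :
    LocallyIntegrableOn (fun y ↦ α (e.symm y) (coordField e a (e.symm y))) e.target volume := by
  rw [locallyIntegrableOn_iff e.open_target.isLocallyClosed]
  intro K hKe hK
  obtain ⟨s, hs⟩ := exists_apply_coordField_eq_sum X hK hKe a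
  have h1 : IntegrableOn (fun y ↦ ∑ l ∈ s, α (e.symm y) (X.field l (e.symm y)) *
      frameCoeff X e a l y) K volume := by
    refine integrable_finsetSum (ε' := ℝ) s fun l _ ↦ ?_
    exact ((locallyIntegrableOn_iff e.open_target.isLocallyClosed).1
      (locallyIntegrableOn_comp_symm hw he (hα l)) K hKe hK).mul_continuousOn
      ((continuousOn_frameCoeff X he a l).mono hKe) hK
  exact h1.congr_fun (fun y hy ↦ (hs y hy _).symm) hK.measurableSet

/-- The pairing of a one-form with a coordinate field and a test function, in terms of the pairings
of the one-form with the frame. -/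
theorem setIntegral_apply_coordField_mul (hw : IsVolumeWeight d w)
    (he : e ∈ IsManifold.maximalAtlas (𝓡 d) ∞ M) (hφ : Continuous φ)
    (hα : ∀ l, Integrable (fun x ↦ α x (X.field l x)) (weightedVolume d w))
    {a : EuclideanSpace ℝ (Fin d)} {s : Finset ι} (hc : HasCompactSupport φ)
    (hφe : tsupport φ ⊆ e.target)
    (hs : ∀ y ∈ tsupport φ, ∀ β : TangentSpace (𝓡 d) (e.symm y) →L[ℝ] ℝ,
      β (coordField e a (e.symm y)) =
        ∑ l ∈ s, β (X.field l (e.symm y)) * frameCoeff X e a l y) :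
    ∫ y in e.target, α (e.symm y) (coordField e a (e.symm y)) * φ y =
      ∑ l ∈ s, ∫ x, α x (X.field l x) *
        chartTest e w (fun y ↦ frameCoeff X e a l y * φ y) x ∂weightedVolume d w := by
  have h1 : ∀ y, α (e.symm y) (coordField e a (e.symm y)) * φ y =
      ∑ l ∈ s, α (e.symm y) (X.field l (e.symm y)) * (frameCoeff X e a l y * φ y) := by
    intro y
    by_cases hy : y ∈ tsupport φ
    · rw [hs y hy, Finset.sum_mul]
      exact Finset.sum_congr rfl fun l _ ↦ mul_assoc _ _ _
    · simp [image_eq_zero_of_notMem_tsupport hy]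
  simp only [h1]
  rw [integral_finsetSum]
  · exact Finset.sum_congr rfl fun l _ ↦ (integral_mul_chartTest hw he
      (aemeasurable_frameCoeff_mul X he hφ a l) (hα l).aestronglyMeasurable).symm
  · intro l _
    have h2 : IntegrableOn (fun y ↦ α (e.symm y) (X.field l (e.symm y)) *
        (frameCoeff X e a l y * φ y)) (tsupport φ) volume :=
      ((locallyIntegrableOn_iff e.open_target.isLocallyClosed).1
        (locallyIntegrableOn_comp_symm hw he (hα l)) _ hφe hc).mul_continuousOn
        (((continuousOn_frameCoeff X he a l).mono hφe).mul hφ.continuousOn) hc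
    refine IntegrableOn.of_forall_sdiff_eq_zero h2 e.open_target.measurableSet fun y hy ↦ ?_
    simp [image_eq_zero_of_notMem_tsupport hy.2]

/-- If bounded functions converge almost everywhere and the components of their weak derivatives in
a Parseval frame converge weakly, then the limit of the derivatives is a weak derivative of the limit
of the functions. -/
theorem isWeakDeriv_of_tendstoWeakly [SecondCountableTopology M] (hw : IsVolumeWeight d w)
    {l : Filter ℕ} [l.NeBot] (hl : l ≤ Filter.atTop) {ζ : ℕ → M → ℝ} {ζ' : M → ℝ}
    {α : ℕ → ∀ x : M, TangentSpace (𝓡 d) x →L[ℝ] ℝ} {α' : ∀ x : M, TangentSpace (𝓡 d) x →L[ℝ] ℝ}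
    (h : ∀ k, IsWeakDeriv (ζ k) (α k)) {C : ℝ} (hC : ∀ k x, |ζ k x| ≤ C)
    (hlim : ∀ᵐ x ∂riemannianVolume d M,
      Filter.Tendsto (fun k ↦ ζ k x) Filter.atTop (𝓝 (ζ' x)))
    (hα : ∀ k i, Integrable (fun x ↦ α k x (X.field i x)) (weightedVolume d w))
    (hα' : ∀ i, Integrable (fun x ↦ α' x (X.field i x)) (weightedVolume d w))
    (hweak : ∀ i, TendstoWeakly (weightedVolume d w) l (fun k x ↦ α k x (X.field i x))
      fun x ↦ α' x (X.field i x)) : IsWeakDeriv ζ' α' := by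
  have := hw.isFiniteMeasure
  have hac : weightedVolume d w ≪ riemannianVolume d M := withDensity_absolutelyContinuous _ _
  have hζ' : AEMeasurable ζ' (riemannianVolume d M) :=
    aemeasurable_of_tendsto_metrizable_ae Filter.atTop (fun k ↦ (h k).aemeasurable) hlim
  have hζC : ∀ᵐ x ∂riemannianVolume d M, |ζ' x| ≤ C := by
    filter_upwards [hlim] with x hx
    exact le_of_tendsto hx.abs (Filter.Eventually.of_forall fun k ↦ hC k x)
  refine isWeakDeriv_iff.2 fun e he ↦ ⟨?_, fun a ↦
    ⟨locallyIntegrableOn_apply_coordField X hw he hα' a, fun φ hφ hc hs ↦ ?_⟩⟩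
  · exact locallyIntegrableOn_comp_symm hw he (Integrable.of_bound
      (hζ'.aestronglyMeasurable.mono_ac hac) C (hac.ae_le hζC))
  obtain ⟨s, hsum⟩ := exists_apply_coordField_eq_sum X hc hs a
  have h1 : Filter.Tendsto (fun k ↦ ∫ y in e.target, ζ k (e.symm y) * fderiv ℝ φ y a) l
      (𝓝 (∫ y in e.target, ζ' (e.symm y) * fderiv ℝ φ y a)) := by
    have hφ' : Continuous fun y ↦ fderiv ℝ φ y a :=
      (hφ.continuous_fderiv (by simp)).clm_apply continuous_const
    have hφc : HasCompactSupport fun y ↦ fderiv ℝ φ y a := hc.fderiv_apply ℝ a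
    refine (tendsto_integral_of_dominated_convergence (fun y ↦ C * |fderiv ℝ φ y a|)
      (fun k ↦ ?_) ?_ (fun k ↦ ae_of_all _ fun y ↦ ?_) ?_).mono_left hl
    · exact (((h k).aemeasurable.comp_chart_symm he).mul
        hφ'.aemeasurable).aestronglyMeasurable
    · exact ((hφ'.integrable_of_hasCompactSupport hφc).abs.const_mul C).restrict
    · rw [Real.norm_eq_abs, abs_mul]
      exact mul_le_mul_of_nonneg_right (hC k _) (abs_nonneg _)
    · filter_upwards [ae_comp_chart_symm hlim he] with y hy using hy.mul_const _
  have h2 : Filter.Tendsto (fun k ↦ -∑ i ∈ s, ∫ x, α k x (X.field i x) *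
        chartTest e w (fun y ↦ frameCoeff X e a i y * φ y) x ∂weightedVolume d w) l
      (𝓝 (-∑ i ∈ s, ∫ x, α' x (X.field i x) *
        chartTest e w (fun y ↦ frameCoeff X e a i y * φ y) x ∂weightedVolume d w)) :=
    (tendsto_finsetSum s fun i _ ↦ hweak i _ (aestronglyMeasurable_chartTest hw he
      (aemeasurable_frameCoeff_mul X he hφ.continuous a i))
      (exists_bound_chartTest_frameCoeff X hw he hφ.continuous hc hs a i)).neg
  rw [setIntegral_apply_coordField_mul X hw he hφ.continuous hα' hc hs hsum]
  refine tendsto_nhds_unique h1 (h2.congr fun k ↦ ?_)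
  rw [((isWeakDeriv_iff.1 (h k) e he).2 a).2 φ hφ hc hs,
    setIntegral_apply_coordField_mul X hw he hφ.continuous (hα k) hc hs hsum]

end Closedness

/-! ### Weak limits of colocal weak derivatives -/

section WeakLimit

universe u v

variable {d : ℕ} {M : Type u} [TopologicalSpace M] [ChartedSpace (EuclideanSpace ℝ (Fin d)) M]
  [IsManifold (𝓡 d) ∞ M] [RiemannianBundle (fun x : M ↦ TangentSpace (𝓡 d) x)]
  {n : ℕ} {N : Type v} [TopologicalSpace N] [ChartedSpace (EuclideanSpace ℝ (Fin n)) N]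
  [IsManifold (𝓡 n) ∞ N] [RiemannianBundle (fun x : N ↦ TangentSpace (𝓡 n) x)]
  {ι κ : Type*} (X : ParsevalFrame d M ι) (Y : ParsevalFrame n N κ)

theorem ParsevalFrame.supp_subset {S : Set M} (hS : IsCompact S) {x : M} (hx : x ∈ S) :
    X.supp x ⊆ (X.finite_inter_compact hS).toFinset := by
  intro l hl
  rw [ParsevalFrame.supp, Set.Finite.mem_toFinset] at hl
  obtain ⟨_, hxl, rfl⟩ := hl
  rw [Set.Finite.mem_toFinset]
  exact ⟨_, hxl, hx⟩

/-- The family of linear maps `T_xM → T_{v x}N` whose matrix coefficients in the two frames are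
synthesized from the functions `G a l`. -/
def synthesis (v : M → N) (G : κ → ι → M → ℝ) (x : M) :
    TangentSpace (𝓡 d) x →L[ℝ] TangentSpace (𝓡 n) (v x) :=
  ∑ i ∈ Y.supp (v x) ×ˢ X.supp x,
    G i.1 i.2 x • (innerSL ℝ (X.field i.2 x)).smulRight (Y.field i.1 (v x))

theorem apply_synthesis {v : M → N} (G : κ → ι → M → ℝ) {x : M}
    (β : TangentSpace (𝓡 n) (v x) →L[ℝ] ℝ) (l : ι) (S : Finset (κ × ι))
    (hS : β ≠ 0 → X.field l x ≠ 0 → Y.supp (v x) ×ˢ X.supp x ⊆ S) :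
    β (synthesis X Y v G x (X.field l x)) = ∑ i ∈ S, β (Y.field i.1 (v x)) *
      (inner ℝ (X.field i.2 x) (X.field l x) : ℝ) * G i.1 i.2 x := by
  by_cases h1 : β = 0
  · simp [h1]
  by_cases h2 : X.field l x = 0
  · simp [h2]
  rw [← Finset.sum_subset (hS h1 h2), synthesis, sum_apply, map_sum]
  · refine Finset.sum_congr rfl fun i _ ↦ ?_
    simp only [smul_apply, ContinuousLinearMap.smulRight_apply, innerSL_apply_apply, map_smul,
      smul_eq_mul]
    ring
  · rintro ⟨a, l'⟩ - hal
    rw [Finset.mem_product, not_and_or] at hal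
    rcases hal with h | h
    · have : Y.field a (v x) = 0 := by
        by_contra h0; exact h (Y.mem_supp h0)
      simp [this]
    · have : X.field l' x = 0 := by
        by_contra h0; exact h (X.mem_supp h0)
      simp [this]

/-- A continuous one-form of compact support. Continuity is expressed through the components in the
frame `Y`. -/
structure IsCompactOneForm (β : ∀ y : N, TangentSpace (𝓡 n) y →L[ℝ] ℝ) : Prop where
  continuous : ∀ a, Continuous fun y ↦ β y (Y.field a y)
  exists_isCompact : ∃ S : Set N, IsCompact S ∧ ∀ y ∉ S, β y = 0

theorem isCompactOneForm_differential {f : N → ℝ} (hf : ContMDiff (𝓡 n) 𝓘(ℝ, ℝ) 1 f)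
    (hc : HasCompactSupport f) : IsCompactOneForm Y (differential f) := by
  refine ⟨fun a ↦ ?_, tsupport f, hc, fun y hy ↦ ?_⟩
  · have : IsManifold (𝓡 n) 1 N := IsManifold.of_le (n := ∞) (by simp)
    rw [← continuousOn_univ]
    exact ContMDiffOn.continuousOn_mfderiv_apply isOpen_univ hf.contMDiffOn
      (Y.continuous a).continuousOn
  · have h1 : f =ᶠ[𝓝 y] fun _ ↦ (0 : ℝ) := notMem_tsupport_iff_eventuallyEq.1 hy
    rw [differential, h1.mfderiv_eq]
    exact mfderiv_const

theorem isCompactOneForm_inner [IsContMDiffRiemannianBundle (𝓡 n) ∞ (EuclideanSpace ℝ (Fin n))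
      (fun x : N ↦ TangentSpace (𝓡 n) x)] (a : κ) :
    IsCompactOneForm Y fun y ↦ innerSL ℝ (Y.field a y) := by
  refine ⟨fun a' ↦ ?_, Y.K a, Y.isCompact a, fun y hy ↦ ?_⟩
  · exact ((Y.contMDiff a).inner_bundle (Y.contMDiff a')).continuous
  · rw [Y.eq_zero a y hy, map_zero]

theorem IsCompactOneForm.exists_bound {β : ∀ y : N, TangentSpace (𝓡 n) y →L[ℝ] ℝ}
    (hβ : IsCompactOneForm Y β) (a : κ) : ∃ C : ℝ, ∀ y, |β y (Y.field a y)| ≤ C := by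
  obtain ⟨S, hS, h0⟩ := hβ.exists_isCompact
  obtain ⟨C, hC⟩ := hS.exists_bound_of_continuousOn (hβ.continuous a).continuousOn
  refine ⟨max C 0, fun y ↦ ?_⟩
  by_cases hy : y ∈ S
  · exact (hC y hy).trans (le_max_left _ _)
  · simp [h0 y hy]

variable [IsContMDiffRiemannianBundle (𝓡 n) ∞ (EuclideanSpace ℝ (Fin n))
      (fun x : N ↦ TangentSpace (𝓡 n) x)]
  [SecondCountableTopology M] [MeasurableSpace M] [BorelSpace M]
  [T2Space N] [SecondCountableTopology N]
  {w : M → ℝ≥0∞} {p : ℝ} {u : ℕ → M → N} {v : M → N}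
  {D : ∀ k, ∀ x : M, TangentSpace (𝓡 d) x →L[ℝ] TangentSpace (𝓡 n) (u k x)}

/-- The frame coefficients are dominated by the Frobenius norm, and `w vol_g ≤ vol_g`. -/
theorem lpBounded_inner (hp : 1 < p) (hw : IsVolumeWeight d w)
    (hD : ∀ k, IsColocalWeakDeriv (u k) (D k)) {B : ℝ≥0∞} (hB : B ≠ ⊤)
    (hDB : ∀ k, ∫⁻ x, ENNReal.ofReal (frobeniusNorm (D k x) ^ p) ∂riemannianVolume d M ≤ B)
    (a : κ) (l : ι) :
    LpBounded (weightedVolume d w) p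
      fun k x ↦ (inner ℝ (Y.field a (u k x)) (D k x (X.field l x)) : ℝ) := by
  have hac : weightedVolume d w ≪ riemannianVolume d M := withDensity_absolutelyContinuous _ _
  have hp0 : 0 < p := zero_lt_one.trans hp
  refine ⟨fun k ↦ (((hD k).aemeasurable_inner X Y a l).mono_ac hac).aestronglyMeasurable,
    B ^ (1 / p), ENNReal.rpow_ne_top_of_nonneg (by positivity) hB, fun k ↦ ?_⟩
  refine (eLpNorm_mono_measure _ hw.weightedVolume_le).trans ?_
  rw [eLpNorm_eq_lintegral_rpow_enorm_toReal (by simpa using hp0) (by simp),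
    ENNReal.toReal_ofReal hp0.le]
  refine ENNReal.rpow_le_rpow ((lintegral_mono fun x ↦ ?_).trans (hDB k)) (by positivity)
  rw [Real.enorm_eq_ofReal_abs, ENNReal.ofReal_rpow_of_nonneg (abs_nonneg _) hp0.le]
  exact ENNReal.ofReal_le_ofReal (Real.rpow_le_rpow (abs_nonneg _)
    (abs_inner_field_le_frobeniusNorm X Y (D k x) a l) hp0.le)

variable [IsContMDiffRiemannianBundle (𝓡 d) ∞ (EuclideanSpace ℝ (Fin d))
      (fun x : M ↦ TangentSpace (𝓡 d) x)]

/-- If the frame coefficients of `D k` converge weakly to `G`, then the derivatives `D k`, tested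
with any continuous one-form of compact support on the target, converge weakly to the family
synthesized from `G`: the coefficients of the one-form along `u k` are bounded and converge almost
everywhere. -/
theorem tendstoWeakly_oneForm (hp : 1 < p) (hw : IsVolumeWeight d w)
    (hD : ∀ k, IsColocalWeakDeriv (u k) (D k)) {B : ℝ≥0∞} (hB : B ≠ ⊤)
    (hDB : ∀ k, ∫⁻ x, ENNReal.ofReal (frobeniusNorm (D k x) ^ p) ∂riemannianVolume d M ≤ B)
    (hlim : ∀ᵐ x ∂riemannianVolume d M, Filter.Tendsto (fun k ↦ u k x) Filter.atTop (𝓝 (v x)))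
    {𝒰 : Filter ℕ} (h𝒰 : 𝒰 ≤ Filter.atTop) {G : κ → ι → M → ℝ}
    (hG : ∀ a l, Integrable (G a l) (weightedVolume d w))
    (hGw : ∀ a l, TendstoWeakly (weightedVolume d w) 𝒰
      (fun k x ↦ (inner ℝ (Y.field a (u k x)) (D k x (X.field l x)) : ℝ)) (G a l))
    {β : ∀ y : N, TangentSpace (𝓡 n) y →L[ℝ] ℝ} (hβ : IsCompactOneForm Y β) (l : ι) :
    (∀ k, Integrable (fun x ↦ β (u k x) (D k x (X.field l x))) (weightedVolume d w)) ∧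
    Integrable (fun x ↦ β (v x) (synthesis X Y v G x (X.field l x))) (weightedVolume d w) ∧
    TendstoWeakly (weightedVolume d w) 𝒰 (fun k x ↦ β (u k x) (D k x (X.field l x)))
      fun x ↦ β (v x) (synthesis X Y v G x (X.field l x)) := by
  have := hw.isFiniteMeasure
  have hac : weightedVolume d w ≪ riemannianVolume d M := withDensity_absolutelyContinuous _ _
  obtain ⟨S, hS, h0⟩ := hβ.exists_isCompact
  -- By compactness, only finitely many pairs of frame vectors contribute.
  set A : Finset (κ × ι) := (Y.finite_inter_compact hS).toFinset ×ˢ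
    (X.finite_inter_compact (X.isCompact l)).toFinset
  have hA : ∀ (x : M) (y : N), β y ≠ 0 → X.field l x ≠ 0 → Y.supp y ×ˢ X.supp x ⊆ A := by
    intro x y hy hx
    refine Finset.product_subset_product (Y.supp_subset hS ?_) (X.supp_subset (X.isCompact l) ?_)
    · by_contra h; exact hy (h0 y h)
    · by_contra h; exact hx (X.eq_zero l x h)
  have e1 : ∀ k x, β (u k x) (D k x (X.field l x)) = ∑ i ∈ A, β (u k x) (Y.field i.1 (u k x)) *
      (inner ℝ (X.field i.2 x) (X.field l x) : ℝ) *
      (inner ℝ (Y.field i.1 (u k x)) (D k x (X.field i.2 x)) : ℝ) := fun k x ↦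
    apply_apply_field_eq_sum X Y (D k x) (β (u k x)) l A (hA x _)
  have e2 : ∀ x, β (v x) (synthesis X Y v G x (X.field l x)) =
      ∑ i ∈ A, β (v x) (Y.field i.1 (v x)) *
      (inner ℝ (X.field i.2 x) (X.field l x) : ℝ) * G i.1 i.2 x := fun x ↦
    apply_synthesis X Y G (β (v x)) l A (hA x _)
  simp only [e1, e2]
  choose C hC using hβ.exists_bound
  have hbd : ∀ (i : κ × ι) (y : N) (x : M), |β y (Y.field i.1 y) *
      (inner ℝ (X.field i.2 x) (X.field l x) : ℝ)| ≤ C i.1 := by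
    intro i y x
    rw [abs_mul]
    exact mul_le_of_le_one_right (abs_nonneg _) (X.abs_inner_field_le_one i.2 l x) |>.trans
      (hC i.1 y)
  have hm : ∀ (i : κ × ι) (k : ℕ), AEStronglyMeasurable (fun x ↦ β (u k x) (Y.field i.1 (u k x)) *
      (inner ℝ (X.field i.2 x) (X.field l x) : ℝ)) (weightedVolume d w) := by
    intro i k
    refine AEMeasurable.aestronglyMeasurable (AEMeasurable.mono_ac ?_ hac)
    exact ((hD k).aemeasurable_comp (hβ.continuous i.1)).mul
      ((X.contMDiff i.2).inner_bundle (X.contMDiff l)).continuous.aemeasurable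
  have ht : ∀ i : κ × ι, ∀ᵐ x ∂weightedVolume d w, Filter.Tendsto
      (fun k ↦ β (u k x) (Y.field i.1 (u k x)) * (inner ℝ (X.field i.2 x) (X.field l x) : ℝ))
      Filter.atTop (𝓝 (β (v x) (Y.field i.1 (v x)) *
        (inner ℝ (X.field i.2 x) (X.field l x) : ℝ))) := by
    intro i
    filter_upwards [hac.ae_le hlim] with x hx
    exact (((hβ.continuous i.1).tendsto (v x)).comp hx).mul_const _
  have hg := lpBounded_inner X Y hp hw hD hB hDB
  have i1 : ∀ (i : κ × ι) (k : ℕ), Integrable (fun x ↦ β (u k x) (Y.field i.1 (u k x)) *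
      (inner ℝ (X.field i.2 x) (X.field l x) : ℝ) *
      (inner ℝ (Y.field i.1 (u k x)) (D k x (X.field i.2 x)) : ℝ)) (weightedVolume d w) :=
    fun i k ↦ ((hg i.1 i.2).integrable hp k).bdd_mul (hm i k) (ae_of_all _ fun x ↦ hbd i _ x)
  have i2 : ∀ i : κ × ι, Integrable (fun x ↦ β (v x) (Y.field i.1 (v x)) *
      (inner ℝ (X.field i.2 x) (X.field l x) : ℝ) * G i.1 i.2 x) (weightedVolume d w) :=
    fun i ↦ (hG i.1 i.2).bdd_mul (aestronglyMeasurable_of_tendsto_ae Filter.atTop (hm i) (ht i))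
      (ae_of_all _ fun x ↦ hbd i _ x)
  refine ⟨fun k ↦ integrable_finsetSum (ε' := ℝ) A fun i _ ↦ i1 i k,
    integrable_finsetSum (ε' := ℝ) A fun i _ ↦ i2 i, ?_⟩
  exact TendstoWeakly.sum A (fun i _ ↦ (hGw i.1 i.2).mul_bounded h𝒰 (hg i.1 i.2) hp (hm i)
    (fun k x ↦ hbd i _ x) (fun x ↦ hbd i _ x) (ht i)) (fun i _ k ↦ i1 i k) fun i _ ↦ i2 i

/-- Maps with bounded energy which converge almost everywhere: the limit has a colocal weak
derivative, and the energy is lower semicontinuous along the ultrafilter `𝒰`. -/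
theorem exists_isColocalWeakDeriv_of_tendsto [T2Space M] (hp : 1 < p)
    (hD : ∀ k, IsColocalWeakDeriv (u k) (D k)) {B : ℝ≥0∞} (hB : B ≠ ⊤)
    (hDB : ∀ k, ∫⁻ x, ENNReal.ofReal (frobeniusNorm (D k x) ^ p) ∂riemannianVolume d M ≤ B)
    (hlim : ∀ᵐ x ∂riemannianVolume d M, Filter.Tendsto (fun k ↦ u k x) Filter.atTop (𝓝 (v x)))
    {𝒰 : Ultrafilter ℕ} (h𝒰 : (𝒰 : Filter ℕ) ≤ Filter.atTop) {c : ℝ≥0∞}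
    (hc : ∃ᶠ k in (𝒰 : Filter ℕ),
      ∫⁻ x, ENNReal.ofReal (frobeniusNorm (D k x) ^ p) ∂riemannianVolume d M ≤ c) :
    ∃ L : ∀ x : M, TangentSpace (𝓡 d) x →L[ℝ] TangentSpace (𝓡 n) (v x), IsColocalWeakDeriv v L ∧
      ∫⁻ x, ENNReal.ofReal (frobeniusNorm (L x) ^ p) ∂riemannianVolume d M ≤ c := by
  obtain ⟨ι, _, ⟨X⟩⟩ := ParsevalFrame.exists_countable (d := d) (M := M)
  obtain ⟨κ, _, ⟨Y⟩⟩ := ParsevalFrame.exists_countable (d := n) (M := N)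
  obtain ⟨w, hw⟩ := exists_isVolumeWeight d M
  have := hw.isFiniteMeasure
  have hac : weightedVolume d w ≪ riemannianVolume d M := withDensity_absolutelyContinuous _ _
  have hg := lpBounded_inner X Y hp hw hD hB hDB
  choose G hG hGw using fun a l ↦ (hg a l).exists_tendstoWeakly hp 𝒰
  have key := fun (β : ∀ y : N, TangentSpace (𝓡 n) y →L[ℝ] ℝ) (hβ : IsCompactOneForm Y β) ↦
    tendstoWeakly_oneForm X Y hp hw hD hB hDB hlim h𝒰 hG hGw hβ
  have hL : IsColocalWeakDeriv v (synthesis X Y v G) := by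
    intro f hf hcf
    obtain ⟨C, hC⟩ := hf.continuous.bounded_above_of_compact_support hcf
    have h1 := key (differential f) (isCompactOneForm_differential Y hf hcf)
    refine isWeakDeriv_of_tendstoWeakly X hw h𝒰 (fun k ↦ (hD k).isWeakDeriv hf hcf)
      (fun k x ↦ hC (u k x)) ?_ (fun k l ↦ (h1 l).1 k) (fun l ↦ (h1 l).2.1) fun l ↦ (h1 l).2.2
    filter_upwards [hlim] with x hx using (hf.continuous.tendsto (v x)).comp hx
  refine ⟨_, hL, ?_⟩
  have hθ : AEMeasurable (fun x ↦ (w x).toReal⁻¹) (weightedVolume d w) :=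
    hw.measurable.ennreal_toReal.inv.aemeasurable
  have hθ0 : ∀ x, 0 ≤ (w x).toReal⁻¹ := fun x ↦ inv_nonneg.2 ENNReal.toReal_nonneg
  rw [← hw.lintegral_ofReal (hL.aemeasurable_frobeniusNorm.pow_const p)]
  refine lintegral_frobeniusNorm_rpow_le X Y (zero_le_one.trans hp.le) hθ hθ0
    (fun a l ↦ (hL.aemeasurable_inner X Y a l).mono_ac hac) fun S ↦ ?_
  have h2 := fun i : S ↦ key (fun y ↦ innerSL ℝ (Y.field i.1.1 y))
    (isCompactOneForm_inner Y i.1.1) i.1.2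
  have h3 := lintegral_le_of_tendstoWeakly hp (fun i k ↦ (h2 i).1 k) (fun i ↦ (h2 i).2.1)
    (fun i ↦ (h2 i).2.2) hθ.aestronglyMeasurable hθ0 (c := c) (hc.mono fun k hk ↦ ?_)
  · refine le_trans (le_of_eq (lintegral_congr fun x ↦ ?_)) h3
    rw [← Finset.sum_coe_sort S]
    rfl
  · refine le_trans ?_ hk
    rw [← hw.lintegral_ofReal ((hD k).aemeasurable_frobeniusNorm.pow_const p)]
    refine lintegral_mono fun x ↦ ENNReal.ofReal_le_ofReal
      (mul_le_mul_of_nonneg_right ?_ (hθ0 x))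
    refine Real.rpow_le_rpow (Real.sqrt_nonneg _) ?_ (zero_le_one.trans hp.le)
    refine (Real.sqrt_le_sqrt ?_).trans_eq (Real.sqrt_sq (frobeniusNorm_nonneg (D k x)))
    refine le_trans (le_of_eq ?_) (sum_sq_inner_le_frobeniusNorm_sq X Y (D k x) S)
    rw [← Finset.sum_coe_sort S]
    rfl

end WeakLimit

end

/-! ### Lower semicontinuity of the Dirichlet energy -/

theorem lemma2p8 {d n : ℕ}
    {M : Type*} [TopologicalSpace M] [T2Space M] [SecondCountableTopology M] [ConnectedSpace M]
    [ChartedSpace (EuclideanSpace ℝ (Fin d)) M] [IsManifold (𝓡 d) ∞ M]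
    [RiemannianBundle (fun x : M ↦ TangentSpace (𝓡 d) x)]
    [IsContMDiffRiemannianBundle (𝓡 d) ∞ (EuclideanSpace ℝ (Fin d))
      (fun x : M ↦ TangentSpace (𝓡 d) x)]
    [MeasurableSpace M] [BorelSpace M]
    {N : Type*} [TopologicalSpace N] [T2Space N] [SecondCountableTopology N] [ConnectedSpace N]
    [ChartedSpace (EuclideanSpace ℝ (Fin n)) N] [IsManifold (𝓡 n) ∞ N]
    [RiemannianBundle (fun x : N ↦ TangentSpace (𝓡 n) x)]
    [IsContMDiffRiemannianBundle (𝓡 n) ∞ (EuclideanSpace ℝ (Fin n))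
      (fun x : N ↦ TangentSpace (𝓡 n) x)]
    (p : ℝ) (hp : 1 < p) (u : ℕ → M → N) (v : M → N)
    (hu : ∀ k, MemHomSobolev d n p (u k))
    (C : ℝ) (hC : 0 < C)
    (hbound : ∀ k, dirichletEnergy d n p (u k) ≤ ENNReal.ofReal C)
    (hlim : Negligible d {x : M | ¬ Filter.Tendsto (fun k ↦ u k x) Filter.atTop (𝓝 (v x))}) :
    MemHomSobolev d n p v ∧
      dirichletEnergy d n p v ≤
        Filter.liminf (fun k ↦ dirichletEnergy d n p (u k)) Filter.atTop := by
  have hspec : ∀ u : M → N, (∃ D : ∀ x : M, TangentSpace (𝓡 d) x →L[ℝ] TangentSpace (𝓡 n) (u x),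
      IsColocalWeakDeriv u D) → IsColocalWeakDeriv u (colocalWeakDeriv d n u) := by
    intro u h
    have h1 : colocalWeakDeriv d n u = h.choose := by
      funext x
      rw [colocalWeakDeriv, dif_pos h]
    rw [h1]
    exact h.choose_spec
  have hD := fun k ↦ hspec (u k) (hu k).2.1
  have hae : ∀ᵐ x ∂riemannianVolume d M,
      Filter.Tendsto (fun k ↦ u k x) Filter.atTop (𝓝 (v x)) := hlim.riemannianVolume_eq_zero
  have key : ∀ c, Filter.liminf (fun k ↦ dirichletEnergy d n p (u k)) Filter.atTop < c →
      IsColocalWeakDeriv v (colocalWeakDeriv d n v) ∧ dirichletEnergy d n p v ≤ c := by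
    intro c hc
    -- an ultrafilter along which the energies stay below `c`
    have hfreq := Filter.frequently_lt_of_liminf_lt (by isBoundedDefault) hc
    have hne := Filter.frequently_iff_neBot.1 hfreq
    obtain ⟨𝒰, h𝒰⟩ := Ultrafilter.exists_le (Filter.atTop ⊓
      Filter.principal {k | dirichletEnergy d n p (u k) < c})
    have h1 : ∀ᶠ k in (𝒰 : Filter ℕ), dirichletEnergy d n p (u k) < c :=
      (h𝒰.trans inf_le_right) (Filter.mem_principal_self _)
    obtain ⟨L, hL, hLc⟩ := exists_isColocalWeakDeriv_of_tendsto hp hD ENNReal.ofReal_ne_top hbound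
      hae (h𝒰.trans inf_le_left) (h1.mono fun k hk ↦ le_of_lt hk).frequently
    have h2 := hspec v ⟨L, hL⟩
    refine ⟨h2, le_trans (le_of_eq (lintegral_congr_ae ?_)) hLc⟩
    filter_upwards [h2.ae_eq hL] with x hx
    rw [colocalDerivNorm, hx]
  have hle : Filter.liminf (fun k ↦ dirichletEnergy d n p (u k)) Filter.atTop ≤
      ENNReal.ofReal C := by
    exact Filter.liminf_le_of_frequently_le' (Filter.Frequently.of_forall hbound)
  have hv := (key ⊤ (hle.trans_lt ENNReal.ofReal_lt_top)).1
  have henergy : dirichletEnergy d n p v ≤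
      Filter.liminf (fun k ↦ dirichletEnergy d n p (u k)) Filter.atTop :=
    le_of_forall_gt_imp_ge_of_dense fun c hc ↦ (key c hc).2
  have hp0 : 0 < p := zero_lt_one.trans hp
  refine ⟨⟨fun f hf hc e he ↦ ⟨_, hv f hf hc e he⟩, ⟨_, hv⟩,
    hv.aemeasurable_frobeniusNorm.aestronglyMeasurable, ?_⟩, henergy⟩
  rw [eLpNorm_lt_top_iff_lintegral_rpow_enorm_lt_top (by simpa using hp0) (by simp),
    ENNReal.toReal_ofReal hp0.le]
  refine lt_of_eq_of_lt (lintegral_congr fun x ↦ ?_)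
    ((henergy.trans hle).trans_lt ENNReal.ofReal_lt_top)
  rw [Real.enorm_eq_ofReal_abs, ENNReal.ofReal_rpow_of_nonneg (abs_nonneg _) hp0.le,
    abs_of_nonneg (a := colocalDerivNorm d n v x) (frobeniusNorm_nonneg _)]
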